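/- **Setting.** Let $d\ge 1$, $m\ge 0$, $u\in\mathbb R$, and let $\mathbb V\subseteq\mathbb R^d$ be measurable and invariant under the reflection $Rv=(-2u-v_1,v_2,\dots,v_d)$ (for example $\mathbb V=\mathbb R^d$, or $\mathbb V=[-1,1]$ with $d=1$, $u=0$). Let $a(v)=(1+|v|)^{\omega_0}$ with $0\le\omega_0\le1$. Write $\langle f,g\rangle_v=\int_{\mathbb V}f\cdot g\,dv$ and $\langle f,g\rangle_{x,v}=\int_0^\infty\langle f,g\rangle_v\,dx$ for $\mathbb R^m$-valued functions. Let $\mathcal L$ be a linear operator on $(L^2(dv))^m$ with null space $N$, and $\mathcal P$ the orthogonal projection of $(L^2(dv))^m$ onto $N$. Assume: * (A1) $\mathcal L$ is self-adjoint and nonnegative, with domain $\mathcal D(\mathcal L)=\{f\in(L^2(dv))^m: af\in(L^2(dv))^m\}$. * (A2) $\mathcal L$ is bounded from $(L^2(a\,dv))^m$ to $(L^2(\frac1a dv))^m$ (that is, $\mathcal L$ on $\mathcal D(\mathcal L)$ extends to such an operator, again denoted $\mathcal L$). * (A3) $N$ is finite dimensional and $N\subseteq(L^p(dv))^m$ for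 all $p\in[1,\infty)$. * (A4) There is $\sigma_0>0$ with $\langle f,\mathcal Lf\rangle_v\ge\sigma_0\|f-\mathcal Pf\|^2_{(L^2(a\,dv))^m}$ for all $f\in(L^2(a\,dv))^m$. Assume also $(v_1+u)f\in (L^2(dv))^m$ for all $f\in N$, so that $\mathcal P_1f=\mathcal P((v_1+u)f)$ is a symmetric operator on $N$. Let $X_1,\dots,X_\nu$ be an orthonormal basis of $N$ with $\mathcal P_1X_k=\gamma_kX_k$. The $X_k$ with $\gamma_k>0$, $\gamma_k<0$, $\gamma_k=0$ are also written $X_{+,k}$, $X_{-,k}$, $X_{0,k}$. Let $\mathcal L^{-1}$ be the pseudo-inverse of $\mathcal L$ (with values in $N^\perp$), and assume $(v_1+u)\mathcal L^{-1}((v_1+u)X_{0,k})\in(L^2(\frac1a dv))^m$ for all $k$. (Both additional assumptions follow from (A1)–(A4) if $\omega_0=1$.) For $\alpha>0$ let $$\mathcal L_df=\mathcal Lf+\alpha\sum_{w}w\,\langle w,f\rangle_v ,$$ where $w$ runs through all $(v_1+u)X_{+,k}$, $(v_1+u)X_{-,k}$, $(v_1+u)X_{0,k}$ and $(v_1+u)\mathcal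 L^{-1}((v_1+u)X_{0,k})$. Call $\mathcal L_d$ coercive if there is $\sigma_1>0$ with $\langle f,\mathcal L_df\rangle_v\ge\sigma_1\|f\|^2_{(L^2(a\,dv))^m}$ for all $f\in\mathcal D(\mathcal L)$. Let $f^\pm(v)=\frac12(f(v)\pm f(Rv))$ and $$\Gamma=\{f\in(L^2(a\,dv\,dx))^m:\ (v_1+u)\partial_xf^+\in(L^2(\tfrac1a\,dv\,dx))^m\},\qquad x\in(0,\infty),\ v\in\mathbb V,$$ with the derivative in the sense of distributions. Traces at $x=0$ are elements of $(L^2(|v_1+u|\,dv))^m$, defined through Green's formula: for $w\in (L^2(a\,dv\,dx))^m$ with $(v_1+u)\partial_xw\in(L^2(\frac1a dv\,dx))^m$, the trace $w|_{x=0}$ satisfies $$\langle (v_1+u)w,\partial_x\eta\rangle_{x,v}+\langle(v_1+u)\partial_xw,\eta\rangle_{x,v}=-\langle(v_1+u)\,w|_{x=0},\,\eta|_{x=0}\rangle_v\qquad\text{for all }\eta\in (C_c^\infty(\mathbb R\times\mathbb R^d))^m.$$ For $f,\psi\in\Gamma$ and a function $\phi$ let $$B(f,\psi)=-\langle f^-,(v_1+u)\partial_x\psi^+\rangle_{x,v}+\langle(v_1+u)\partial_xf^+,\psi^-\rangle_{x,v}+\langle\psi,\mathcal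 L_df\rangle_{x,v}+\langle|v_1+u|f^+|_{x=0},\psi^+|_{x=0}\rangle_v,$$ $$l(\psi)=2\int_{v\in\mathbb V,\ v_1+u>0}(v_1+u)\,\phi\cdot\psi^+|_{x=0}\,dv.$$ **Proposition 3.3 (Well-posedness of the damped equation).** For every $g\in\Gamma$ the derivative $(v_1+u)\partial_xg^+$ and the trace $g^+|_{x=0}$ exist and are unique in the spaces above. There is $\alpha_0>0$ such that $\mathcal L_d$ is coercive for all $0<\alpha\le\alpha_0$. Moreover, let $\alpha>0$ be such that $\mathcal L_d$ is coercive, and let $\phi\in(L^2(a\mathbf 1_{v_1+u>0}dv))^m\cap(L^2((v_1+u)\mathbf 1_{v_1+u>0}dv))^m$ (the second space contains the first if $\omega_0=1$). Then: (a) There is a unique $f\in\Gamma$ such that $B(f,\psi)=l(\psi)$ for all $\psi\in\Gamma$. (b) This $f$ satisfies $(v_1+u)\partial_xf\in(L^2(\frac1a dv\,dx))^m$, it solves $(v_1+u)\partial_xf+\mathcal L_df=0$ in the sense of distributions on $(0,\infty)\times\mathbb V$ (tested with all $\eta\in(C_c^\infty((0,\infty)\times\mathbb R^d))^m$), and it has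 a trace at $x=0$ that equals $\phi(v)$ for almost every $v\in\mathbb V$ with $v_1+u>0$. (c) If $a(v)=1+|v|$, then there is $\beta>0$ such that $f\in (L^2(e^{2\beta x}dx;L^2(a\,dv)))^m$. -/

import Mathlib

open MeasureTheory Set
open scoped ENNReal

noncomputable section

namespace HalfSpace

/-- The space `ℝ^d` of velocities. Its first coordinate `v₁` is `v 0`. -/
abbrev Vel (d : ℕ) : Type := EuclideanSpace ℝ (Fin d)

/-- The space `ℝ^m` of values (`m` species). -/
abbrev Val (m : ℕ) : Type := EuclideanSpace ℝ (Fin m)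

/-- The weight `(1 + |v|)^q`. The weight `a` is the case `q = ω₀`, and `1/a` is the case
`q = -ω₀`. -/
def wt {d : ℕ} (q : ℝ) (v : Vel d) : ℝ := (1 + ‖v‖) ^ q

/-- The measure `(1 + |v|)^q dv` on the velocity set `V`. -/
def velMeasure {d : ℕ} (V : Set (Vel d)) (q : ℝ) : Measure (Vel d) :=
  (volume.restrict V).withDensity fun v => ENNReal.ofReal (wt q v)

/-- The measure `|v₁ + u| dv` on the velocity set `V`. -/
def fluxMeasure {d : ℕ} [NeZero d] (V : Set (Vel d)) (u : ℝ) : Measure (Vel d) :=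
  (volume.restrict V).withDensity fun v => ENNReal.ofReal |v 0 + u|

/-- The incoming velocities, `v₁ + u > 0`. -/
def incoming (d : ℕ) [NeZero d] (u : ℝ) : Set (Vel d) := {v | 0 < v 0 + u}

/-- `(L²(dv))^m` on the velocity set `V`. -/
abbrev L2v {d : ℕ} (m : ℕ) (V : Set (Vel d)) := Lp (Val m) 2 (volume.restrict V)

/-- `(L²((1 + |v|)^q dv))^m` on the velocity set `V`. -/
abbrev L2w {d : ℕ} (m : ℕ) (V : Set (Vel d)) (q : ℝ) := Lp (Val m) 2 (velMeasure V q)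

/-- `(L²((1 + |v|)^q dv dx))^m` for `x ∈ (0, ∞)` and `v ∈ V`, in the form
`L²(dx; (L²((1 + |v|)^q dv))^m)`. -/
abbrev L2xw {d : ℕ} (m : ℕ) (V : Set (Vel d)) (q : ℝ) :=
  Lp (L2w m V q) 2 (volume.restrict (Ioi (0 : ℝ)))

/-- `(L²(|v₁ + u| dv))^m` on the velocity set `V`. -/
abbrev L2flux {d : ℕ} [NeZero d] (m : ℕ) (V : Set (Vel d)) (u : ℝ) :=
  Lp (Val m) 2 (fluxMeasure V u)

/-! ### The collision operator -/

section Collision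

variable {d m : ℕ} {V : Set (Vel d)}

/-- The null space of the (unbounded) operator `L`. -/
def nullSpace (L : L2v m V →ₗ.[ℝ] L2v m V) : Submodule ℝ (L2v m V) :=
  (LinearMap.ker L.toFun).map L.domain.subtype

/-- The orthogonal projection `P` of `(L²(dv))^m` onto the null space of `L`. The closure changes
nothing, because the null space of a self-adjoint operator is closed; it is there to make the
projection available. -/
def nullProj (L : L2v m V →ₗ.[ℝ] L2v m V) : L2v m V →L[ℝ] L2v m V :=
  (nullSpace L).topologicalClosure.starProjection

/-- (A1): `L` is self-adjoint and nonnegative, with domain `{f ∈ L² : a f ∈ L²}`. -/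
def AssumptionA1 (ω₀ : ℝ) (L : L2v m V →ₗ.[ℝ] L2v m V) : Prop :=
  IsSelfAdjoint L ∧
  (∀ f : L.domain, 0 ≤ inner ℝ (f : L2v m V) (L f)) ∧
  ∀ f : L2v m V, f ∈ L.domain ↔ MemLp (fun v => wt ω₀ v • f v) 2 (volume.restrict V)

/-- (A2): `L` is bounded from `(L²(a dv))^m` to `(L²(1/a dv))^m`. The bounded operator `La` between
these spaces agrees with `L` on the domain of `L`, which is dense in `(L²(a dv))^m`, so that
`La` is the unique bounded extension of `L`. -/
def AssumptionA2 (ω₀ : ℝ) (L : L2v m V →ₗ.[ℝ] L2v m V) (La : L2w m V ω₀ →L[ℝ] L2w m V (-ω₀)) :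
    Prop :=
  ∀ (f : L.domain) (g : L2w m V ω₀), ((f : L2v m V) : Vel d → Val m) =ᵐ[volume.restrict V] g →
    (La g : Vel d → Val m) =ᵐ[volume.restrict V] (L f : Vel d → Val m)

/-- (A3): the null space of `L` is finite dimensional and contained in `L^p` for all
`p ∈ [1, ∞)`. -/
def AssumptionA3 (L : L2v m V →ₗ.[ℝ] L2v m V) : Prop :=
  FiniteDimensional ℝ (nullSpace L) ∧
  ∀ f ∈ nullSpace L, ∀ p : ℝ≥0∞, 1 ≤ p → p ≠ ∞ → MemLp f p (volume.restrict V)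

/-- (A4): spectral gap, `⟨f, L f⟩ ≥ σ ‖f - P f‖²` in the norm of `(L²(a dv))^m`, for all `f` in
`(L²(a dv))^m`. Here `f'` is `f` seen as an element of the larger space `(L²(dv))^m`. -/
def AssumptionA4 (ω₀ : ℝ) (L : L2v m V →ₗ.[ℝ] L2v m V) (La : L2w m V ω₀ →L[ℝ] L2w m V (-ω₀)) :
    Prop :=
  ∃ σ : ℝ, 0 < σ ∧ ∀ (f : L2w m V ω₀) (f' : L2v m V),
    (f : Vel d → Val m) =ᵐ[volume.restrict V] f' →
      σ * ∫ v in V, wt ω₀ v * ‖f' v - nullProj L f' v‖ ^ 2 ≤ ∫ v in V, inner ℝ (f v) (La f v)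

open Classical in
/-- The class in `(L²(dv))^m` of a square integrable function. -/
def toL2 (V : Set (Vel d)) (g : Vel d → Val m) : L2v m V :=
  if h : MemLp g 2 (volume.restrict V) then h.toLp g else 0

open Classical in
/-- The pseudo-inverse of `L`: `L⁻¹ g` is the element `y` of the domain of `L` that is orthogonal
to the null space and satisfies `L y = g - P g`. It is unique, and it exists for every `g` if `L`
is self-adjoint with a spectral gap. -/
def pinv (L : L2v m V →ₗ.[ℝ] L2v m V) (g : L2v m V) : L2v m V :=
  if h : ∃ y : L.domain, (y : L2v m V) ∈ (nullSpace L)ᗮ ∧ L y = g - nullProj L g then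
    (h.choose : L2v m V) else 0

end Collision

section Damping

variable {d m : ℕ} [NeZero d] {V : Set (Vel d)}

/-- Multiplication by `v₁ + u`. -/
def shiftMul (u : ℝ) (f : Vel d → Val m) : Vel d → Val m := fun v => (v 0 + u) • f v

/-- `P₁ f = P((v₁ + u) f)`. -/
def momentOp (u : ℝ) (L : L2v m V →ₗ.[ℝ] L2v m V) (f : L2v m V) : L2v m V :=
  nullProj L (toL2 V (shiftMul u f))

/-- `X` is an orthonormal basis of the null space of `L` that consists of eigenfunctions of `P₁`,
with the eigenvalues `γ`. The `X i` with `γ i > 0`, `γ i < 0` and `γ i = 0` are the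
functions `X_{+,k}`, `X_{-,k}` and `X_{0,k}`, which span `H⁺`, `H⁻` and `H⁰`. -/
structure IsEigenbasis (u : ℝ) (L : L2v m V →ₗ.[ℝ] L2v m V) {ν : ℕ} (X : Fin ν → L2v m V)
    (γ : Fin ν → ℝ) : Prop where
  orthonormal : Orthonormal ℝ X
  span_eq : Submodule.span ℝ (range X) = nullSpace L
  eigen : ∀ i, momentOp u L (X i) = γ i • X i

/-- `L⁻¹((v₁ + u) X)`. -/
def pinvShift (u : ℝ) (L : L2v m V →ₗ.[ℝ] L2v m V) (X : L2v m V) : L2v m V :=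
  pinv L (toL2 V (shiftMul u X))

/-- The rank one term `w ⟨w, f⟩`. -/
def rankOne (V : Set (Vel d)) (w f : Vel d → Val m) : Vel d → Val m :=
  fun v => (∫ v' in V, inner ℝ (w v') (f v')) • w v

/-- The damped operator `L_d`, applied to `f ∈ (L²(a dv))^m`. -/
def damped {ω₀ : ℝ} (u : ℝ) (L : L2v m V →ₗ.[ℝ] L2v m V) (La : L2w m V ω₀ →L[ℝ] L2w m V (-ω₀))
    {ν : ℕ} (X : Fin ν → L2v m V) (γ : Fin ν → ℝ) (α : ℝ) (f : L2w m V ω₀) : Vel d → Val m :=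
  fun v => La f v
    + α • ∑ k with 0 < γ k, rankOne V (shiftMul u (X k)) f v
    + α • ∑ k with γ k < 0, rankOne V (shiftMul u (X k)) f v
    + α • ∑ k with γ k = 0, rankOne V (shiftMul u (X k)) f v
    + α • ∑ k with γ k = 0, rankOne V (shiftMul u (pinvShift u L (X k))) f v

/-- Coercivity of the damped operator: `⟨f, L_d f⟩ ≥ σ ‖f‖²` in the norm of `(L²(a dv))^m`, for all
`f` in the domain of `L`. -/
def Coercive {ω₀ : ℝ} (u : ℝ) (L : L2v m V →ₗ.[ℝ] L2v m V) (La : L2w m V ω₀ →L[ℝ] L2w m V (-ω₀))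
    {ν : ℕ} (X : Fin ν → L2v m V) (γ : Fin ν → ℝ) (α : ℝ) : Prop :=
  ∃ σ : ℝ, 0 < σ ∧ ∀ f : L2w m V ω₀,
    (∃ f' : L.domain, (f : Vel d → Val m) =ᵐ[volume.restrict V] ((f' : L2v m V) : Vel d → Val m)) →
      σ * ‖f‖ ^ 2 ≤ ∫ v in V, inner ℝ (f v) (damped u L La X γ α f v)

/-! ### Even and odd parts, transport derivative and trace -/

/-- The reflection `v ↦ (-2u - v₁, v₂, …, v_d)`. -/
def reflect (u : ℝ) (v : Vel d) : Vel d :=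
  v - (2 * (v 0 + u)) • EuclideanSpace.single (0 : Fin d) (1 : ℝ)

theorem reflect_apply_zero (u : ℝ) (v : Vel d) : reflect u v 0 = -2 * u - v 0 := by
  simp [reflect]; ring

theorem reflect_apply_ne (u : ℝ) (v : Vel d) {i : Fin d} (hi : i ≠ 0) :
    reflect u v i = v i := by
  simp [reflect, hi]

/-- The shifted even part `f⁺`. -/
def evenPart (u : ℝ) (f : Vel d → Val m) : Vel d → Val m :=
  fun v => (1 / 2 : ℝ) • (f v + f (reflect u v))

/-- The shifted odd part `f⁻`. -/
def oddPart (u : ℝ) (f : Vel d → Val m) : Vel d → Val m :=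
  fun v => (1 / 2 : ℝ) • (f v - f (reflect u v))

/-- `(v₁ + u) ∂ₓ w = g` on `(0, ∞) × V` in the sense of distributions, that is,
`∫∫ (v₁ + u) w · ∂ₓη dv dx = - ∫∫ g · η dv dx` for all smooth `η` with compact support in
`(0, ∞) × ℝ^d`. -/
def HasTransportDeriv (V : Set (Vel d)) (u : ℝ) (w g : ℝ → Vel d → Val m) : Prop :=
  ∀ η : ℝ × Vel d → Val m, ContDiff ℝ (⊤ : ℕ∞) η → HasCompactSupport η →
    tsupport η ⊆ Ioi (0 : ℝ) ×ˢ univ →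
      ∫ x in Ioi (0 : ℝ), ∫ v in V, (v 0 + u) * inner ℝ (w x v) (deriv (fun s => η (s, v)) x) =
        - ∫ x in Ioi (0 : ℝ), ∫ v in V, inner ℝ (g x v) (η (x, v))

/-- `t` is the trace at `x = 0` of `w`, where `g = (v₁ + u) ∂ₓ w`: Green's formula
`∫∫ ((v₁ + u) w · ∂ₓη + g · η) dv dx = - ∫ (v₁ + u) t · η|_{x=0} dv` holds for all smooth `η` with
compact support in `ℝ × ℝ^d` (not necessarily zero at `x = 0`). -/
def IsTrace (V : Set (Vel d)) (u : ℝ) (w g : ℝ → Vel d → Val m) (t : Vel d → Val m) : Prop :=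
  ∀ η : ℝ × Vel d → Val m, ContDiff ℝ (⊤ : ℕ∞) η → HasCompactSupport η →
    (∫ x in Ioi (0 : ℝ), ∫ v in V, (v 0 + u) * inner ℝ (w x v) (deriv (fun s => η (s, v)) x)) +
      ∫ x in Ioi (0 : ℝ), ∫ v in V, inner ℝ (g x v) (η (x, v)) =
        - ∫ v in V, (v 0 + u) * inner ℝ (t v) (η (0, v))

/-! ### The variational problem -/

variable {ω₀ : ℝ}

/-- The space `Γ` of all `f ∈ (L²(a dv dx))^m` with `(v₁ + u) ∂ₓ f⁺ ∈ (L²(1/a dv dx))^m`. -/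
def Gam (u : ℝ) : Set (L2xw m V ω₀) :=
  {f | ∃ g : L2xw m V (-ω₀), HasTransportDeriv V u (fun x => evenPart u (f x)) fun x => g x}

open Classical in
/-- `(v₁ + u) ∂ₓ f⁺` for `f ∈ Γ`. -/
def dEven (u : ℝ) (f : L2xw m V ω₀) : L2xw m V (-ω₀) :=
  if h : ∃ g : L2xw m V (-ω₀), HasTransportDeriv V u (fun x => evenPart u (f x)) fun x => g x then
    h.choose else 0

/-- `t` is the trace `f⁺|_{x=0}` of `f ∈ Γ`. -/
def IsEvenTrace (u : ℝ) (f : L2xw m V ω₀) (t : L2flux m V u) : Prop :=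
  IsTrace V u (fun x => evenPart u (f x)) (fun x => dEven u f x) t

open Classical in
/-- The trace operator `T f = f⁺|_{x=0}` from `Γ` to `(L²(|v₁ + u| dv))^m`. -/
def traceEven (u : ℝ) (f : L2xw m V ω₀) : L2flux m V u :=
  if h : ∃ t : L2flux m V u, IsEvenTrace u f t then h.choose else 0

/-- The bilinear form
`B(f, ψ) = -⟨f⁻, (v₁+u) ∂ₓψ⁺⟩ + ⟨(v₁+u) ∂ₓf⁺, ψ⁻⟩ + ⟨ψ, L_d f⟩ + ⟨|v₁+u| f⁺, ψ⁺⟩_{x=0}`. -/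
def bilin (u : ℝ) (L : L2v m V →ₗ.[ℝ] L2v m V) (La : L2w m V ω₀ →L[ℝ] L2w m V (-ω₀))
    {ν : ℕ} (X : Fin ν → L2v m V) (γ : Fin ν → ℝ) (α : ℝ) (f ψ : L2xw m V ω₀) : ℝ :=
  -(∫ x in Ioi (0 : ℝ), ∫ v in V, inner ℝ (oddPart u (f x) v) (dEven u ψ x v))
    + (∫ x in Ioi (0 : ℝ), ∫ v in V, inner ℝ (dEven u f x v) (oddPart u (ψ x) v))
    + (∫ x in Ioi (0 : ℝ), ∫ v in V, inner ℝ (ψ x v) (damped u L La X γ α (f x) v))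
    + ∫ v in V, |v 0 + u| * inner ℝ (traceEven u f v) (traceEven u ψ v)

/-- The functional `l(ψ) = 2 ∫_{v₁+u>0} (v₁ + u) φ · ψ⁺|_{x=0} dv`. -/
def load (u : ℝ) (φ : Vel d → Val m) (ψ : L2xw m V ω₀) : ℝ :=
  2 * ∫ v in incoming d u ∩ V, (v 0 + u) * inner ℝ (φ v) (traceEven u ψ v)

/-- `f ∈ Γ` and `B(f, ψ) = l(ψ)` for every `ψ ∈ Γ`. -/
def IsVarSolution (u : ℝ) (L : L2v m V →ₗ.[ℝ] L2v m V) (La : L2w m V ω₀ →L[ℝ] L2w m V (-ω₀))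
    {ν : ℕ} (X : Fin ν → L2v m V) (γ : Fin ν → ℝ) (α : ℝ) (φ : Vel d → Val m)
    (f : L2xw m V ω₀) : Prop :=
  f ∈ Gam u ∧ ∀ ψ ∈ Gam (V := V) (m := m) (ω₀ := ω₀) u, bilin u L La X γ α f ψ = load u φ ψ

/-- The damped equation `(v₁ + u) ∂ₓf + L_d f = 0` on `(0, ∞) × V` in the sense of
distributions. -/
def SolvesDamped (u : ℝ) (L : L2v m V →ₗ.[ℝ] L2v m V) (La : L2w m V ω₀ →L[ℝ] L2w m V (-ω₀))
    {ν : ℕ} (X : Fin ν → L2v m V) (γ : Fin ν → ℝ) (α : ℝ) (f : L2xw m V ω₀) : Prop :=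
  ∀ η : ℝ × Vel d → Val m, ContDiff ℝ (⊤ : ℕ∞) η → HasCompactSupport η →
    tsupport η ⊆ Ioi (0 : ℝ) ×ˢ univ →
      -(∫ x in Ioi (0 : ℝ), ∫ v in V,
          (v 0 + u) * inner ℝ (f x v) (deriv (fun s => η (s, v)) x)) +
        ∫ x in Ioi (0 : ℝ), ∫ v in V, inner ℝ (damped u L La X γ α (f x) v) (η (x, v)) = 0

end Damping

end HalfSpace

end

open HalfSpace

noncomputable section

namespace HalfSpace

open Filter Topology
open scoped NNReal

/-! ### Absolutely continuous functions with values in a Hilbert space -/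

section Calculus

variable {K : Type*} [NormedAddCommGroup K] [InnerProductSpace ℝ K] [CompleteSpace K]

/-! Solvability is an inf-sup argument. In B(f, f) the two transport terms cancel, so coercivity of
L_d controls f and its trace, but not g = (v₁+u)∂ₓf⁺, which is part of the norm of Γ. Since f⁺ is
even and v₁+u is odd under R, g is odd. Hence ψ = f + δ g/a lies in Γ, has the same even part and
trace as f, and B(f, ψ) gains δ‖g‖². For small δ this dominates the cross term with L_d. The map f ↦
f + δ g/a is invertible on Γ, so Lax–Milgram applies to B composed with it
(`existsUnique_mixedForm`). To have a complete space, Γ is represented by triples (f, g, t) of a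
function, a derivative and a trace, a closed subspace of a product of L² spaces
(`isClosed_gamTriple`).

Traces come from placing (v₁+u)w and its x-derivative in the single Hilbert space L²((1+|v|)⁻² dv).
There a weakly differentiable curve is a primitive of its derivative
(`IsWeakDeriv.exists_primitive`) and has a boundary value c. An energy identity with the regularized
weight 1/(|v₁+u| + ε(1+|v|)²), bounded uniformly in ε, followed by Fatou's lemma shows that c =
(v₁+u)t with t in L²(|v₁+u| dv) (`exists_traceK_eq`).

For (b), products θ(x)z(v) are used as test functions. The odd part of f in the first term of B and
the even part in the second recombine to the full transport term (`IsWeakSol.tensor`). Cutoffs θ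
vanishing near 0 give the equation, hence a trace of f itself; θ(0) = 1 gives a boundary identity,
from which even z extract the incoming values (`trace_eq_of_inner`).

For (c), if a = 1+|v|, multiplication by v₁+u is bounded by (1+|u|)a, so L_d − β(v₁+u) stays
coercive for small β > 0. Its solution times e^{-βx} solves the original problem, and uniqueness
identifies it with f (`exists_exp_isWeakSol`).

For coercivity of L_d, the spectral gap controls f − Pf, and the damping terms need only control the
finite dimensional space N. If they all vanish on n = ∑ c_k X_k, then γ_k c_k = 0, so P₁n = 0; with
y = L⁻¹((v₁+u)n) one gets ⟨y, Ly⟩ = 0, so y = 0, (v₁+u)n = 0 and n = 0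
(`IsEigenbasis.eq_zero_of_damping`). Injectivity in finite dimension gives a lower bound, which is
combined with the gap in `exists_coercive_add`. The pseudo-inverse exists because a self-adjoint
operator with a gap is onto Nᗮ (`IsSelfAdjoint.exists_map_eq`). -/

theorem inner_intervalIntegral_intervalIntegral {G₁ G₂ : ℝ → K} {X : ℝ} (hX : 0 ≤ X)
    (h₁ : IntegrableOn G₁ (Ioc 0 X)) (h₂ : IntegrableOn G₂ (Ioc 0 X)) :
    inner ℝ (∫ s in (0 : ℝ)..X, G₁ s) (∫ s in (0 : ℝ)..X, G₂ s) =
      ∫ s in (0 : ℝ)..X, (inner ℝ (G₁ s) (∫ r in (0 : ℝ)..s, G₂ r) +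
        inner ℝ (∫ r in (0 : ℝ)..s, G₁ r) (G₂ s)) := by
  set μ : Measure ℝ := volume.restrict (Ioc 0 X) with hμ
  have hP : Integrable (fun p : ℝ × ℝ => inner ℝ (G₁ p.1) (G₂ p.2)) (μ.prod μ) :=
    Integrable.op_fst_snd (op := fun x y : K => inner ℝ x y)
      (continuous_fst.inner (𝕜 := ℝ) continuous_snd)
      ⟨1, fun x y => by simpa using norm_inner_le_norm (𝕜 := ℝ) x y⟩ h₁ h₂
  -- The square is cut along its diagonal. Fubini in one order on the lower triangle and in the
  -- other order on the upper one gives the two terms of the product rule.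
  have hms : MeasurableSet {p : ℝ × ℝ | p.2 ≤ p.1} := measurableSet_le measurable_snd measurable_fst
  have hi₁ : ∀ s ∈ Ioc 0 X, ∫ r, {p : ℝ × ℝ | p.2 ≤ p.1}.indicator
      (fun p => inner ℝ (G₁ p.1) (G₂ p.2)) (s, r) ∂μ = inner ℝ (G₁ s) (∫ r in (0 : ℝ)..s, G₂ r) := by
    intro s hs
    rw [intervalIntegral.integral_of_le hs.1.le, ← integral_inner (h₂.mono_set
      (Ioc_subset_Ioc_right hs.2))]
    have : (fun r => {p : ℝ × ℝ | p.2 ≤ p.1}.indicator (fun p => inner ℝ (G₁ p.1) (G₂ p.2)) (s, r))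
        = (Iic s).indicator fun r => inner ℝ (G₁ s) (G₂ r) := by
      ext r; simp [indicator]
    rw [this, integral_indicator measurableSet_Iic, hμ, Measure.restrict_restrict measurableSet_Iic]
    congr 2
    ext r; simp only [mem_inter_iff, mem_Iic, mem_Ioc]; grind
  have hi₂ : ∀ s ∈ Ioc 0 X, ∫ r, {p : ℝ × ℝ | p.2 ≤ p.1}ᶜ.indicator
      (fun p => inner ℝ (G₁ p.1) (G₂ p.2)) (r, s) ∂μ = inner ℝ (∫ r in (0 : ℝ)..s, G₁ r) (G₂ s) := by
    intro s hs
    rw [intervalIntegral.integral_of_le hs.1.le, real_inner_comm,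
      integral_Ioc_eq_integral_Ioo (y := s), ← integral_inner (h₁.mono_set (Ioo_subset_Ioc_self.trans (Ioc_subset_Ioc_right hs.2)))]
    have : (fun r => {p : ℝ × ℝ | p.2 ≤ p.1}ᶜ.indicator
        (fun p => inner ℝ (G₁ p.1) (G₂ p.2)) (r, s))
        = (Iio s).indicator fun r => inner ℝ (G₂ s) (G₁ r) := by
      ext r; simp [indicator, real_inner_comm]
    rw [this, integral_indicator measurableSet_Iio, hμ, Measure.restrict_restrict measurableSet_Iio]
    congr 2
    ext r; simp only [mem_inter_iff, mem_Iio, mem_Ioc, mem_Ioo]; grind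
  have hI₁ := (hP.indicator hms).integral_prod_left
  have hI₂ := (hP.indicator hms.compl).integral_prod_right
  have e₁ := integral_prod _ (hP.indicator hms)
  have e₂ := integral_prod_symm _ (hP.indicator hms.compl)
  have hc₁ := setIntegral_congr_fun (μ := volume) measurableSet_Ioc hi₁
  have hc₂ := setIntegral_congr_fun (μ := volume) measurableSet_Ioc hi₂
  have hJ₁ : IntegrableOn (fun s => inner ℝ (G₁ s) (∫ r in (0 : ℝ)..s, G₂ r)) (Ioc 0 X) :=
    (integrableOn_congr_fun hi₁ measurableSet_Ioc).1 hI₁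
  have hJ₂ : IntegrableOn (fun s => inner ℝ (∫ r in (0 : ℝ)..s, G₁ r) (G₂ s)) (Ioc 0 X) :=
    (integrableOn_congr_fun hi₂ measurableSet_Ioc).1 hI₂
  have etot : inner ℝ (∫ s in (0 : ℝ)..X, G₁ s) (∫ s in (0 : ℝ)..X, G₂ s)
      = ∫ p, inner ℝ (G₁ p.1) (G₂ p.2) ∂(μ.prod μ) := by
    rw [integral_prod _ hP, intervalIntegral.integral_of_le hX,
      intervalIntegral.integral_of_le hX, real_inner_comm, ← integral_inner h₁]
    refine integral_congr_ae (Eventually.of_forall fun s => ?_)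
    simp only
    rw [real_inner_comm, ← integral_inner h₂]
  rw [etot, intervalIntegral.integral_of_le hX, integral_add hJ₁ hJ₂, ← hc₁, ← hc₂, ← e₁, ← e₂,
    ← integral_add (hP.indicator hms) (hP.indicator hms.compl)]
  refine integral_congr_ae (Eventually.of_forall fun p => ?_)
  simp

/-- The product rule for primitives of integrable functions. -/
theorem inner_primitive_sub {G₁ G₂ : ℝ → K} {X : ℝ} (hX : 0 ≤ X)
    (h₁ : IntegrableOn G₁ (Ioc 0 X)) (h₂ : IntegrableOn G₂ (Ioc 0 X)) (c₁ c₂ : K) :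
    inner ℝ (c₁ + ∫ s in (0 : ℝ)..X, G₁ s) (c₂ + ∫ s in (0 : ℝ)..X, G₂ s) - inner ℝ c₁ c₂ =
      ∫ s in (0 : ℝ)..X, (inner ℝ (G₁ s) (c₂ + ∫ r in (0 : ℝ)..s, G₂ r) +
        inner ℝ (c₁ + ∫ r in (0 : ℝ)..s, G₁ r) (G₂ s)) := by
  have i₁ : IntervalIntegrable G₁ volume 0 X := (intervalIntegrable_iff_integrableOn_Ioc_of_le hX).2 h₁
  have i₂ : IntervalIntegrable G₂ volume 0 X := (intervalIntegrable_iff_integrableOn_Ioc_of_le hX).2 h₂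
  have p₁ : ContinuousOn (fun s => ∫ r in (0 : ℝ)..s, G₁ r) (uIcc 0 X) :=
    intervalIntegral.continuousOn_primitive_interval (((integrableOn_Icc_iff_integrableOn_Ioc (by simp)).2 h₁).mono_set
      (by rw [uIcc_of_le hX]))
  have p₂ : ContinuousOn (fun s => ∫ r in (0 : ℝ)..s, G₂ r) (uIcc 0 X) :=
    intervalIntegral.continuousOn_primitive_interval (((integrableOn_Icc_iff_integrableOn_Ioc (by simp)).2 h₂).mono_set
      (by rw [uIcc_of_le hX]))
  have bd : ∀ {F G : ℝ → K}, IntervalIntegrable G volume 0 X → ContinuousOn F (uIcc 0 X) →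
      IntervalIntegrable (fun s => inner ℝ (G s) (F s)) volume 0 X := by
    intro F G hG hF
    obtain ⟨C, hC⟩ := isCompact_uIcc.exists_bound_of_continuousOn hF
    have hG' := hG.1
    rw [intervalIntegrable_iff] at hG ⊢
    refine Integrable.mono' (hG.norm.const_mul C) (hG.aestronglyMeasurable.inner
      ((hF.mono uIoc_subset_uIcc).aestronglyMeasurable measurableSet_uIoc)) ?_
    filter_upwards [ae_restrict_mem measurableSet_uIoc] with s hs
    have := hC s (uIoc_subset_uIcc hs)
    calc ‖inner ℝ (G s) (F s)‖ ≤ ‖G s‖ * ‖F s‖ := norm_inner_le_norm _ _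
      _ ≤ C * ‖G s‖ := by rw [mul_comm]; gcongr
  have b₁ := bd i₁ p₂
  have b₂ : IntervalIntegrable (fun s => inner ℝ (∫ r in (0 : ℝ)..s, G₁ r) (G₂ s)) volume 0 X := by
    simpa [real_inner_comm] using bd i₂ p₁
  have b₃ := bd i₁ (continuousOn_const (c := c₂))
  have b₄ : IntervalIntegrable (fun s => inner ℝ c₁ (G₂ s)) volume 0 X := by
    simpa [real_inner_comm] using bd i₂ (continuousOn_const (c := c₁))
  have split : ∀ s, (inner ℝ (G₁ s) (c₂ + ∫ r in (0 : ℝ)..s, G₂ r) +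
        inner ℝ (c₁ + ∫ r in (0 : ℝ)..s, G₁ r) (G₂ s)) =
      (inner ℝ (G₁ s) (∫ r in (0 : ℝ)..s, G₂ r) + inner ℝ (∫ r in (0 : ℝ)..s, G₁ r) (G₂ s))
        + (inner ℝ (G₁ s) c₂ + inner ℝ c₁ (G₂ s)) := by
    intro s; rw [inner_add_right, inner_add_left]; ring
  simp_rw [split]
  rw [intervalIntegral.integral_add (b₁.add b₂) (b₃.add b₄),
    ← inner_intervalIntegral_intervalIntegral hX h₁ h₂, intervalIntegral.integral_add b₃ b₄]
  have e₃ : ∫ s in (0 : ℝ)..X, inner ℝ (G₁ s) c₂ = inner ℝ (∫ s in (0 : ℝ)..X, G₁ s) c₂ := by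
    rw [intervalIntegral.integral_of_le hX, intervalIntegral.integral_of_le hX, real_inner_comm,
      ← integral_inner h₁]
    simp_rw [real_inner_comm]
  have e₄ : ∫ s in (0 : ℝ)..X, inner ℝ c₁ (G₂ s) = inner ℝ c₁ (∫ s in (0 : ℝ)..X, G₂ s) := by
    rw [intervalIntegral.integral_of_le hX, intervalIntegral.integral_of_le hX,
      ← integral_inner h₂]
  rw [e₃, e₄]
  simp only [inner_add_left, inner_add_right]
  ring

/-- Green's formula for a function `W` with derivative `G` on `(0, ∞)` and boundary value `c`,
tested with smooth scalar functions. -/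
def IsGreen (W G : ℝ → K) (c : K) : Prop :=
  ∀ θ : ℝ → ℝ, ContDiff ℝ (⊤ : ℕ∞) θ → HasCompactSupport θ →
    (∫ x in Ioi (0 : ℝ), deriv θ x • W x) + ∫ x in Ioi (0 : ℝ), θ x • G x = -(θ 0 • c)

/-- Green's formula for test functions that vanish near `0`. -/
def IsWeakDeriv (W G : ℝ → K) : Prop :=
  ∀ θ : ℝ → ℝ, ContDiff ℝ (⊤ : ℕ∞) θ → HasCompactSupport θ → tsupport θ ⊆ Ioi 0 →
    (∫ x in Ioi (0 : ℝ), deriv θ x • W x) + ∫ x in Ioi (0 : ℝ), θ x • G x = 0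

omit [CompleteSpace K] in
theorem integrable_inner_of_memLp {α : Type*} [MeasurableSpace α] {μ : Measure α} {f g : α → K}
    (hf : MemLp f 2 μ) (hg : MemLp g 2 μ) : Integrable (fun x => inner ℝ (f x) (g x)) μ := by
  refine (MemLp.integrable_mul hf.norm hg.norm).mono' (hf.1.inner hg.1) ?_
  exact Eventually.of_forall fun x => norm_inner_le_norm _ _

omit [InnerProductSpace ℝ K] [CompleteSpace K] in
theorem integrableOn_Ioi_smul [NormedSpace ℝ K] {W : ℝ → K} (hW : ∀ X, IntegrableOn W (Ioc 0 X))
    {θ : ℝ → ℝ} (hθ : Continuous θ) (hs : HasCompactSupport θ) :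
    IntegrableOn (fun x => θ x • W x) (Ioi 0) := by
  obtain ⟨b, hb⟩ := hs.isCompact.bddAbove
  obtain ⟨C, hC⟩ := hs.exists_bound_of_continuous hθ
  have h : IntegrableOn (fun x => θ x • W x) (Ioc 0 b) :=
    (hW b).bdd_smul C hθ.aestronglyMeasurable (Eventually.of_forall hC)
  refine h.of_forall_sdiff_eq_zero measurableSet_Ioi fun x hx => ?_
  have : x ∉ tsupport θ := fun h => hx.2 ⟨hx.1, hb h⟩
  simp [image_eq_zero_of_notMem_tsupport this]

/-- Integration by parts up to a point beyond the support of k, by the product rule for the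
primitives of G and k'. It upgrades Green's formula from scalar test functions to differentiable
test curves with values in K. -/
theorem green_of_primitive {W G : ℝ → K} {c : K}
    (hW : ∀ᵐ x ∂volume.restrict (Ioi (0 : ℝ)), W x = c + ∫ s in (0 : ℝ)..x, G s)
    (hG : ∀ X, IntegrableOn G (Ioc 0 X)) {k k' : ℝ → K} (hk : ∀ x, HasDerivAt k (k' x) x)
    (hk' : Continuous k') (hs : HasCompactSupport k) :
    (∫ x in Ioi (0 : ℝ), inner ℝ (W x) (k' x)) + ∫ x in Ioi (0 : ℝ), inner ℝ (G x) (k x) =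
      -inner ℝ c (k 0) := by
  obtain ⟨X, hX0, hX⟩ : ∃ X : ℝ, 0 < X ∧ ∀ x, X ≤ x → k x = 0 ∧ k' x = 0 := by
    obtain ⟨b, hb⟩ := hs.isCompact.bddAbove
    refine ⟨max b 0 + 1, by positivity, fun x hx => ?_⟩
    have hx' : x ∉ tsupport k := fun h => by
      have := hb h
      have := le_max_left b 0
      linarith
    refine ⟨image_eq_zero_of_notMem_tsupport hx', ?_⟩
    have : deriv k x = 0 := by
      have h2 : x ∉ tsupport (deriv k) := fun h => hx' (tsupport_deriv_subset h)
      exact image_eq_zero_of_notMem_tsupport h2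
    rw [← (hk x).deriv, this]
  have hkc : Continuous k := continuous_iff_continuousAt.2 fun x => (hk x).continuousAt
  have hFTC : ∀ x, k 0 + ∫ s in (0 : ℝ)..x, k' s = k x := fun x => by
    rw [intervalIntegral.integral_eq_sub_of_hasDerivAt (fun y _ => hk y)
      (hk'.intervalIntegrable _ _)]; abel
  have key := inner_primitive_sub hX0.le (hG X) (hk'.integrableOn_Ioc (a := 0) (b := X)) c (k 0)
  simp_rw [hFTC, (hX X le_rfl).1, inner_zero_right, zero_sub] at key
  have hcut : ∀ f : ℝ → ℝ, (∀ x, X ≤ x → f x = 0) →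
      ∫ x in Ioi (0 : ℝ), f x = ∫ x in Ioc 0 X, f x := fun f hf =>
    (setIntegral_eq_of_subset_of_forall_sdiff_eq_zero measurableSet_Ioi Ioc_subset_Ioi_self
      fun x hx => hf x (by
        by_contra h
        exact hx.2 ⟨hx.1, (not_le.1 h).le⟩))
  rw [hcut _ fun x hx => by rw [(hX x hx).2, inner_zero_right],
    hcut _ fun x hx => by rw [(hX x hx).1, inner_zero_right], key,
    intervalIntegral.integral_of_le hX0.le]
  have hWX : ∀ᵐ x ∂volume.restrict (Ioc 0 X), W x = c + ∫ s in (0 : ℝ)..x, G s :=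
    ae_restrict_of_ae_restrict_of_subset Ioc_subset_Ioi_self hW
  have pc : ContinuousOn (fun x => c + ∫ s in (0 : ℝ)..x, G s) (Icc 0 X) := by
    have := intervalIntegral.continuousOn_primitive_interval (μ := volume) (f := G) (a := 0) (b := X)
      ((integrableOn_Icc_iff_integrableOn_Ioc (by simp)).2 (hG X) |>.mono_set (by rw [uIcc_of_le hX0.le]))
    rw [uIcc_of_le hX0.le] at this
    exact continuousOn_const.add this
  rw [integral_congr_ae (g := fun x => inner ℝ (c + ∫ s in (0 : ℝ)..x, G s) (k' x))
    (hWX.mono fun x hx => by simp only [hx]), add_comm, ← integral_add]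
  · obtain ⟨C, hC⟩ := isCompact_Icc.exists_bound_of_continuousOn (hkc.continuousOn (s := Icc 0 X))
    refine Integrable.mono' ((hG X).norm.const_mul C) ((hG X).aestronglyMeasurable.inner
      hkc.aestronglyMeasurable) ?_
    filter_upwards [ae_restrict_mem measurableSet_Ioc] with s hs
    have := hC s (Ioc_subset_Icc_self hs)
    calc ‖inner ℝ (G s) (k s)‖ ≤ ‖G s‖ * ‖k s‖ := norm_inner_le_norm _ _
      _ ≤ C * ‖G s‖ := by rw [mul_comm]; gcongr
  · exact ((pc.inner hk'.continuousOn).integrableOn_Icc).mono_set Ioc_subset_Icc_self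

theorem IsGreen.of_primitive {W G : ℝ → K} {c : K}
    (hW : ∀ᵐ x ∂volume.restrict (Ioi (0 : ℝ)), W x = c + ∫ s in (0 : ℝ)..x, G s)
    (hG : ∀ X, IntegrableOn G (Ioc 0 X)) (hWi : ∀ X, IntegrableOn W (Ioc 0 X)) :
    IsGreen W G c := by
  intro θ hθ hs
  have hd : ∀ x, HasDerivAt θ (deriv θ x) x := fun x =>
    (hθ.differentiable (by simp)).differentiableAt.hasDerivAt
  have hc' : Continuous (deriv θ) := hθ.continuous_deriv (by simp)
  have i₁ := integrableOn_Ioi_smul hWi hc' hs.deriv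
  have i₂ := integrableOn_Ioi_smul hG hθ.continuous hs
  refine ext_inner_left ℝ fun y => ?_
  have key := green_of_primitive hW hG (k := fun x => θ x • y) (k' := fun x => deriv θ x • y)
    (fun x => (hd x).smul_const y) (hc'.smul continuous_const) hs.smul_right
  rw [inner_add_right, ← integral_inner i₁, ← integral_inner i₂, inner_neg_right, inner_smul_right]
  simp_rw [inner_smul_right] at key ⊢
  simpa only [real_inner_comm] using key

/-- A weakly differentiable function is a primitive of its derivative. -/
theorem IsWeakDeriv.exists_primitive {W G : ℝ → K} (h : IsWeakDeriv W G)
    (hG : ∀ X, IntegrableOn G (Ioc 0 X)) (hW : ∀ X, IntegrableOn W (Ioc 0 X)) :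
    ∃ c, ∀ᵐ x ∂volume.restrict (Ioi (0 : ℝ)), W x = c + ∫ s in (0 : ℝ)..x, G s := by
  -- The du Bois-Reymond argument: F has the weak derivative G, so W - F has weak derivative zero
  -- and has to be constant.
  set F : ℝ → K := fun x => ∫ s in (0 : ℝ)..x, G s with hF
  have hFc : ∀ X, ContinuousOn F (Icc 0 X) := fun X => by
    rcases le_or_gt 0 X with hX | hX
    · have := intervalIntegral.continuousOn_primitive_interval (μ := volume) (f := G) (a := 0)
        (b := X) ((integrableOn_Icc_iff_integrableOn_Ioc (by simp)).2 (hG X) |>.mono_set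
          (by rw [uIcc_of_le hX]))
      rwa [uIcc_of_le hX] at this
    · simp [Icc_eq_empty (not_le.2 hX)]
  have hFi : ∀ X, IntegrableOn F (Ioc 0 X) := fun X =>
    (hFc X).integrableOn_Icc.mono_set Ioc_subset_Icc_self
  have hFG : IsGreen F G 0 := IsGreen.of_primitive (Eventually.of_forall fun x => by simp [hF]) hG hFi
  have hDi : ∀ X, IntegrableOn (fun x => W x - F x) (Ioc 0 X) := fun X => (hW X).sub (hFi X)
  have hD : ∀ θ : ℝ → ℝ, ContDiff ℝ (⊤ : ℕ∞) θ → HasCompactSupport θ → tsupport θ ⊆ Ioi 0 →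
      ∫ x in Ioi (0 : ℝ), deriv θ x • (W x - F x) = 0 := by
    intro θ hθ hs ht
    have hc' : Continuous (deriv θ) := hθ.continuous_deriv (by simp)
    have e₁ := h θ hθ hs ht
    have e₂ := hFG θ hθ hs
    simp_rw [smul_sub]
    rw [integral_sub (integrableOn_Ioi_smul hW hc' hs.deriv) (integrableOn_Ioi_smul hFi hc' hs.deriv)]
    rw [smul_zero, neg_zero] at e₂
    rw [eq_neg_of_add_eq_zero_left e₁, eq_neg_of_add_eq_zero_left e₂, sub_self]
  obtain ⟨θ₁, ht₁, hs₁, hθ₁, hr₁, h1⟩ := exists_contDiff_tsupport_subset (n := ⊤)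
    (Ioi_mem_nhds (zero_lt_one' ℝ))
  have hI₁ : 0 < ∫ x, θ₁ x := hθ₁.continuous.integral_pos_of_hasCompactSupport_nonneg_nonzero hs₁
    (fun x => (hr₁ ⟨x, rfl⟩).1) (x := 1) (by rw [h1]; exact one_ne_zero)
  -- The constant is read off as the mean of W - F against one fixed bump θ₁ supported in the open
  -- half-line.
  refine ⟨(∫ x, θ₁ x)⁻¹ • ∫ x in Ioi (0 : ℝ), θ₁ x • (W x - F x), ?_⟩
  set c := (∫ x, θ₁ x)⁻¹ • ∫ x in Ioi (0 : ℝ), θ₁ x • (W x - F x) with hc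
  have hloc : LocallyIntegrableOn (fun x => W x - F x - c) (Ioi 0) := by
    rw [locallyIntegrableOn_iff isOpen_Ioi.isLocallyClosed]
    intro k hk hkc
    obtain ⟨b, hb⟩ := hkc.bddAbove
    exact ((hDi b).sub (integrableOn_const (by simp))).mono_set fun x hx => ⟨hk hx, hb hx⟩
  have hz := isOpen_Ioi.ae_eq_zero_of_integral_contDiff_smul_eq_zero hloc (fun θ hθ hs ht => ?_)
  · rw [ae_restrict_iff' measurableSet_Ioi]
    filter_upwards [hz] with x hx hx0
    have := hx hx0
    rw [sub_sub, sub_eq_zero] at this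
    rw [this, add_comm]
  · rw [← setIntegral_eq_integral_of_forall_compl_eq_zero (s := Ioi 0) fun x hx => by
      rw [image_eq_zero_of_notMem_tsupport fun h => hx (ht h), zero_smul]]
    -- Subtracting r θ₁ makes the integral of θ zero, so that the primitive Θ of the difference
    -- again has compact support in the open half-line and is an admissible test function.
    set r : ℝ := (∫ x, θ x) / ∫ x, θ₁ x with hr
    set φ : ℝ → ℝ := fun x => θ x - r * θ₁ x with hφ
    have hφd : ContDiff ℝ (⊤ : ℕ∞) φ := hθ.sub (contDiff_const.mul hθ₁)
    obtain ⟨a, b, ha, hab⟩ : ∃ a b : ℝ, 0 < a ∧ tsupport θ ∪ tsupport θ₁ ⊆ Icc a b := by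
      have hcp : IsCompact (tsupport θ ∪ tsupport θ₁) := hs.isCompact.union hs₁.isCompact
      have hne : (tsupport θ ∪ tsupport θ₁).Nonempty :=
        ⟨1, Or.inr (subset_tsupport _ (by simp [h1]))⟩
      refine ⟨sInf (tsupport θ ∪ tsupport θ₁), sSup (tsupport θ ∪ tsupport θ₁), ?_, fun x hx =>
        ⟨csInf_le hcp.bddBelow hx, le_csSup hcp.bddAbove hx⟩⟩
      exact (union_subset ht ht₁) (hcp.sInf_mem hne)
    have hφ0 : ∀ x, x ∉ Icc a b → φ x = 0 := fun x hx => by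
      have h₁ : x ∉ tsupport θ := fun h => hx (hab (Or.inl h))
      have h₂ : x ∉ tsupport θ₁ := fun h => hx (hab (Or.inr h))
      simp [hφ, image_eq_zero_of_notMem_tsupport h₁, image_eq_zero_of_notMem_tsupport h₂]
    have iθ := hθ.continuous.integrable_of_hasCompactSupport (μ := volume) hs
    have iθ₁ := hθ₁.continuous.integrable_of_hasCompactSupport (μ := volume) hs₁
    have hφI : ∫ x, φ x = 0 := by
      rw [hφ, integral_sub iθ (iθ₁.const_mul r), integral_const_mul, hr,
        div_mul_cancel₀ _ hI₁.ne', sub_self]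
    set Θ : ℝ → ℝ := fun x => ∫ s in (0 : ℝ)..x, φ s with hΘ
    have hΘd : ∀ x, HasDerivAt Θ (φ x) x := fun x =>
      intervalIntegral.integral_hasDerivAt_right (hφd.continuous.intervalIntegrable _ _)
        (hφd.continuous.stronglyMeasurableAtFilter _ _) hφd.continuous.continuousAt
    have hΘd' : deriv Θ = φ := funext fun x => (hΘd x).deriv
    have hΘs : ContDiff ℝ (⊤ : ℕ∞) Θ :=
      contDiff_infty_iff_deriv.2 ⟨fun x => (hΘd x).differentiableAt, by rw [hΘd']; exact hφd⟩
    have hΘ0 : ∀ x, x ∉ Icc a b → Θ x = 0 := fun x hx => by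
      rcases lt_or_ge x a with hxa | hxa
      · refine intervalIntegral.integral_zero_ae (Eventually.of_forall fun s hs => hφ0 s fun hs' => ?_)
        rcases mem_uIoc.1 hs with h | h
        · linarith [hs'.1, h.2]
        · linarith [hs'.1, h.2]
      · have hxb : b < x := not_le.1 fun h => hx ⟨hxa, h⟩
        rw [hΘ]
        simp only
        rw [intervalIntegral.integral_of_le (by linarith), ← hφI]
        refine setIntegral_eq_integral_of_forall_compl_eq_zero fun s hs => hφ0 s fun hs' => hs ?_
        exact ⟨by linarith [hs'.1], by linarith [hs'.2]⟩
    have hΘt : tsupport Θ ⊆ Icc a b := closure_minimal (fun x hx => by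
      by_contra hx'
      exact hx (hΘ0 x hx')) isClosed_Icc
    have hΘc : HasCompactSupport Θ := isCompact_Icc.of_isClosed_subset (isClosed_tsupport _) hΘt
    have := hD Θ hΘs hΘc (hΘt.trans fun x hx => lt_of_lt_of_le ha hx.1)
    rw [hΘd'] at this
    simp only [hφ, sub_smul, mul_smul] at this
    have j₁ := integrableOn_Ioi_smul hDi hθ.continuous hs
    have j₂ := integrableOn_Ioi_smul hDi hθ₁.continuous hs₁
    have j₃ : IntegrableOn (fun x => r • θ₁ x • (W x - F x)) (Ioi 0) := j₂.smul r
    rw [integral_sub j₁ j₃, integral_smul, sub_eq_zero] at this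
    have k₁ : ∫ x in Ioi (0 : ℝ), θ x = ∫ x, θ x :=
      setIntegral_eq_integral_of_forall_compl_eq_zero fun x hx =>
        image_eq_zero_of_notMem_tsupport fun h => hx (ht h)
    simp_rw [smul_sub _ _ c]
    rw [integral_sub j₁ (iθ.integrableOn.smul_const c), integral_smul_const, k₁, this, hc, smul_smul,
      hr, div_eq_mul_inv, sub_self]

omit [InnerProductSpace ℝ K] [CompleteSpace K] in
theorem integrableOn_Ioc_of_memLp {W : ℝ → K} (hW : MemLp W 2 (volume.restrict (Ioi 0))) (X : ℝ) :
    IntegrableOn W (Ioc 0 X) := by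
  have h : MemLp W 2 (volume.restrict (Ioc 0 X)) :=
    hW.mono_measure (Measure.restrict_mono Ioc_subset_Ioi_self le_rfl)
  exact h.integrable (by norm_num)

/-- The boundary value of a square integrable function with square integrable derivative. -/
theorem inner_boundary_eq {W G : ℝ → K} {c : K}
    (hWc : ∀ᵐ x ∂volume.restrict (Ioi (0 : ℝ)), W x = c + ∫ s in (0 : ℝ)..x, G s)
    (hW : MemLp W 2 (volume.restrict (Ioi 0))) (hG : MemLp G 2 (volume.restrict (Ioi 0)))
    (κ : K →L[ℝ] K) (hκ : ∀ x y, inner ℝ (κ x) y = inner ℝ x (κ y)) :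
    inner ℝ (κ c) c = -2 * ∫ x in Ioi (0 : ℝ), inner ℝ (κ (W x)) (G x) := by
  set F : ℝ → K := fun x => c + ∫ s in (0 : ℝ)..x, G s with hF
  have hGX := integrableOn_Ioc_of_memLp hG
  have hint : Integrable (fun x => inner ℝ (κ (W x)) (G x)) (volume.restrict (Ioi 0)) :=
    integrable_inner_of_memLp (κ.comp_memLp' hW) hG
  have hq : ∀ X, 0 ≤ X → inner ℝ (κ (F X)) (F X) =
      inner ℝ (κ c) c + 2 * ∫ s in (0 : ℝ)..X, inner ℝ (κ (W s)) (G s) := by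
    intro X hX
    have hκF : ∀ x, 0 ≤ x → κ (F x) = κ c + ∫ s in (0 : ℝ)..x, κ (G s) := fun x hx => by
      rw [hF, map_add, intervalIntegral.integral_of_le hx, intervalIntegral.integral_of_le hx,
        κ.integral_comp_comm (hGX x)]
    have := inner_primitive_sub hX (κ.integrable_comp (hGX X)) (hGX X) (κ c) c
    rw [← hκF X hX] at this
    have e : ∫ s in (0 : ℝ)..X, (inner ℝ (κ (G s)) (c + ∫ r in (0 : ℝ)..s, G r) +
        inner ℝ (κ c + ∫ r in (0 : ℝ)..s, κ (G r)) (G s)) =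
        ∫ s in (0 : ℝ)..X, 2 * inner ℝ (κ (W s)) (G s) := by
      rw [intervalIntegral.integral_of_le hX, intervalIntegral.integral_of_le hX]
      refine integral_congr_ae ?_
      filter_upwards [ae_restrict_mem measurableSet_Ioc,
        ae_restrict_of_ae_restrict_of_subset Ioc_subset_Ioi_self hWc] with s hs hs'
      rw [← hκF s hs.1.le, hs', hκ, real_inner_comm]
      simp only [hF]; ring
    rw [e, intervalIntegral.integral_const_mul] at this
    linarith
  -- The quadratic expression has a limit at infinity and is integrable there, so the limit is 0; no
  -- separate decay statement for F is needed.
  have hlim : Tendsto (fun X => inner ℝ (κ (F X)) (F X)) atTop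
      (𝓝 (inner ℝ (κ c) c + 2 * ∫ x in Ioi (0 : ℝ), inner ℝ (κ (W x)) (G x))) := by
    have := ((intervalIntegral_tendsto_integral_Ioi 0 hint tendsto_id).const_mul 2).const_add
      (inner ℝ (κ c) c)
    refine this.congr' ?_
    filter_upwards [eventually_ge_atTop 0] with X hX using (hq X hX).symm
  have hqi : IntegrableOn (fun X => inner ℝ (κ (F X)) (F X)) (Ioi 0) := by
    refine (integrable_inner_of_memLp (κ.comp_memLp' hW) hW).congr (hWc.mono fun x hx => ?_)
    simp only [hF, Function.comp_apply, hx]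
  have h0 := IntegrableAtFilter.eq_zero_of_tendsto ⟨Ioi 0, Ioi_mem_atTop 0, hqi⟩ (fun s hs => by
    rcases mem_atTop_sets.1 hs with ⟨b, hb⟩
    rw [← top_le_iff, ← Real.volume_Ici (a := b)]
    exact measure_mono hb) hlim
  linarith

end Calculus

/-! ### Bounded operators between weighted spaces -/

section OpL2

variable {α E F : Type*} [MeasurableSpace α] [NormedAddCommGroup E] [NormedSpace ℝ E]
  [NormedAddCommGroup F] [NormedSpace ℝ F] {M₁ M₂ : Measure α}

/-- The norm bound alone makes T respect almost everywhere equality: a function that vanishes almost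
everywhere has norm 0, and so has its image. Hence T descends to classes. -/
theorem exists_opL2 (T : (α → E) →ₗ[ℝ] (α → F)) (C : ℝ≥0)
    (hT : ∀ f, MemLp f 2 M₁ → MemLp (T f) 2 M₂ ∧ eLpNorm (T f) 2 M₂ ≤ C * eLpNorm f 2 M₁) :
    ∃ T' : Lp E 2 M₁ →L[ℝ] Lp F 2 M₂, ∀ f, T' f =ᵐ[M₂] T f := by
  have hT0 : ∀ f, f =ᵐ[M₁] 0 → T f =ᵐ[M₂] 0 := fun f hf => by
    obtain ⟨h₁, h₂⟩ := hT f (MemLp.ae_eq hf.symm MemLp.zero)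
    rw [eLpNorm_congr_ae hf, eLpNorm_zero, mul_zero, nonpos_iff_eq_zero,
      eLpNorm_eq_zero_iff h₁.1 (by norm_num)] at h₂
    exact h₂
  have hcongr : ∀ f g, f =ᵐ[M₁] g → T f =ᵐ[M₂] T g := fun f g h => by
    have := hT0 (f - g) (by filter_upwards [h] with x hx; simp [hx])
    rw [map_sub] at this
    filter_upwards [this] with x hx
    simpa [sub_eq_zero] using hx
  refine ⟨LinearMap.mkContinuous
    { toFun := fun f => (hT f (Lp.memLp f)).1.toLp
      map_add' := fun f g => ?_
      map_smul' := fun c f => ?_ } C fun f => ?_, fun f => MemLp.coeFn_toLp (hT f (Lp.memLp f)).1⟩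
  · rw [← MemLp.toLp_add, MemLp.toLp_eq_toLp_iff, ← map_add]
    exact hcongr _ _ (Lp.coeFn_add f g)
  · rw [RingHom.id_apply, ← MemLp.toLp_const_smul, MemLp.toLp_eq_toLp_iff, ← map_smul]
    exact hcongr _ _ (Lp.coeFn_smul c f)
  · have := (hT f (Lp.memLp f)).2
    change ‖(hT f (Lp.memLp f)).1.toLp‖ ≤ C * ‖f‖
    rw [Lp.norm_toLp, Lp.norm_def]
    have h2 := ENNReal.toReal_mono (ENNReal.mul_ne_top ENNReal.coe_ne_top (Lp.memLp f).2.ne) this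
    simpa using h2

end OpL2

/-- `M` is the measure with the continuous density `ρ` on `V`, which is positive almost
everywhere. -/
structure IsDens {d : ℕ} (V : Set (Vel d)) (M : Measure (Vel d)) (ρ : Vel d → ℝ) : Prop where
  eq : M = (volume.restrict V).withDensity fun v => ENNReal.ofReal (ρ v)
  cont : Continuous ρ
  nonneg : ∀ v, 0 ≤ ρ v
  pos : ∀ᵐ v ∂volume.restrict V, 0 < ρ v

/-! ### Weighted measures, multiplication and reflection. -/

section Weights

variable {d m : ℕ} {V : Set (Vel d)} {M M₁ M₂ : Measure (Vel d)} {ρ ρ₁ ρ₂ : Vel d → ℝ}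

/-- A density that is positive almost everywhere creates no new null sets. This allows functions in
differently weighted spaces to be compared almost everywhere on V. -/
theorem IsDens.ae_eq (h : IsDens V M ρ) : ae M = ae (volume.restrict V) := by
  ext s
  change (∀ᵐ v ∂M, v ∈ s) ↔ ∀ᵐ v ∂volume.restrict V, v ∈ s
  rw [h.eq, ae_withDensity_iff (h.cont.measurable.ennreal_ofReal)]
  constructor
  · intro H
    filter_upwards [H, h.pos] with v h₁ h₂
    exact h₁ (by simpa using h₂)
  · intro H
    filter_upwards [H] with v h₁ _ using h₁

theorem IsDens.isLocallyFiniteMeasure (h : IsDens V M ρ) : IsLocallyFiniteMeasure M := by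
  rw [h.eq]
  exact IsLocallyFiniteMeasure.withDensity_ofReal h.cont

theorem IsDens.aestronglyMeasurable_iff (h : IsDens V M ρ) {f : Vel d → Val m} :
    AEStronglyMeasurable f M ↔ AEStronglyMeasurable f (volume.restrict V) :=
  ⟨fun hf => hf.mono_ac (Measure.ae_le_iff_absolutelyContinuous.1 h.ae_eq.ge),
    fun hf => hf.mono_ac (Measure.ae_le_iff_absolutelyContinuous.1 h.ae_eq.le)⟩

theorem IsDens.eLpNorm_eq (h : IsDens V M ρ) (f : Vel d → Val m) :
    eLpNorm f 2 M = (∫⁻ v in V, ENNReal.ofReal (ρ v) * ‖f v‖ₑ ^ (2 : ℝ)) ^ (1 / 2 : ℝ) := by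
  rw [eLpNorm_eq_lintegral_rpow_enorm_toReal (by norm_num) (by norm_num), h.eq,
    lintegral_withDensity_eq_lintegral_mul_non_measurable _ h.cont.measurable.ennreal_ofReal
      (Eventually.of_forall fun v => ENNReal.ofReal_lt_top)]
  simp

theorem IsDens.integral_eq (h : IsDens V M ρ) (f : Vel d → ℝ) :
    ∫ v, f v ∂M = ∫ v in V, ρ v * f v := by
  rw [h.eq, integral_withDensity_eq_integral_toReal_smul h.cont.measurable.ennreal_ofReal
      (Eventually.of_forall fun v => ENNReal.ofReal_lt_top)]
  simp [ENNReal.toReal_ofReal (h.nonneg _)]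

theorem IsDens.inner_eq (h : IsDens V M ρ) (f g : Lp (Val m) 2 M) :
    inner ℝ f g = ∫ v in V, ρ v * inner ℝ (f v) (g v) := by
  rw [L2.inner_def, h.integral_eq]

theorem IsDens.integrable_iff (h : IsDens V M ρ) {f : Vel d → ℝ} :
    Integrable f M ↔ Integrable (fun v => ρ v * f v) (volume.restrict V) := by
  rw [h.eq, integrable_withDensity_iff_integrable_smul' h.cont.measurable.ennreal_ofReal
      (Eventually.of_forall fun v => ENNReal.ofReal_lt_top)]
  simp [ENNReal.toReal_ofReal (h.nonneg _)]

theorem exists_mulOp (h₁ : IsDens V M₁ ρ₁) (h₂ : IsDens V M₂ ρ₂) {b : Vel d → ℝ}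
    (hb : Measurable b) {C : ℝ} (hC : ∀ v, b v ^ 2 * ρ₂ v ≤ C * ρ₁ v) :
    ∃ T : Lp (Val m) 2 M₁ →L[ℝ] Lp (Val m) 2 M₂,
      ∀ f, T f =ᵐ[volume.restrict V] fun v => b v • f v := by
  wlog hC0 : 0 ≤ C generalizing C
  · exact this (C := |C|) (fun v => (hC v).trans (by gcongr; exacts [h₁.nonneg v, le_abs_self C]))
      (abs_nonneg C)
  have key : ∀ f : Vel d → Val m, eLpNorm (fun v => b v • f v) 2 M₂ ≤
      (Real.toNNReal C ^ (1 / 2 : ℝ) : ℝ≥0) * eLpNorm f 2 M₁ := fun f => by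
    rw [h₁.eLpNorm_eq, h₂.eLpNorm_eq, ENNReal.coe_rpow_of_nonneg _ (by norm_num),
      ← ENNReal.mul_rpow_of_nonneg _ _ (by norm_num), ← lintegral_const_mul' _ _ ENNReal.coe_ne_top]
    refine ENNReal.rpow_le_rpow (lintegral_mono fun v => ?_) (by norm_num)
    rw [enorm_smul, ENNReal.mul_rpow_of_nonneg _ _ (by norm_num), ← mul_assoc, ← mul_assoc]
    refine mul_le_mul_left ?_ _
    rw [Real.enorm_eq_ofReal_abs, ENNReal.ofReal_rpow_of_nonneg (abs_nonneg _) (by norm_num),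
      ← ENNReal.ofReal_mul (h₂.nonneg v)]
    change _ ≤ ENNReal.ofReal C * _
    rw [← ENNReal.ofReal_mul hC0]
    refine ENNReal.ofReal_le_ofReal ?_
    have := hC v
    rw [Real.rpow_two, sq_abs, mul_comm]
    exact this
  obtain ⟨T, hT⟩ := exists_opL2 (M₁ := M₁) (M₂ := M₂) (E := Val m) (F := Val m)
    { toFun := fun f v => b v • f v
      map_add' := fun f g => by ext1 v; simp
      map_smul' := fun c f => by ext1 v; exact smul_comm (b v) c (f v) } _ (fun f hf => ⟨⟨
        h₂.aestronglyMeasurable_iff.2 (hb.aestronglyMeasurable.smul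
          (h₁.aestronglyMeasurable_iff.1 hf.1)), (key f).trans_lt
            (ENNReal.mul_lt_top ENNReal.coe_lt_top hf.2)⟩, key f⟩)
  exact ⟨T, fun f => by have := hT f; rwa [h₂.ae_eq] at this⟩

/-- The change of variables by the involution R moves the reflection from f onto the density, where
it costs at most the factor C. -/
theorem exists_compOp (h : IsDens V M ρ) {R : Vel d → Vel d} (hR : MeasurePreserving R
    (volume.restrict V) (volume.restrict V)) (hRR : ∀ v, R (R v) = v)
    {C : ℝ} (hC : ∀ v, ρ (R v) ≤ C * ρ v) :
    ∃ T : Lp (Val m) 2 M →L[ℝ] Lp (Val m) 2 M,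
      ∀ f, T f =ᵐ[volume.restrict V] fun v => f (R v) := by
  wlog hC0 : 0 ≤ C generalizing C
  · exact this (C := |C|) (fun v => (hC v).trans (by gcongr; exacts [h.nonneg v, le_abs_self C]))
      (abs_nonneg C)
  have hRe : MeasurableEmbedding R :=
    (MeasurableEquiv.mk ⟨R, R, hRR, hRR⟩ hR.measurable hR.measurable).measurableEmbedding
  have key : ∀ f : Vel d → Val m, eLpNorm (fun v => f (R v)) 2 M ≤
      (Real.toNNReal C ^ (1 / 2 : ℝ) : ℝ≥0) * eLpNorm f 2 M := fun f => by
    rw [h.eLpNorm_eq, h.eLpNorm_eq, ENNReal.coe_rpow_of_nonneg _ (by norm_num),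
      ← ENNReal.mul_rpow_of_nonneg _ _ (by norm_num), ← lintegral_const_mul' _ _ ENNReal.coe_ne_top]
    have e : ∫⁻ v in V, ENNReal.ofReal (ρ v) * ‖f (R v)‖ₑ ^ (2 : ℝ) =
        ∫⁻ v in V, ENNReal.ofReal (ρ (R v)) * ‖f v‖ₑ ^ (2 : ℝ) := by
      rw [← hR.lintegral_comp_emb hRe (fun v => ENNReal.ofReal (ρ v) * ‖f (R v)‖ₑ ^ (2 : ℝ))]
      simp only [hRR]
    rw [e]
    refine ENNReal.rpow_le_rpow (lintegral_mono fun v => ?_) (by norm_num)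
    rw [← mul_assoc]
    refine mul_le_mul_left ?_ _
    change _ ≤ ENNReal.ofReal C * _
    rw [← ENNReal.ofReal_mul hC0]
    exact ENNReal.ofReal_le_ofReal (hC v)
  obtain ⟨T, hT⟩ := exists_opL2 (M₁ := M) (M₂ := M) (E := Val m) (F := Val m)
    { toFun := fun f v => f (R v)
      map_add' := fun f g => by ext1 v; simp
      map_smul' := fun c f => by ext1 v; simp } _ (fun f hf => ⟨⟨
        h.aestronglyMeasurable_iff.2 ((h.aestronglyMeasurable_iff.1 hf.1).comp_measurePreserving hR),
        (key f).trans_lt (ENNReal.mul_lt_top ENNReal.coe_lt_top hf.2)⟩, key f⟩)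
  exact ⟨T, fun f => by have := hT f; rwa [h.ae_eq] at this⟩

theorem wt_pos (q : ℝ) (v : Vel d) : 0 < wt q v := Real.rpow_pos_of_pos (by positivity) _

theorem wt_add (q r : ℝ) (v : Vel d) : wt (q + r) v = wt q v * wt r v :=
  Real.rpow_add (by positivity) _ _

theorem wt_zero (v : Vel d) : wt 0 v = 1 := Real.rpow_zero _

theorem wt_one (v : Vel d) : wt 1 v = 1 + ‖v‖ := Real.rpow_one _

theorem wt_le_wt {q r : ℝ} (h : q ≤ r) (v : Vel d) : wt q v ≤ wt r v :=
  Real.rpow_le_rpow_of_exponent_le (by simp) h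

theorem wt_neg_mul (q : ℝ) (v : Vel d) : wt (-q) v * wt q v = 1 := by
  rw [← wt_add, neg_add_cancel, wt_zero]

theorem continuous_wt (q : ℝ) : Continuous (wt q : Vel d → ℝ) :=
  Continuous.rpow_const (by fun_prop) fun v => Or.inl (by positivity)

theorem isDens_velMeasure (V : Set (Vel d)) (q : ℝ) : IsDens V (velMeasure V q) (wt q) :=
  ⟨rfl, continuous_wt q, fun v => (wt_pos q v).le, Eventually.of_forall fun v => wt_pos q v⟩

theorem isDens_volume (V : Set (Vel d)) : IsDens V (volume.restrict V) fun _ => 1 :=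
  ⟨by simp, continuous_const, fun _ => zero_le_one, Eventually.of_forall fun _ => zero_lt_one⟩

variable [NeZero d]

/-- A hyperplane is a null set. Therefore the factor v₁ + u can be divided out and the flux measure
has the null sets of V. -/
theorem ae_coord_ne (V : Set (Vel d)) (u : ℝ) : ∀ᵐ v ∂volume.restrict V, v 0 + u ≠ 0 := by
  refine ae_restrict_of_ae ?_
  have h1 : ∀ᵐ v : Fin d → ℝ, v 0 ≠ -u := by
    have := Measure.pi_hyperplane (fun _ : Fin d => (volume : Measure ℝ)) 0 (-u)
    rw [ae_iff]; simpa [volume_pi] using this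
  have h2 := (PiLp.volume_preserving_ofLp (Fin d)).quasiMeasurePreserving.ae h1
  filter_upwards [h2] with v hv h
  exact hv (by linarith)

theorem isDens_fluxMeasure (V : Set (Vel d)) (u : ℝ) :
    IsDens V (fluxMeasure V u) fun v => |v 0 + u| :=
  ⟨rfl, by fun_prop, fun v => abs_nonneg _, (ae_coord_ne V u).mono fun v hv => abs_pos.2 hv⟩

theorem abs_coord_le (u : ℝ) (v : Vel d) : |v 0 + u| ≤ (1 + |u|) * (1 + ‖v‖) := by
  have h1 : |v 0| ≤ ‖v‖ := by simpa using PiLp.norm_apply_le v 0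
  have h2 := abs_add_le (v 0) u
  nlinarith [abs_nonneg u, norm_nonneg v]

theorem reflect_reflect (u : ℝ) (v : Vel d) : reflect u (reflect u v) = v := by
  have h := reflect_apply_zero u v
  conv_lhs => rw [reflect, h]
  rw [reflect]
  module

theorem reflect_coord (u : ℝ) (v : Vel d) : reflect u v 0 + u = -(v 0 + u) := by
  rw [reflect_apply_zero]; ring

/-- The affine reflection is the linear reflection in the hyperplane orthogonal to the first unit
vector, followed by a translation along that vector. -/
theorem measurePreserving_reflect (u : ℝ) :
    MeasurePreserving (reflect u : Vel d → Vel d) volume volume := by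
  set e : Vel d := EuclideanSpace.single 0 1 with he
  have h1 := ((ℝ ∙ e)ᗮ.reflection).measurePreserving
  have h2 := measurePreserving_sub_right (volume : Measure (Vel d)) ((2 * u) • e)
  convert! h2.comp h1 using 1
  ext1 v
  rw [Function.comp_apply, Submodule.reflection_orthogonal_apply,
    Submodule.reflection_singleton_apply]
  simp only [reflect, he, EuclideanSpace.inner_single_left, PiLp.norm_single]
  simp
  module

theorem measurePreserving_reflect_restrict {u : ℝ} (hV : MeasurableSet V)
    (hVu : ∀ v, reflect u v ∈ V ↔ v ∈ V) :
    MeasurePreserving (reflect u) (volume.restrict V) (volume.restrict V) := by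
  have := (measurePreserving_reflect (d := d) u).restrict_preimage hV
  rwa [show reflect u ⁻¹' V = V from ext hVu] at this

theorem norm_reflect_le (u : ℝ) (v : Vel d) : 1 + ‖reflect u v‖ ≤ (3 + 2 * |u|) * (1 + ‖v‖) := by
  have h1 : ‖reflect u v‖ ≤ ‖v‖ + 2 * |v 0 + u| := by
    refine (norm_sub_le _ _).trans ?_
    simp [norm_smul]
  have := abs_coord_le u v
  nlinarith [abs_nonneg u, norm_nonneg v]

theorem exists_wt_reflect_le (u q : ℝ) : ∃ C : ℝ, ∀ v : Vel d, wt q (reflect u v) ≤ C * wt q v := by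
  have hc : 0 < 3 + 2 * |u| := by positivity
  rcases le_or_gt 0 q with hq | hq
  · refine ⟨(3 + 2 * |u|) ^ q, fun v => ?_⟩
    rw [wt, wt, ← Real.mul_rpow hc.le (by positivity)]
    exact Real.rpow_le_rpow (by positivity) (norm_reflect_le u v) hq
  · refine ⟨(3 + 2 * |u|) ^ (-q), fun v => ?_⟩
    -- For a negative exponent the norm has to be bounded from below, which is the upper bound
    -- applied at the reflected point.
    have h := norm_reflect_le u (reflect u v)
    rw [reflect_reflect] at h
    rw [Real.rpow_neg hc.le, ← div_eq_inv_mul, le_div_iff₀ (Real.rpow_pos_of_pos hc _), wt, wt,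
      ← Real.mul_rpow (by positivity) hc.le, mul_comm]
    exact Real.rpow_le_rpow_of_nonpos (by positivity) h hq.le

end Weights

/-! ### Curves of test functions -/

section Curve

variable {d m : ℕ} {M : Measure (Vel d)}

open Classical in
/-- The curve `x ↦ η(x, ·)` in `L²`. -/
def curve (M : Measure (Vel d)) (η : ℝ × Vel d → Val m) (x : ℝ) : Lp (Val m) 2 M :=
  if h : MemLp (fun v => η (x, v)) 2 M then h.toLp else 0

theorem hasCompactSupport_slice {η : ℝ × Vel d → Val m} (hs : HasCompactSupport η) (x : ℝ) :
    HasCompactSupport fun v => η (x, v) := by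
  refine HasCompactSupport.intro (hs.isCompact.image continuous_snd) fun v hv => ?_
  exact image_eq_zero_of_notMem_tsupport fun h => hv ⟨_, h, rfl⟩

theorem memLp_slice [IsLocallyFiniteMeasure M] {η : ℝ × Vel d → Val m} (hη : Continuous η)
    (hs : HasCompactSupport η) (x : ℝ) : MemLp (fun v => η (x, v)) 2 M :=
  (hη.comp (by fun_prop)).memLp_of_hasCompactSupport (hasCompactSupport_slice hs x)

theorem curve_ae_of_memLp {η : ℝ × Vel d → Val m} {x : ℝ} (h : MemLp (fun v => η (x, v)) 2 M) :
    curve M η x =ᵐ[M] fun v => η (x, v) := by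
  rw [curve, dif_pos h]
  exact MemLp.coeFn_toLp _

theorem curve_ae [IsLocallyFiniteMeasure M] {η : ℝ × Vel d → Val m} (hη : Continuous η)
    (hs : HasCompactSupport η) (x : ℝ) : curve M η x =ᵐ[M] fun v => η (x, v) :=
  curve_ae_of_memLp (memLp_slice hη hs x)

/-- The derivative `∂ₓη`. -/
def dx (η : ℝ × Vel d → Val m) : ℝ × Vel d → Val m := fun p => deriv (fun s => η (s, p.2)) p.1

variable {η : ℝ × Vel d → Val m}

theorem hasDerivAt_slice (hη : ContDiff ℝ (⊤ : ℕ∞) η) (x : ℝ) (v : Vel d) :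
    HasDerivAt (fun s => η (s, v)) (dx η (x, v)) x := by
  have : Differentiable ℝ fun s => η (s, v) :=
    (hη.comp (contDiff_id.prodMk contDiff_const)).differentiable (by simp)
  exact (this x).hasDerivAt

theorem dx_eq (hη : ContDiff ℝ (⊤ : ℕ∞) η) : dx η = fun p => fderiv ℝ η p (1, 0) := by
  ext1 p
  have h1 : HasFDerivAt η (fderiv ℝ η p) (p.1, p.2) :=
    (hη.differentiable (by simp) p).hasFDerivAt
  have h2 : HasDerivAt (fun s : ℝ => (s, p.2)) ((1 : ℝ), (0 : Vel d)) p.1 :=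
    (hasDerivAt_id _).prodMk (hasDerivAt_const _ _)
  exact (h1.comp_hasDerivAt p.1 h2).deriv

theorem contDiff_dx (hη : ContDiff ℝ (⊤ : ℕ∞) η) : ContDiff ℝ (⊤ : ℕ∞) (dx η) := by
  rw [dx_eq hη]
  exact (hη.fderiv_right (by simp)).clm_apply contDiff_const

theorem tsupport_dx_subset (hη : ContDiff ℝ (⊤ : ℕ∞) η) : tsupport (dx η) ⊆ tsupport η := by
  refine closure_minimal (fun p hp => ?_) (isClosed_tsupport η)
  by_contra h
  rw [dx_eq hη] at hp
  exact hp (by simp [fderiv_of_notMem_tsupport ℝ h])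

theorem hasCompactSupport_dx (hη : ContDiff ℝ (⊤ : ℕ∞) η) (hs : HasCompactSupport η) :
    HasCompactSupport (dx η) :=
  hs.isCompact.of_isClosed_subset (isClosed_tsupport _) (tsupport_dx_subset hη)

/-- The derivative `dx η` is Lipschitz, so the Taylor remainder is of order |y - x|² uniformly in v.
It vanishes outside one compact set of velocities, which has finite measure, so the bound passes to
the L² norm. -/
theorem hasDerivAt_curve [IsLocallyFiniteMeasure M] (hη : ContDiff ℝ (⊤ : ℕ∞) η)
    (hs : HasCompactSupport η) (x : ℝ) : HasDerivAt (curve M η) (curve M (dx η) x) x := by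
  obtain ⟨L, hL⟩ := ContDiff.lipschitzWith_of_hasCompactSupport (𝕂 := ℝ)
    (hasCompactSupport_dx hη hs) (contDiff_dx hη) (by simp)
  set S : Set (Vel d) := Prod.snd '' tsupport η with hS
  have hSc : IsCompact S := hs.isCompact.image continuous_snd
  have hbd : ∀ y v, ‖η (y, v) - η (x, v) - (y - x) • dx η (x, v)‖ ≤ L * |y - x| ^ 2 := by
    intro y v
    have := Convex.norm_image_sub_le_of_norm_hasDerivWithin_le (s := uIcc x y)
      (f := fun s => η (s, v) - s • dx η (x, v)) (f' := fun s => dx η (s, v) - dx η (x, v))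
      (C := L * |y - x|) (x := x) (y := y) (fun s _ => by
        have := (hasDerivAt_slice hη s v).sub ((hasDerivAt_id s).smul_const (dx η (x, v)))
        rw [one_smul] at this
        exact this.hasDerivWithinAt) (fun s hs => by
          rw [← dist_eq_norm]
          refine (hL.dist_le_mul _ _).trans ?_
          gcongr
          rw [Prod.dist_eq, dist_self, Real.dist_eq]
          exact max_le (abs_sub_left_of_mem_uIcc hs) (abs_nonneg _)) (convex_uIcc x y) left_mem_uIcc
      right_mem_uIcc
    simp only [Real.norm_eq_abs] at this
    convert this using 1
    · congr 1; module
    · ring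
  have hnot : ∀ y v, v ∉ S → η (y, v) = 0 := fun y v hv =>
    image_eq_zero_of_notMem_tsupport fun h => hv ⟨_, h, rfl⟩
  have hnot' : ∀ v, v ∉ S → dx η (x, v) = 0 := fun v hv =>
    image_eq_zero_of_notMem_tsupport fun h => hv ⟨_, tsupport_dx_subset hη h, rfl⟩
  set r : ℝ → Lp (Val m) 2 M := fun y => curve M η y - curve M η x - (y - x) • curve M (dx η) x
  have hr : ∀ y, ‖r y‖ ≤ L * |y - x| ^ 2 * (M S ^ (1 / (2 : ℝ≥0∞).toReal)).toReal := by
    intro y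
    rw [Lp.norm_def]
    have e : r y =ᵐ[M] (fun v => η (y, v) - η (x, v) - (y - x) • dx η (x, v)) - 0 := by
      filter_upwards [Lp.coeFn_sub (curve M η y - curve M η x) ((y - x) • curve M (dx η) x),
        Lp.coeFn_sub (curve M η y) (curve M η x), Lp.coeFn_smul (y - x) (curve M (dx η) x),
        curve_ae hη.continuous hs y, curve_ae hη.continuous hs x,
        curve_ae (contDiff_dx hη).continuous (hasCompactSupport_dx hη hs) x] with v h₁ h₂ h₃ h₄ h₅ h₆
      rw [h₁, Pi.sub_apply, h₂, Pi.sub_apply, h₃, Pi.smul_apply, h₄, h₅, h₆]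
      simp
    rw [eLpNorm_congr_ae e]
    have := eLpNorm_sub_le_of_dist_bdd (p := 2) M (by norm_num) hSc.measurableSet
      (c := L * |y - x| ^ 2) (by positivity)
      (f := fun v => η (y, v) - η (x, v) - (y - x) • dx η (x, v)) (g := 0)
      (fun v => by simpa using hbd y v) (fun v hv => by
        by_contra h
        exact hv (by simp [hnot _ v h, hnot' v h])) (by simp)
    refine (ENNReal.toReal_mono (ENNReal.mul_ne_top ENNReal.ofReal_ne_top
      (ENNReal.rpow_ne_top_of_nonneg (by norm_num) hSc.measure_lt_top.ne)) this).trans ?_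
    rw [ENNReal.toReal_mul, ENNReal.toReal_ofReal (by positivity)]
  have hr0 : HasDerivAt r 0 x := by
    have : HasFDerivAt (𝕜 := ℝ) r (0 : ℝ →L[ℝ] Lp (Val m) 2 M) x :=
      Asymptotics.IsBigO.hasFDerivAt (n := 2) (Asymptotics.IsBigO.of_bound
        (L * (M S ^ (1 / (2 : ℝ≥0∞).toReal)).toReal) (Eventually.of_forall fun y => by
          refine (hr y).trans (le_of_eq ?_)
          simp only [Real.norm_eq_abs, abs_pow, abs_abs]
          ring)) (by norm_num)
    simpa using this.hasDerivAt
  have h2 : HasDerivAt (fun y => curve M η x + (y - x) • curve M (dx η) x) (curve M (dx η) x) x := by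
    have := (((hasDerivAt_id x).sub_const x).smul_const (curve M (dx η) x)).const_add (curve M η x)
    simpa using this
  have h3 := hr0.add h2
  rw [zero_add] at h3
  refine h3.congr_of_eventuallyEq (Eventually.of_forall fun y => ?_)
  simp only [r, Pi.add_apply]
  abel

theorem curve_eq_zero {x : ℝ} (h : ∀ v, η (x, v) = 0) : curve M η x = 0 := by
  rw [curve]
  split_ifs with h'
  · rw [MemLp.toLp_eq_toLp_iff h' MemLp.zero |>.2 (by simp [h]; rfl)]
    exact MemLp.toLp_zero _
  · rfl

theorem hasCompactSupport_curve (hs : HasCompactSupport η) : HasCompactSupport (curve M η) := by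
  refine HasCompactSupport.intro (hs.isCompact.image continuous_fst) fun x hx => curve_eq_zero fun v => ?_
  exact image_eq_zero_of_notMem_tsupport fun h => hx ⟨_, h, rfl⟩

end Curve

/-! ### Multiplication and reflection operators -/

section Operators

variable {d m : ℕ} {V : Set (Vel d)} {M M₁ M₂ : Measure (Vel d)} {ρ ρ₁ ρ₂ : Vel d → ℝ}

open Classical in
/-- Multiplication by `b` as a bounded operator between `L²` spaces. -/
def mulL (m : ℕ) (M₁ M₂ : Measure (Vel d)) (b : Vel d → ℝ) : Lp (Val m) 2 M₁ →L[ℝ] Lp (Val m) 2 M₂ :=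
  if h : ∃ T : Lp (Val m) 2 M₁ →L[ℝ] Lp (Val m) 2 M₂, ∀ f, T f =ᵐ[M₂] fun v => b v • f v then
    h.choose else 0

theorem mulL_ae (h₁ : IsDens V M₁ ρ₁) (h₂ : IsDens V M₂ ρ₂) {b : Vel d → ℝ}
    (hb : Measurable b) {C : ℝ} (hC : ∀ v, b v ^ 2 * ρ₂ v ≤ C * ρ₁ v) (f : Lp (Val m) 2 M₁) :
    mulL m M₁ M₂ b f =ᵐ[volume.restrict V] fun v => b v • f v := by
  have h : ∃ T : Lp (Val m) 2 M₁ →L[ℝ] Lp (Val m) 2 M₂, ∀ f, T f =ᵐ[M₂] fun v => b v • f v := by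
    obtain ⟨T, hT⟩ := exists_mulOp (m := m) h₁ h₂ hb hC
    exact ⟨T, fun f => by rw [h₂.ae_eq]; exact hT f⟩
  rw [mulL, dif_pos h, ← h₂.ae_eq]
  exact h.choose_spec f

theorem IsDens.ext (h : IsDens V M ρ) {f g : Lp (Val m) 2 M}
    (hfg : (f : Vel d → Val m) =ᵐ[volume.restrict V] g) : f = g :=
  Lp.ext (by rw [h.ae_eq]; exact hfg)

theorem IsDens.add_ae (h : IsDens V M ρ) (f g : Lp (Val m) 2 M) :
    ((f + g : Lp (Val m) 2 M) : Vel d → Val m) =ᵐ[volume.restrict V] fun v => f v + g v := by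
  rw [← h.ae_eq]; exact Lp.coeFn_add f g

theorem IsDens.sub_ae (h : IsDens V M ρ) (f g : Lp (Val m) 2 M) :
    ((f - g : Lp (Val m) 2 M) : Vel d → Val m) =ᵐ[volume.restrict V] fun v => f v - g v := by
  rw [← h.ae_eq]; exact Lp.coeFn_sub f g

theorem IsDens.neg_ae (h : IsDens V M ρ) (f : Lp (Val m) 2 M) :
    ((-f : Lp (Val m) 2 M) : Vel d → Val m) =ᵐ[volume.restrict V] fun v => -f v := by
  rw [← h.ae_eq]; exact Lp.coeFn_neg f

theorem IsDens.smul_ae (h : IsDens V M ρ) (c : ℝ) (f : Lp (Val m) 2 M) :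
    ((c • f : Lp (Val m) 2 M) : Vel d → Val m) =ᵐ[volume.restrict V] fun v => c • f v := by
  rw [← h.ae_eq]; exact Lp.coeFn_smul c f

theorem IsDens.zero_ae (h : IsDens V M ρ) :
    ((0 : Lp (Val m) 2 M) : Vel d → Val m) =ᵐ[volume.restrict V] 0 := by
  rw [← h.ae_eq]; exact Lp.coeFn_zero _ _ _

theorem IsDens.integrable_inner (h : IsDens V M ρ) (f g : Lp (Val m) 2 M) :
    Integrable (fun v => ρ v * inner ℝ (f v) (g v)) (volume.restrict V) :=
  h.integrable_iff.1 (L2.integrable_inner f g)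

theorem IsDens.norm_sq_eq (h : IsDens V M ρ) (f : Lp (Val m) 2 M) :
    ‖f‖ ^ 2 = ∫ v in V, ρ v * ‖f v‖ ^ 2 := by
  rw [← real_inner_self_eq_norm_sq, h.inner_eq]
  simp_rw [real_inner_self_eq_norm_sq]

variable [NeZero d] {u : ℝ}

open Classical in
/-- The reflection `f ↦ f ∘ R` as a bounded operator. -/
def reflL (m : ℕ) (M : Measure (Vel d)) (u : ℝ) : Lp (Val m) 2 M →L[ℝ] Lp (Val m) 2 M :=
  if h : ∃ T : Lp (Val m) 2 M →L[ℝ] Lp (Val m) 2 M, ∀ f, T f =ᵐ[M] fun v => f (reflect u v) then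
    h.choose else 0

/-- The density `ρ` is compatible with the reflection. -/
structure IsReflDens (V : Set (Vel d)) (u : ℝ) (M : Measure (Vel d)) (ρ : Vel d → ℝ) : Prop
    extends IsDens V M ρ where
  meas : MeasurableSet V
  mem_iff : ∀ v, reflect u v ∈ V ↔ v ∈ V
  bound : ∃ C : ℝ, ∀ v, ρ (reflect u v) ≤ C * ρ v

theorem IsReflDens.mp (h : IsReflDens V u M ρ) :
    MeasurePreserving (reflect u) (volume.restrict V) (volume.restrict V) :=
  measurePreserving_reflect_restrict h.meas h.mem_iff

theorem isReflDens_velMeasure (hV : MeasurableSet V) (hVu : ∀ v, reflect u v ∈ V ↔ v ∈ V) (q : ℝ) :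
    IsReflDens V u (velMeasure V q) (wt q) :=
  ⟨isDens_velMeasure V q, hV, hVu, exists_wt_reflect_le u q⟩

theorem isReflDens_fluxMeasure (hV : MeasurableSet V) (hVu : ∀ v, reflect u v ∈ V ↔ v ∈ V) :
    IsReflDens V u (fluxMeasure V u) fun v => |v 0 + u| :=
  ⟨isDens_fluxMeasure V u, hV, hVu, 1, fun v => by rw [reflect_coord, abs_neg, one_mul]⟩

theorem reflL_ae (h : IsReflDens V u M ρ) (f : Lp (Val m) 2 M) :
    reflL m M u f =ᵐ[volume.restrict V] fun v => f (reflect u v) := by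
  have hex : ∃ T : Lp (Val m) 2 M →L[ℝ] Lp (Val m) 2 M,
      ∀ f, T f =ᵐ[M] fun v => f (reflect u v) := by
    obtain ⟨C, hC⟩ := h.bound
    obtain ⟨T, hT⟩ := exists_compOp (m := m) h.toIsDens h.mp (reflect_reflect u) hC
    exact ⟨T, fun f => by rw [h.ae_eq]; exact hT f⟩
  rw [reflL, dif_pos hex, ← h.ae_eq]
  exact hex.choose_spec f

/-- The even part as a bounded operator. -/
def evenL (m : ℕ) (M : Measure (Vel d)) (u : ℝ) : Lp (Val m) 2 M →L[ℝ] Lp (Val m) 2 M :=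
  (1 / 2 : ℝ) • (ContinuousLinearMap.id ℝ _ + reflL m M u)

/-- The odd part as a bounded operator. -/
def oddL (m : ℕ) (M : Measure (Vel d)) (u : ℝ) : Lp (Val m) 2 M →L[ℝ] Lp (Val m) 2 M :=
  (1 / 2 : ℝ) • (ContinuousLinearMap.id ℝ _ - reflL m M u)

theorem evenL_apply (f : Lp (Val m) 2 M) : evenL m M u f = (1 / 2 : ℝ) • (f + reflL m M u f) := rfl

theorem oddL_apply (f : Lp (Val m) 2 M) : oddL m M u f = (1 / 2 : ℝ) • (f - reflL m M u f) := rfl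

theorem evenL_ae (h : IsReflDens V u M ρ) (f : Lp (Val m) 2 M) :
    evenL m M u f =ᵐ[volume.restrict V] evenPart u f := by
  rw [evenL_apply]
  filter_upwards [h.smul_ae (1 / 2) (f + reflL m M u f), h.add_ae f (reflL m M u f), reflL_ae h f]
    with v h₁ h₂ h₃
  rw [h₁, h₂, h₃, evenPart]

theorem oddL_ae (h : IsReflDens V u M ρ) (f : Lp (Val m) 2 M) :
    oddL m M u f =ᵐ[volume.restrict V] oddPart u f := by
  rw [oddL_apply]
  filter_upwards [h.smul_ae (1 / 2) (f - reflL m M u f), h.sub_ae f (reflL m M u f), reflL_ae h f]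
    with v h₁ h₂ h₃
  rw [h₁, h₂, h₃, oddPart]

theorem reflL_reflL (h : IsReflDens V u M ρ) (f : Lp (Val m) 2 M) :
    reflL m M u (reflL m M u f) = f := by
  refine h.ext ?_
  filter_upwards [reflL_ae h (reflL m M u f), h.mp.quasiMeasurePreserving.ae (reflL_ae h f)]
    with v h₁ h₂
  rw [h₁, h₂, reflect_reflect]

end Operators

/-! ### The phase spaces and the space of transport derivatives -/

section Phase

variable {d m : ℕ} {V : Set (Vel d)} [NeZero d] {u ω₀ : ℝ}

/-- The space `L²((1 + |v|)⁻² dv)` in which transport derivatives are compared. -/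
abbrev L2k (m : ℕ) (V : Set (Vel d)) := L2w m V (-2)

/-- `f ↦ (v₁ + u) f` from `L²(a dv)` to the comparison space. -/
def transK (m : ℕ) (V : Set (Vel d)) (u ω₀ : ℝ) : L2w m V ω₀ →L[ℝ] L2k m V :=
  mulL m _ _ fun v => v 0 + u

/-- The inclusion of `L²(1/a dv)` in the comparison space. -/
def inclK (m : ℕ) (V : Set (Vel d)) (ω₀ : ℝ) : L2w m V (-ω₀) →L[ℝ] L2k m V :=
  mulL m _ _ fun _ => 1

/-- `t ↦ (v₁ + u) t` from the trace space to the comparison space. -/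
def traceK (m : ℕ) (V : Set (Vel d)) (u : ℝ) : L2flux m V u →L[ℝ] L2k m V :=
  mulL m _ _ fun v => v 0 + u

/-- The isometry `g ↦ g / a` from `L²(1/a dv)` to `L²(a dv)`. -/
def riesz (m : ℕ) (V : Set (Vel d)) (ω₀ : ℝ) : L2w m V (-ω₀) →L[ℝ] L2w m V ω₀ :=
  mulL m _ _ (wt (-ω₀))

omit [NeZero d] in
theorem wt_two_mul (v : Vel d) : wt 2 v * wt (-2) v = 1 := by
  rw [← wt_add, add_neg_cancel, wt_zero]

omit [NeZero d] in
theorem wt_two (v : Vel d) : wt 2 v = (1 + ‖v‖) ^ 2 := by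
  rw [wt]; norm_cast

theorem coord_sq_le (u : ℝ) (v : Vel d) : (v 0 + u) ^ 2 ≤ (1 + |u|) ^ 2 * wt 2 v := by
  rw [wt_two, ← mul_pow, ← sq_abs]
  exact pow_le_pow_left₀ (abs_nonneg _) (abs_coord_le u v) 2

theorem coord_sq_mul_le (u : ℝ) (v : Vel d) : (v 0 + u) ^ 2 * wt (-2) v ≤ (1 + |u|) ^ 2 := by
  have := mul_le_mul_of_nonneg_right (coord_sq_le u v) (wt_pos (-2) v).le
  rwa [mul_assoc, wt_two_mul, mul_one] at this

theorem transK_ae (hω₀ : 0 ≤ ω₀) (f : L2w m V ω₀) :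
    transK m V u ω₀ f =ᵐ[volume.restrict V] fun v => (v 0 + u) • f v :=
  mulL_ae (isDens_velMeasure V _) (isDens_velMeasure V _) (by fun_prop) (C := (1 + |u|) ^ 2)
    (fun v => (coord_sq_mul_le u v).trans (le_mul_of_one_le_right (by positivity)
      (by rw [← wt_zero v]; exact wt_le_wt hω₀ v))) f

omit [NeZero d] in
theorem inclK_ae (hω₁ : ω₀ ≤ 1) (g : L2w m V (-ω₀)) :
    inclK m V ω₀ g =ᵐ[volume.restrict V] g := by
  have := mulL_ae (isDens_velMeasure V (-ω₀)) (isDens_velMeasure V (-2)) (m := m)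
    (b := fun _ => 1) (by fun_prop) (C := 1)
    (fun v => by simpa using wt_le_wt (by linarith) v) g
  simp only [one_smul] at this
  exact this

theorem traceK_ae (t : L2flux m V u) :
    traceK m V u t =ᵐ[volume.restrict V] fun v => (v 0 + u) • t v :=
  mulL_ae (isDens_fluxMeasure V u) (isDens_velMeasure V _) (by fun_prop) (C := 1 + |u|)
    (fun v => by
      have h1 := abs_coord_le u v
      have h2 : wt (-2) v * (1 + ‖v‖) ≤ 1 := by
        have : wt (-2) v * (1 + ‖v‖) = wt (-1) v := by
          rw [← wt_one v, ← wt_add]; norm_num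
        rw [this]; exact (wt_le_wt (by norm_num) v).trans (wt_zero v).le
      calc (v 0 + u) ^ 2 * wt (-2) v = |v 0 + u| * |v 0 + u| * wt (-2) v := by
            rw [← sq_abs, sq]
        _ ≤ |v 0 + u| * ((1 + |u|) * (1 + ‖v‖)) * wt (-2) v := by
            have := (wt_pos (-2) v).le
            gcongr
        _ = (1 + |u|) * |v 0 + u| * (wt (-2) v * (1 + ‖v‖)) := by ring
        _ ≤ (1 + |u|) * |v 0 + u| * 1 := by gcongr
        _ = _ := mul_one _) t

omit [NeZero d] in
theorem riesz_ae (g : L2w m V (-ω₀)) :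
    riesz m V ω₀ g =ᵐ[volume.restrict V] fun v => wt (-ω₀) v • g v :=
  mulL_ae (isDens_velMeasure V _) (isDens_velMeasure V _) (continuous_wt _).measurable (C := 1)
    (fun v => by rw [sq, mul_assoc, wt_neg_mul, mul_one, one_mul]) g

-- The factor 1/a cancels the density a, so the unweighted pairing of the spaces with weights 1/a
-- and a becomes an inner product in a single Hilbert space.
omit [NeZero d] in
theorem inner_riesz (g : L2w m V (-ω₀)) (f : L2w m V ω₀) :
    inner ℝ (riesz m V ω₀ g) f = ∫ v in V, inner ℝ (g v) (f v) := by
  rw [(isDens_velMeasure V ω₀).inner_eq]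
  refine integral_congr_ae ?_
  filter_upwards [riesz_ae g] with v hv
  rw [hv, real_inner_smul_left, ← mul_assoc, mul_comm (wt ω₀ v), wt_neg_mul, one_mul]

omit [NeZero d] in
theorem integrable_inner_dual (g : L2w m V (-ω₀)) (f : L2w m V ω₀) :
    Integrable (fun v => inner ℝ (g v) (f v)) (volume.restrict V) := by
  refine ((isDens_velMeasure V ω₀).integrable_inner (riesz m V ω₀ g) f).congr ?_
  filter_upwards [riesz_ae g] with v hv
  rw [hv, real_inner_smul_left, ← mul_assoc, mul_comm (wt ω₀ v), wt_neg_mul, one_mul]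

omit [NeZero d] in
theorem norm_riesz (g : L2w m V (-ω₀)) : ‖riesz m V ω₀ g‖ = ‖g‖ := by
  rw [← sq_eq_sq₀ (norm_nonneg _) (norm_nonneg _), (isDens_velMeasure V ω₀).norm_sq_eq,
    (isDens_velMeasure V (-ω₀)).norm_sq_eq]
  refine integral_congr_ae ?_
  filter_upwards [riesz_ae g] with v hv
  rw [hv, norm_smul, Real.norm_of_nonneg (wt_pos _ v).le, mul_pow, ← mul_assoc, sq (wt (-ω₀) v),
    ← mul_assoc, mul_comm (wt ω₀ v), wt_neg_mul, one_mul]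

omit [NeZero d] in
theorem inclK_injective (hω₁ : ω₀ ≤ 1) : Function.Injective (inclK m V ω₀) := fun g g' h =>
  (isDens_velMeasure V _).ext <| (inclK_ae hω₁ g).symm.trans (h ▸ inclK_ae hω₁ g')

theorem traceK_injective : Function.Injective (traceK m V u) := fun t t' h => by
  refine (isDens_fluxMeasure V u).ext ?_
  filter_upwards [traceK_ae t, traceK_ae t', ae_coord_ne V u] with v h₁ h₂ h₃
  rw [h, h₂] at h₁
  exact (smul_right_injective _ h₃ h₁).symm

/-! ### Test curves in the comparison space -/

/-- A test function as a curve in the comparison space, normalized such that pairings become inner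
products. -/
def testCurve (V : Set (Vel d)) (η : ℝ × Vel d → Val m) (x : ℝ) : L2k m V :=
  mulL m (velMeasure V 2) (velMeasure V (-2)) (wt 2) (curve (velMeasure V 2) η x)

instance (q : ℝ) : IsLocallyFiniteMeasure (velMeasure V q) :=
  (isDens_velMeasure V q).isLocallyFiniteMeasure

variable {η : ℝ × Vel d → Val m}

omit [NeZero d] in
theorem mulL_two_ae (f : L2w m V 2) :
    mulL m (velMeasure V 2) (velMeasure V (-2)) (wt 2) f =ᵐ[volume.restrict V]
      fun v => wt 2 v • f v :=
  mulL_ae (isDens_velMeasure V _) (isDens_velMeasure V _) (continuous_wt _).measurable (C := 1)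
    (fun v => by rw [sq, mul_assoc, wt_two_mul, mul_one, one_mul]) f

omit [NeZero d] in
theorem testCurve_ae {x : ℝ} (h : MemLp (fun v => η (x, v)) 2 (velMeasure V 2)) :
    testCurve V η x =ᵐ[volume.restrict V] fun v => wt 2 v • η (x, v) := by
  have h := curve_ae_of_memLp h
  rw [(isDens_velMeasure V 2).ae_eq] at h
  filter_upwards [mulL_two_ae (curve (velMeasure V 2) η x), h] with v h₁ h₂
  rw [testCurve, h₁, h₂]

omit [NeZero d] in
theorem inner_testCurve {x : ℝ} (h : MemLp (fun v => η (x, v)) 2 (velMeasure V 2)) (y : L2k m V)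
    {f : Vel d → Val m} (hf : y =ᵐ[volume.restrict V] f) :
    inner ℝ y (testCurve V η x) = ∫ v in V, inner ℝ (f v) (η (x, v)) := by
  rw [(isDens_velMeasure V _).inner_eq]
  refine integral_congr_ae ?_
  filter_upwards [testCurve_ae h, hf] with v hv hv'
  rw [hv, hv', real_inner_smul_right, ← mul_assoc, mul_comm (wt (-2) v), wt_two_mul, one_mul]

omit [NeZero d] in
theorem hasDerivAt_testCurve (hη : ContDiff ℝ (⊤ : ℕ∞) η) (hs : HasCompactSupport η) (x : ℝ) :
    HasDerivAt (testCurve V η) (testCurve V (dx η) x) x :=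
  (mulL m (velMeasure V 2) (velMeasure V (-2)) (wt 2)).hasFDerivAt.comp_hasDerivAt x
    (hasDerivAt_curve hη hs x)

omit [NeZero d] in
theorem continuous_testCurve (hη : ContDiff ℝ (⊤ : ℕ∞) η) (hs : HasCompactSupport η) :
    Continuous (testCurve V η) :=
  continuous_iff_continuousAt.2 fun x => (hasDerivAt_testCurve hη hs x).continuousAt

omit [NeZero d] in
theorem hasCompactSupport_testCurve (hs : HasCompactSupport η) :
    HasCompactSupport (testCurve V η) :=
  (hasCompactSupport_curve hs).comp_left (map_zero _)

omit [NeZero d] in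
/-- Test functions separate the comparison space. -/
theorem eq_zero_of_inner_test {y : L2k m V} (h : ∀ ζ : Vel d → Val m, ContDiff ℝ (⊤ : ℕ∞) ζ →
    HasCompactSupport ζ → ∫ v in V, inner ℝ (y v) (ζ v) = 0) : y = 0 := by
  -- Dividing y by (1+|v|)² gives an element z of the space with weight (1+|v|)², whose inner
  -- product with ζ is the unweighted pairing of y and ζ. Density of test functions is used in that
  -- space.
  have hz := mulL_ae (m := m) (isDens_velMeasure V (-2)) (isDens_velMeasure V 2)
    (continuous_wt (-2)).measurable (C := 1)
    (fun v => by rw [sq, mul_assoc, mul_comm (wt (-2) v) (wt 2 v), wt_two_mul, one_mul, mul_one]) y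
  set z := mulL m (velMeasure V (-2)) (velMeasure V 2) (wt (-2)) y with hzdef
  have hz0 : z = 0 := by
    refine (Lp.dense_hasCompactSupport_contDiff (F := Val m) (μ := velMeasure V 2) (p := 2)
      (by norm_num)).eq_zero_of_inner_left ℝ fun w ⟨ζ, hw, hs, hζ⟩ => ?_
    rw [(isDens_velMeasure V 2).inner_eq, ← h ζ hζ hs]
    rw [(isDens_velMeasure V 2).ae_eq] at hw
    refine integral_congr_ae ?_
    filter_upwards [hz, hw] with v h₁ h₂
    rw [h₁, h₂, real_inner_smul_left, ← mul_assoc, wt_two_mul, one_mul]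
  refine (isDens_velMeasure V (-2)).ext ?_
  rw [hz0] at hz
  filter_upwards [hz, (isDens_velMeasure V 2).zero_ae, (isDens_velMeasure V (-2)).zero_ae]
    with v h₁ h₂ h₃
  rw [h₂] at h₁
  rw [h₃]
  exact (smul_eq_zero.1 h₁.symm).resolve_left (wt_pos _ v).ne'

end Phase

/-! ### Uniqueness of boundary values. -/

section Green

variable {K : Type*} [NormedAddCommGroup K] [InnerProductSpace ℝ K] [CompleteSpace K]
  {W G : ℝ → K} {c : K}

omit [CompleteSpace K] in
theorem IsGreen.isWeakDeriv (h : IsGreen W G c) : IsWeakDeriv W G := fun θ hθ hs ht => by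
  rw [h θ hθ hs, image_eq_zero_of_notMem_tsupport fun h0 => lt_irrefl (0 : ℝ) (ht h0), zero_smul, neg_zero]

theorem exists_smooth_cutoff : ∃ θ : ℝ → ℝ, ContDiff ℝ (⊤ : ℕ∞) θ ∧ HasCompactSupport θ ∧ θ 0 = 1 := by
  obtain ⟨θ, _, h₂, h₃, _, h₅⟩ := exists_contDiff_tsupport_subset (n := ⊤) (univ_mem (f := 𝓝 (0 : ℝ)))
  exact ⟨θ, h₃, h₂, h₅⟩

omit [CompleteSpace K] in
theorem IsGreen.unique {c' : K} (h : IsGreen W G c) (h' : IsGreen W G c') : c = c' := by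
  obtain ⟨θ, h₁, h₂, h₃⟩ := exists_smooth_cutoff
  have := (h θ h₁ h₂).symm.trans (h' θ h₁ h₂)
  simpa [h₃] using this

theorem IsGreen.primitive (h : IsGreen W G c) (hW : ∀ X, IntegrableOn W (Ioc 0 X))
    (hG : ∀ X, IntegrableOn G (Ioc 0 X)) :
    ∀ᵐ x ∂volume.restrict (Ioi (0 : ℝ)), W x = c + ∫ s in (0 : ℝ)..x, G s := by
  obtain ⟨c', hc'⟩ := h.isWeakDeriv.exists_primitive hG hW
  rwa [h.unique (IsGreen.of_primitive hc' hG hW)]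

end Green

/-! ### Existence and uniqueness of traces. -/

section Trans

variable {d m : ℕ} {V : Set (Vel d)} [NeZero d] {u ω₀ : ℝ}

/-- `(v₁ + u) ∂ₓ w = g` with the trace `t` at `x = 0`, as an identity of curves in the comparison
space. -/
def Trans (u : ℝ) (w : L2xw m V ω₀) (g : L2xw m V (-ω₀)) (t : L2flux m V u) : Prop :=
  IsGreen (fun x => transK m V u ω₀ (w x)) (fun x => inclK m V ω₀ (g x)) (traceK m V u t)

theorem memLp_transK (w : L2xw m V ω₀) :
    MemLp (fun x => transK m V u ω₀ (w x)) 2 (volume.restrict (Ioi (0 : ℝ))) :=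
  (transK m V u ω₀).comp_memLp' (Lp.memLp w)

omit [NeZero d] in
theorem memLp_inclK (g : L2xw m V (-ω₀)) :
    MemLp (fun x => inclK m V ω₀ (g x)) 2 (volume.restrict (Ioi (0 : ℝ))) :=
  (inclK m V ω₀).comp_memLp' (Lp.memLp g)

omit [NeZero d] in
theorem memLp_slice_two {η : ℝ × Vel d → Val m} (hη : ContDiff ℝ (⊤ : ℕ∞) η)
    (hs : HasCompactSupport η) (x : ℝ) : MemLp (fun v => η (x, v)) 2 (velMeasure V 2) :=
  memLp_slice hη.continuous hs x

theorem integral_transport_eq (hω₀ : 0 ≤ ω₀) {w : L2xw m V ω₀} {w' : ℝ → Vel d → Val m}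
    (hw : ∀ᵐ x ∂volume.restrict (Ioi (0 : ℝ)), w' x =ᵐ[volume.restrict V] w x)
    {η : ℝ × Vel d → Val m} (h : ∀ x, MemLp (fun v => η (x, v)) 2 (velMeasure V 2)) :
    ∫ x in Ioi (0 : ℝ), ∫ v in V, (v 0 + u) * inner ℝ (w' x v) (η (x, v)) =
      ∫ x in Ioi (0 : ℝ), inner ℝ (transK m V u ω₀ (w x)) (testCurve V η x) := by
  refine integral_congr_ae ?_
  filter_upwards [hw] with x hx
  rw [inner_testCurve (h x) _ (transK_ae hω₀ (w x))]
  refine integral_congr_ae ?_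
  filter_upwards [hx] with v hv
  rw [hv, real_inner_smul_left]

omit [NeZero d] in
theorem integral_source_eq (hω₁ : ω₀ ≤ 1) {g : L2xw m V (-ω₀)} {g' : ℝ → Vel d → Val m}
    (hg : ∀ᵐ x ∂volume.restrict (Ioi (0 : ℝ)), g' x =ᵐ[volume.restrict V] g x)
    {η : ℝ × Vel d → Val m} (h : ∀ x, MemLp (fun v => η (x, v)) 2 (velMeasure V 2)) :
    ∫ x in Ioi (0 : ℝ), ∫ v in V, inner ℝ (g' x v) (η (x, v)) =
      ∫ x in Ioi (0 : ℝ), inner ℝ (inclK m V ω₀ (g x)) (testCurve V η x) := by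
  refine integral_congr_ae ?_
  filter_upwards [hg] with x hx
  rw [inner_testCurve (h x) _ (inclK_ae hω₁ (g x))]
  refine integral_congr_ae ?_
  filter_upwards [hx] with v hv
  rw [hv]

theorem integral_trace_eq (t : L2flux m V u) {η : ℝ × Vel d → Val m} {x : ℝ}
    (h : MemLp (fun v => η (x, v)) 2 (velMeasure V 2)) :
    ∫ v in V, (v 0 + u) * inner ℝ (t v) (η (x, v)) =
      inner ℝ (traceK m V u t) (testCurve V η x) := by
  rw [inner_testCurve h _ (traceK_ae t)]
  simp_rw [real_inner_smul_left]

/-- Scalar cutoffs in x already force the curve to be a primitive, and a primitive may be tested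
with any compactly supported C¹ curve, in particular with `testCurve V η` for a general η(x, v). -/
theorem isTrace_of_trans (hω₀ : 0 ≤ ω₀) (hω₁ : ω₀ ≤ 1) {w : L2xw m V ω₀} {g : L2xw m V (-ω₀)}
    {t : L2flux m V u} (h : Trans u w g t) {w' g' : ℝ → Vel d → Val m}
    (hw : ∀ᵐ x ∂volume.restrict (Ioi (0 : ℝ)), w' x =ᵐ[volume.restrict V] w x)
    (hg : ∀ᵐ x ∂volume.restrict (Ioi (0 : ℝ)), g' x =ᵐ[volume.restrict V] g x) :
    IsTrace V u w' g' t := by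
  intro η hη hs
  have hW := integrableOn_Ioc_of_memLp (memLp_transK (u := u) w)
  have hG := integrableOn_Ioc_of_memLp (memLp_inclK g)
  have h1 := integral_transport_eq (u := u) hω₀ hw
    (memLp_slice_two (V := V) (contDiff_dx hη) (hasCompactSupport_dx hη hs))
  have h2 := integral_source_eq hω₁ hg (memLp_slice_two (V := V) hη hs)
  have h3 := integral_trace_eq t (memLp_slice_two (V := V) hη hs 0)
  have h4 := green_of_primitive (h.primitive hW hG) hG (hasDerivAt_testCurve hη hs)
    (continuous_testCurve (contDiff_dx hη) (hasCompactSupport_dx hη hs))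
    (hasCompactSupport_testCurve hs)
  rw [← h1, ← h2, ← h3] at h4
  exact h4

omit [NeZero d] in
theorem slice_eq_zero {η : ℝ × Vel d → Val m} (ht : tsupport η ⊆ Ioi (0 : ℝ) ×ˢ univ) (v : Vel d) :
    η (0, v) = 0 :=
  image_eq_zero_of_notMem_tsupport fun h => lt_irrefl (0 : ℝ) (ht h).1

theorem IsTrace.hasTransportDeriv {w' g' : ℝ → Vel d → Val m} {t : Vel d → Val m}
    (h : IsTrace V u w' g' t) : HasTransportDeriv V u w' g' := by
  intro η hη hs ht
  have := h η hη hs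
  simp only [slice_eq_zero ht, inner_zero_right, mul_zero, integral_zero, neg_zero] at this
  exact eq_neg_of_add_eq_zero_left this

/-- The product test function `θ(x) ζ(v)`. -/
def tensor (θ : ℝ → ℝ) (ζ : Vel d → Val m) (p : ℝ × Vel d) : Val m := θ p.1 • ζ p.2

section Tensor

variable {θ : ℝ → ℝ} {ζ : Vel d → Val m}

omit [NeZero d] in
theorem contDiff_tensor (hθ : ContDiff ℝ (⊤ : ℕ∞) θ) (hζ : ContDiff ℝ (⊤ : ℕ∞) ζ) :
    ContDiff ℝ (⊤ : ℕ∞) (tensor θ ζ) :=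
  (hθ.comp contDiff_fst).smul (hζ.comp contDiff_snd)

omit [NeZero d] in
theorem tsupport_tensor_subset : tsupport (tensor θ ζ) ⊆ tsupport θ ×ˢ tsupport ζ := by
  refine closure_minimal (fun p hp => ?_) ((isClosed_tsupport θ).prod (isClosed_tsupport ζ))
  constructor
  · by_contra h
    exact hp (by simp [tensor, image_eq_zero_of_notMem_tsupport h])
  · by_contra h
    exact hp (by simp [tensor, image_eq_zero_of_notMem_tsupport h])

omit [NeZero d] in
theorem hasCompactSupport_tensor (hθ : HasCompactSupport θ) (hζ : HasCompactSupport ζ) :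
    HasCompactSupport (tensor θ ζ) :=
  (hθ.isCompact.prod hζ.isCompact).of_isClosed_subset (isClosed_tsupport _) tsupport_tensor_subset

omit [NeZero d] in
theorem dx_tensor (hθ : ContDiff ℝ (⊤ : ℕ∞) θ) : dx (tensor θ ζ) = tensor (deriv θ) ζ := by
  ext1 p
  exact deriv_smul_const (hθ.differentiable (by simp) p.1) (ζ p.2)

/-- A test function of `v` as an element of the comparison space. -/
def testVec (V : Set (Vel d)) (ζ : Vel d → Val m) : L2k m V := testCurve V (fun p => ζ p.2) 0

omit [NeZero d] in
theorem testVec_ae (hζ : MemLp ζ 2 (velMeasure V 2)) :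
    testVec V ζ =ᵐ[volume.restrict V] fun v => wt 2 v • ζ v :=
  testCurve_ae (η := fun p => ζ p.2) (x := 0) hζ

omit [NeZero d] in
theorem inner_testVec (hζ : MemLp ζ 2 (velMeasure V 2)) (y : L2k m V)
    {f : Vel d → Val m} (hf : y =ᵐ[volume.restrict V] f) :
    inner ℝ y (testVec V ζ) = ∫ v in V, inner ℝ (f v) (ζ v) :=
  inner_testCurve (η := fun p => ζ p.2) (x := 0) hζ y hf

omit [NeZero d] in
theorem testCurve_tensor (hζ : MemLp ζ 2 (velMeasure V 2)) (x : ℝ) :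
    testCurve V (tensor θ ζ) x = θ x • testVec V ζ := by
  refine (isDens_velMeasure V (-2)).ext ?_
  have h : MemLp (fun v => tensor θ ζ (x, v)) 2 (velMeasure V 2) := hζ.const_smul (θ x)
  filter_upwards [testCurve_ae h, testVec_ae hζ, (isDens_velMeasure V (-2)).smul_ae (θ x)
    (testVec V ζ)] with v h₁ h₂ h₃
  rw [h₁, h₃, h₂, tensor, smul_comm]

end Tensor

/-- Products θ(x)ζ(v) are enough test functions: for fixed θ the distributional identity says that a
vector of the comparison space is orthogonal to every ζ, and such ζ separate points. -/
theorem isWeakDeriv_of_hasTransportDeriv (hω₀ : 0 ≤ ω₀) (hω₁ : ω₀ ≤ 1) {w : L2xw m V ω₀}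
    {g : L2xw m V (-ω₀)} {w' g' : ℝ → Vel d → Val m}
    (hw : ∀ᵐ x ∂volume.restrict (Ioi (0 : ℝ)), w' x =ᵐ[volume.restrict V] w x)
    (hg : ∀ᵐ x ∂volume.restrict (Ioi (0 : ℝ)), g' x =ᵐ[volume.restrict V] g x)
    (h : HasTransportDeriv V u w' g') :
    IsWeakDeriv (fun x => transK m V u ω₀ (w x)) fun x => inclK m V ω₀ (g x) := by
  intro θ hθ hs ht
  refine eq_zero_of_inner_test fun ζ hζ hζs => ?_
  have hζ2 : MemLp ζ 2 (velMeasure V 2) := hζ.continuous.memLp_of_hasCompactSupport hζs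
  have hη := contDiff_tensor hθ hζ
  have hηs := hasCompactSupport_tensor hs hζs
  rw [← inner_testVec hζ2 _ (ae_eq_refl _)]
  have key := h (tensor θ ζ) hη hηs
    (tsupport_tensor_subset.trans fun p hp => ⟨ht hp.1, mem_univ _⟩)
  have h1 := integral_transport_eq (u := u) hω₀ hw
    (memLp_slice_two (V := V) (contDiff_dx hη) (hasCompactSupport_dx hη hηs))
  have h2 := integral_source_eq hω₁ hg (memLp_slice_two (V := V) hη hηs)
  rw [h2] at key
  change (∫ x in Ioi (0 : ℝ), ∫ v in V, (v 0 + u) * inner ℝ (w' x v) (dx (tensor θ ζ) (x, v))) = _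
    at key
  rw [h1, dx_tensor hθ] at key
  simp_rw [testCurve_tensor hζ2, real_inner_smul_right, ← real_inner_smul_left] at key
  have hW := integrableOn_Ioc_of_memLp (memLp_transK (u := u) w)
  have hG := integrableOn_Ioc_of_memLp (memLp_inclK g)
  have i₁ := integrableOn_Ioi_smul hW (hθ.continuous_deriv (by simp)) hs.deriv
  have i₂ := integrableOn_Ioi_smul hG hθ.continuous hs
  rw [inner_add_left, real_inner_comm, ← integral_inner i₁, real_inner_comm (testVec V ζ),
    ← integral_inner i₂]
  simp_rw [real_inner_comm _ (testVec V ζ)]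
  rw [key, neg_add_cancel]

-- Young's inequality, where the weights a and 1/a have product 1. The multiplier b leaves room for
-- the ratio of v₁ + u to its regularized modulus.
omit [NeZero d] in
theorem abs_inner_dual_le (g : L2w m V (-ω₀)) (f : L2w m V ω₀) {b : Vel d → ℝ} (hb : ∀ v, |b v| ≤ 1) :
    |∫ v in V, b v * inner ℝ (g v) (f v)| ≤ (‖f‖ ^ 2 + ‖g‖ ^ 2) / 2 := by
  have h₁ := isDens_velMeasure V ω₀
  have h₂ := isDens_velMeasure V (-ω₀)
  have i₁ := h₁.integrable_inner f f
  have i₂ := h₂.integrable_inner g g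
  simp_rw [real_inner_self_eq_norm_sq] at i₁ i₂
  rw [h₁.norm_sq_eq, h₂.norm_sq_eq, ← integral_add i₁ i₂, ← integral_div, ← Real.norm_eq_abs]
  refine norm_integral_le_of_norm_le ((i₁.add i₂).div_const 2) (Eventually.of_forall fun v => ?_)
  have e1 := norm_inner_le_norm (𝕜 := ℝ) (g v) (f v)
  have e2 : ‖b v * inner ℝ (g v) (f v)‖ ≤ ‖g v‖ * ‖f v‖ := by
    rw [norm_mul, Real.norm_eq_abs]
    exact (mul_le_of_le_one_left (norm_nonneg _) (hb v)).trans e1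
  refine e2.trans ?_
  have hw := wt_neg_mul ω₀ v
  have p1 := wt_pos ω₀ v
  have p2 := wt_pos (-ω₀) v
  rw [le_div_iff₀ two_pos]
  have e3 : (Real.sqrt (wt (-ω₀) v) * Real.sqrt (wt ω₀ v)) = 1 := by
    rw [← Real.sqrt_mul p2.le, hw, Real.sqrt_one]
  have e4 := two_mul_le_add_sq (Real.sqrt (wt (-ω₀) v) * ‖g v‖) (Real.sqrt (wt ω₀ v) * ‖f v‖)
  rw [mul_pow, mul_pow, Real.sq_sqrt p1.le, Real.sq_sqrt p2.le] at e4
  have e5 : 2 * (Real.sqrt (wt (-ω₀) v) * ‖g v‖) * (Real.sqrt (wt ω₀ v) * ‖f v‖) =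
      (‖g v‖ * ‖f v‖) * 2 * (Real.sqrt (wt (-ω₀) v) * Real.sqrt (wt ω₀ v)) := by ring
  rw [e5, e3, mul_one] at e4
  linarith

omit [NeZero d] in
theorem integrable_norm_sq {H : Type*} [NormedAddCommGroup H] {μ : Measure ℝ} (f : Lp H 2 μ) :
    Integrable (fun x => ‖f x‖ ^ 2) μ := (Lp.memLp f).integrable_norm_pow (by norm_num)

/-- The boundary value of `(v₁ + u) w` is of the form `(v₁ + u) t` with `t` in the trace space. -/
theorem exists_traceK_eq (hω₀ : 0 ≤ ω₀) (hω₁ : ω₀ ≤ 1) {w : L2xw m V ω₀} {g : L2xw m V (-ω₀)}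
    {c : L2k m V} (h : ∀ᵐ x ∂volume.restrict (Ioi (0 : ℝ)), transK m V u ω₀ (w x) =
      c + ∫ s in (0 : ℝ)..x, inclK m V ω₀ (g s)) : ∃ t : L2flux m V u, traceK m V u t = c := by
  have hD := isDens_velMeasure V (-2)
  -- The target is the bound ∫ |c|²/|v₁+u| ≤ C. The term ε(1+|v|)² in the denominator makes the
  -- corresponding multiplier bounded on the comparison space, so that the energy identity for the
  -- boundary value applies.
  set ε : ℕ → ℝ := fun n => 1 / (n + 1) with hε
  have hε0 : ∀ n, 0 < ε n := fun n => by positivity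
  set C : ℝ := ∫ x in Ioi (0 : ℝ), (‖w x‖ ^ 2 + ‖g x‖ ^ 2) with hC
  have hCi : Integrable (fun x => ‖w x‖ ^ 2 + ‖g x‖ ^ 2) (volume.restrict (Ioi (0 : ℝ))) :=
    (integrable_norm_sq w).add (integrable_norm_sq g)
  have hden : ∀ n (v : Vel d), 0 < |v 0 + u| + ε n * wt 2 v := fun n v =>
    add_pos_of_nonneg_of_pos (abs_nonneg _) (mul_pos (hε0 n) (wt_pos 2 v))
  have hbound : ∀ n, Integrable (fun v => ‖c v‖ ^ 2 / (|v 0 + u| + ε n * wt 2 v)) (volume.restrict V) ∧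
      ∫ v in V, ‖c v‖ ^ 2 / (|v 0 + u| + ε n * wt 2 v) ≤ C := by
    intro n
    set b : Vel d → ℝ := fun v => wt 2 v / (|v 0 + u| + ε n * wt 2 v) with hb
    have hbm : Measurable b := (continuous_wt 2).measurable.div
      ((by fun_prop : Measurable fun v : Vel d => |v 0 + u|).add
        ((continuous_wt 2).measurable.const_mul _))
    have hb1 : ∀ v, |b v| ≤ (ε n)⁻¹ := fun v => by
      rw [hb, abs_of_nonneg (div_nonneg (wt_pos 2 v).le (hden n v).le), div_le_iff₀ (hden n v),
        mul_add, inv_mul_cancel_left₀ (hε0 n).ne']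
      have := mul_nonneg (inv_nonneg.2 (hε0 n).le) (abs_nonneg (v 0 + u))
      linarith
    set κ := mulL m (velMeasure V (-2)) (velMeasure V (-2)) b with hκdef
    have hκ : ∀ f : L2k m V, κ f =ᵐ[volume.restrict V] fun v => b v • f v :=
      mulL_ae hD hD hbm (C := (ε n)⁻¹ ^ 2) fun v => by
        have := pow_le_pow_left₀ (abs_nonneg _) (hb1 v) 2
        rw [sq_abs] at this
        exact mul_le_mul_of_nonneg_right this (wt_pos _ v).le
    have hin : ∀ f f' : L2k m V, inner ℝ (κ f) f' = ∫ v in V, wt (-2) v * (b v * inner ℝ (f v) (f' v)) :=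
      fun f f' => by
        rw [hD.inner_eq]
        refine integral_congr_ae ?_
        filter_upwards [hκ f] with v hv
        rw [hv, real_inner_smul_left]
    have hsym : ∀ f f' : L2k m V, inner ℝ (κ f) f' = inner ℝ f (κ f') := fun f f' => by
      rw [hin, real_inner_comm, hin]
      simp_rw [real_inner_comm (f' _)]
    have hq := inner_boundary_eq h (memLp_transK w) (memLp_inclK g) κ hsym
    have hb2 : ∀ v, wt (-2) v * b v = (|v 0 + u| + ε n * wt 2 v)⁻¹ := fun v => by
      rw [hb, ← mul_div_assoc, mul_comm, wt_two_mul, one_div]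
    have hcc : inner ℝ (κ c) c = ∫ v in V, ‖c v‖ ^ 2 / (|v 0 + u| + ε n * wt 2 v) := by
      rw [hin]
      congr 1; ext1 v
      rw [← mul_assoc, hb2, real_inner_self_eq_norm_sq, div_eq_inv_mul]
    refine ⟨?_, ?_⟩
    · refine (hD.integrable_inner (κ c) c).congr ?_
      filter_upwards [hκ c] with v hv
      rw [hv, real_inner_smul_left, ← mul_assoc, hb2, real_inner_self_eq_norm_sq, div_eq_inv_mul]
    · rw [← hcc, hq]
      -- The regularized weight multiplies v₁ + u, and their product has modulus at most 1 for every
      -- ε. This uniformity is what survives in the limit; the one half cancels the factor 2 of the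
      -- energy identity.
      have hpt : ∀ x, ‖inner ℝ (κ (transK m V u ω₀ (w x))) (inclK m V ω₀ (g x))‖ ≤
          (‖w x‖ ^ 2 + ‖g x‖ ^ 2) / 2 := fun x => by
        have e : inner ℝ (κ (transK m V u ω₀ (w x))) (inclK m V ω₀ (g x)) =
            ∫ v in V, ((v 0 + u) / (|v 0 + u| + ε n * wt 2 v)) * inner ℝ (g x v) (w x v) := by
          rw [hin]
          refine integral_congr_ae ?_
          filter_upwards [transK_ae hω₀ (w x), inclK_ae hω₁ (g x)] with v h₁ h₂
          rw [h₁, h₂, ← mul_assoc, hb2, real_inner_smul_left, real_inner_comm, div_eq_inv_mul,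
            mul_assoc]
        rw [e]
        refine abs_inner_dual_le _ _ fun v => ?_
        rw [abs_div, abs_of_pos (hden n v), div_le_one (hden n v)]
        exact le_add_of_nonneg_right (mul_pos (hε0 n) (wt_pos 2 v)).le
      have := norm_integral_le_of_norm_le (hCi.div_const 2) (Eventually.of_forall hpt)
      rw [integral_div, ← hC, Real.norm_eq_abs] at this
      have := (abs_le.1 this).1
      linarith
  have hcm : Measurable c := (Lp.stronglyMeasurable c).measurable
  -- Fatou's lemma removes the regularization, and the result is exactly the square integrability of
  -- c/(v₁+u) against |v₁+u| dv.
  have hfatou : ∫⁻ v in V, ENNReal.ofReal (‖c v‖ ^ 2 / |v 0 + u|) ≤ ENNReal.ofReal C := by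
    have hlim : ∀ᵐ v ∂volume.restrict V, ENNReal.ofReal (‖c v‖ ^ 2 / |v 0 + u|) =
        liminf (fun n => ENNReal.ofReal (‖c v‖ ^ 2 / (|v 0 + u| + ε n * wt 2 v))) atTop := by
      filter_upwards [ae_coord_ne V u] with v hv
      refine (Tendsto.liminf_eq (ENNReal.tendsto_ofReal ?_)).symm
      have : Tendsto (fun n => |v 0 + u| + ε n * wt 2 v) atTop (𝓝 |v 0 + u|) := by
        have := (tendsto_one_div_add_atTop_nhds_zero_nat (𝕜 := ℝ)).mul_const (wt 2 v)
        rw [zero_mul] at this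
        have := this.const_add |v 0 + u|
        rw [add_zero] at this
        exact this
      exact tendsto_const_nhds.div this (abs_pos.2 hv).ne'
    rw [lintegral_congr_ae hlim]
    refine (lintegral_liminf_le fun n => ?_).trans ?_
    · exact ((hcm.norm.pow_const 2).div ((by fun_prop : Measurable fun v : Vel d => |v 0 + u|).add
        ((continuous_wt 2).measurable.const_mul _))).ennreal_ofReal
    · refine liminf_le_of_le (by isBoundedDefault) fun b hb => ?_
      obtain ⟨n, hn⟩ := hb.exists
      refine hn.trans ?_
      rw [← ofReal_integral_eq_lintegral_ofReal (hbound n).1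
        (Eventually.of_forall fun v => div_nonneg (sq_nonneg _) (hden n v).le)]
      exact ENNReal.ofReal_le_ofReal (hbound n).2
  have hF := isDens_fluxMeasure V u
  have htm : Measurable fun v : Vel d => (v 0 + u)⁻¹ • c v :=
    (by fun_prop : Measurable fun v : Vel d => v 0 + u).inv.smul hcm
  have hmem : MemLp (fun v => (v 0 + u)⁻¹ • c v) 2 (fluxMeasure V u) := by
    refine ⟨htm.aestronglyMeasurable, ?_⟩
    rw [hF.eLpNorm_eq]
    refine ENNReal.rpow_lt_top_of_nonneg (by norm_num) (ne_top_of_le_ne_top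
      (ENNReal.ofReal_ne_top (r := C)) (le_trans (lintegral_mono_ae ?_) hfatou))
    filter_upwards [ae_coord_ne V u] with v hv
    rw [← ofReal_norm, ENNReal.ofReal_rpow_of_nonneg (norm_nonneg _) (by norm_num),
      ← ENNReal.ofReal_mul (abs_nonneg _)]
    refine ENNReal.ofReal_le_ofReal (le_of_eq ?_)
    have := abs_pos.2 hv
    rw [norm_smul, norm_inv, Real.norm_eq_abs, Real.rpow_two]
    field_simp
  refine ⟨hmem.toLp, hD.ext ?_⟩
  have hto := hmem.coeFn_toLp
  rw [hF.ae_eq] at hto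
  filter_upwards [traceK_ae hmem.toLp, hto, ae_coord_ne V u] with v h₁ h₂ h₃
  rw [h₁, h₂, smul_inv_smul₀ h₃]

/-- The transport derivative in the sense of distributions comes with a trace. -/
theorem HasTransportDeriv.exists_trans (hω₀ : 0 ≤ ω₀) (hω₁ : ω₀ ≤ 1) {w : L2xw m V ω₀}
    {g : L2xw m V (-ω₀)} {w' g' : ℝ → Vel d → Val m} (h : HasTransportDeriv V u w' g')
    (hw : ∀ᵐ x ∂volume.restrict (Ioi (0 : ℝ)), w' x =ᵐ[volume.restrict V] w x)
    (hg : ∀ᵐ x ∂volume.restrict (Ioi (0 : ℝ)), g' x =ᵐ[volume.restrict V] g x) :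
    ∃ t : L2flux m V u, Trans u w g t := by
  have hW := integrableOn_Ioc_of_memLp (memLp_transK (u := u) w)
  have hG := integrableOn_Ioc_of_memLp (memLp_inclK g)
  obtain ⟨c, hc⟩ := (isWeakDeriv_of_hasTransportDeriv hω₀ hω₁ hw hg h).exists_primitive hG hW
  obtain ⟨t, rfl⟩ := exists_traceK_eq hω₀ hω₁ hc
  exact ⟨t, IsGreen.of_primitive hc hG hW⟩

theorem Trans.unique_trace {w : L2xw m V ω₀} {g : L2xw m V (-ω₀)} {t t' : L2flux m V u}
    (h : Trans u w g t) (h' : Trans u w g t') : t = t' := traceK_injective (IsGreen.unique h h')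

/-- Test functions θ(x)ζ(v) with θ(0) = 1 isolate the boundary term, and the functions ζ separate
the values of `traceK`. Only Green's formula is asked of the second trace. -/
theorem Trans.unique_of_isTrace (hω₀ : 0 ≤ ω₀) (hω₁ : ω₀ ≤ 1) {w : L2xw m V ω₀}
    {g : L2xw m V (-ω₀)} {t t' : L2flux m V u} (h : Trans u w g t) {w' g' : ℝ → Vel d → Val m}
    (hw : ∀ᵐ x ∂volume.restrict (Ioi (0 : ℝ)), w' x =ᵐ[volume.restrict V] w x)
    (hg : ∀ᵐ x ∂volume.restrict (Ioi (0 : ℝ)), g' x =ᵐ[volume.restrict V] g x)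
    (h' : IsTrace V u w' g' t') : t' = t := by
  have h1 := isTrace_of_trans hω₀ hω₁ h hw hg
  obtain ⟨θ, hθ, hθs, hθ0⟩ := exists_smooth_cutoff
  refine traceK_injective (sub_eq_zero.1 ?_)
  rw [← map_sub]
  refine eq_zero_of_inner_test fun ζ hζ hζs => ?_
  have hη := contDiff_tensor hθ hζ
  have hηs := hasCompactSupport_tensor hθs hζs
  have hζ2 : MemLp ζ 2 (velMeasure V 2) := hζ.continuous.memLp_of_hasCompactSupport hζs
  have e := (h1 _ hη hηs).symm.trans (h' _ hη hηs)
  rw [neg_inj, integral_trace_eq t (memLp_slice_two (V := V) hη hηs 0),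
    integral_trace_eq t' (memLp_slice_two (V := V) hη hηs 0), testCurve_tensor hζ2, hθ0, one_smul] at e
  rw [← inner_testVec hζ2 _ (ae_eq_refl _), map_sub, inner_sub_left, e, sub_self]

theorem Trans.unique_deriv (hω₁ : ω₀ ≤ 1) {w : L2xw m V ω₀} {g g' : L2xw m V (-ω₀)}
    {t t' : L2flux m V u} (h : Trans u w g t) (h' : Trans u w g' t') : g = g' := by
  have hG := integrableOn_Ioc_of_memLp (memLp_inclK g)
  have hG' := integrableOn_Ioc_of_memLp (memLp_inclK g')
  have hz := isOpen_Ioi.ae_eq_zero_of_integral_contDiff_smul_eq_zero (U := Ioi (0 : ℝ)) (μ := volume)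
    (f := fun x => inclK m V ω₀ (g x) - inclK m V ω₀ (g' x)) (by
      rw [locallyIntegrableOn_iff isOpen_Ioi.isLocallyClosed]
      intro k hk hkc
      obtain ⟨b, hb⟩ := hkc.bddAbove
      exact ((hG b).sub (hG' b)).mono_set fun x hx => ⟨hk hx, hb hx⟩) fun θ hθ hs ht => by
    rw [← setIntegral_eq_integral_of_forall_compl_eq_zero (s := Ioi 0) fun x hx => by
      rw [image_eq_zero_of_notMem_tsupport fun h => hx (ht h), zero_smul]]
    simp_rw [smul_sub]
    rw [integral_sub (integrableOn_Ioi_smul hG hθ.continuous hs)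
      (integrableOn_Ioi_smul hG' hθ.continuous hs), sub_eq_zero]
    have e₁ := IsGreen.isWeakDeriv h θ hθ hs ht
    have e₂ := IsGreen.isWeakDeriv h' θ hθ hs ht
    exact add_left_cancel (e₁.trans e₂.symm)
  refine Lp.ext ?_
  refine (ae_restrict_iff' measurableSet_Ioi).2 ?_
  filter_upwards [hz] with x hx hx0
  exact inclK_injective hω₁ (sub_eq_zero.1 (hx hx0))

end Trans

/-! ### An inf-sup stable variational problem -/

section Abstract

variable {G F T : Type*} [NormedAddCommGroup G] [InnerProductSpace ℝ G] [CompleteSpace G]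
  [NormedAddCommGroup F] [InnerProductSpace ℝ F] [NormedAddCommGroup T] [InnerProductSpace ℝ T]

/-- The bilinear form of a mixed problem with the components `pf`, `pg`, `pt`, the projection `O`
and the operator `D`. -/
def mixedForm (pf pg : G →L[ℝ] F) (pt : G →L[ℝ] T) (O D : F →L[ℝ] F) : G →L[ℝ] G →L[ℝ] ℝ :=
  -((innerSL ℝ).bilinearComp (O.comp pf) pg) + (innerSL ℝ).bilinearComp pg (O.comp pf)
    + (innerSL ℝ).bilinearComp (D.comp pf) pf + (innerSL ℝ).bilinearComp pt pt

omit [CompleteSpace G] in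
theorem mixedForm_apply (pf pg : G →L[ℝ] F) (pt : G →L[ℝ] T) (O D : F →L[ℝ] F) (p q : G) :
    mixedForm pf pg pt O D p q = -inner ℝ (O (pf p)) (pg q) + inner ℝ (pg p) (O (pf q))
      + inner ℝ (D (pf p)) (pf q) + inner ℝ (pt p) (pt q) := rfl

/-- On the diagonal the skew terms cancel and nothing controls `pg`. Adding δ times the lift of `pg
p` to the test element leaves `pg` and `pt` unchanged, and the second skew term then contributes
δ‖pg p‖². Lax–Milgram is applied to the form twisted by this invertible map S. -/
theorem existsUnique_mixedForm (pf pg : G →L[ℝ] F) (pt : G →L[ℝ] T) (O D : F →L[ℝ] F)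
    (hnorm : ∀ p, ‖p‖ ^ 2 ≤ ‖pf p‖ ^ 2 + ‖pg p‖ ^ 2 + ‖pt p‖ ^ 2) (lift : F →L[ℝ] G)
    (hf : ∀ y, pf (lift y) = O y) (hg : ∀ y, pg (lift y) = 0) (ht : ∀ y, pt (lift y) = 0)
    (hO : ∀ y, O (O y) = O y) (hgO : ∀ p, inner ℝ (pg p) (O (pg p)) = ‖pg p‖ ^ 2) {c : ℝ}
    (hc : 0 < c) (hD : ∀ y, c * ‖y‖ ^ 2 ≤ inner ℝ (D y) y) (l : G →L[ℝ] ℝ) :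
    ∃! p, ∀ q, mixedForm pf pg pt O D p q = l q := by
  set k : ℝ := ‖D‖ * ‖O‖ with hk
  have hk0 : 0 ≤ k := by positivity
  set δ : ℝ := min 1 (c / (k ^ 2 + 1)) with hδ
  have hδ0 : 0 < δ := lt_min one_pos (by positivity)
  have hδ1 : δ ≤ 1 := min_le_left _ _
  have hδc : δ * k ^ 2 ≤ c := by
    have h1 : δ ≤ c / (k ^ 2 + 1) := min_le_right _ _
    rw [le_div_iff₀ (by positivity)] at h1
    nlinarith
  set S : G →L[ℝ] G := ContinuousLinearMap.id ℝ G + δ • lift.comp pg with hS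
  have hSa : ∀ q, S q = q + δ • lift (pg q) := fun q => rfl
  set B := mixedForm pf pg pt O D with hB
  have hBS : ∀ p, c / 2 * ‖pf p‖ ^ 2 + δ / 2 * ‖pg p‖ ^ 2 + ‖pt p‖ ^ 2 ≤ B p (S p) := by
    intro p
    have e : B p (S p) = inner ℝ (D (pf p)) (pf p) + ‖pt p‖ ^ 2
        + δ * (‖pg p‖ ^ 2 + inner ℝ (D (pf p)) (O (pg p))) := by
      rw [hSa, map_add, map_smul, hB, mixedForm_apply, mixedForm_apply, hf, hg, ht, hO, hgO,
        real_inner_comm (O (pf p)) (pg p), real_inner_self_eq_norm_sq, inner_zero_right,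
        inner_zero_right, smul_eq_mul]
      ring
    have h1 : |inner ℝ (D (pf p)) (O (pg p))| ≤ k * ‖pf p‖ * ‖pg p‖ := by
      refine (abs_real_inner_le_norm _ _).trans ?_
      calc ‖D (pf p)‖ * ‖O (pg p)‖ ≤ (‖D‖ * ‖pf p‖) * (‖O‖ * ‖pg p‖) := by
            gcongr
            exacts [D.le_opNorm _, O.le_opNorm _]
        _ = _ := by rw [hk]; ring
    have h2 := (abs_le.1 h1).1
    have h3 := hD (pf p)
    have h4 : δ * (k * ‖pf p‖ * ‖pg p‖) ≤ c / 2 * ‖pf p‖ ^ 2 + δ / 2 * ‖pg p‖ ^ 2 := by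
      have := mul_nonneg hδ0.le (sq_nonneg (k * ‖pf p‖ - ‖pg p‖))
      have := mul_le_mul_of_nonneg_right hδc (sq_nonneg ‖pf p‖)
      nlinarith
    have h5 := mul_le_mul_of_nonneg_left h2 hδ0.le
    rw [e]
    linarith
  set κ : ℝ := min (c / 2) (δ / 2) with hκ
  have hκ0 : 0 < κ := lt_min (by positivity) (by positivity)
  have hcoer : IsCoercive (B.bilinearComp (ContinuousLinearMap.id ℝ G) S) := by
    refine ⟨κ, hκ0, fun p => ?_⟩
    change κ * ‖p‖ * ‖p‖ ≤ B p (S p)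
    have h1 := hBS p
    have h2 := mul_le_mul_of_nonneg_left (hnorm p) hκ0.le
    have h3 := mul_le_mul_of_nonneg_right (min_le_left (c / 2) (δ / 2)) (sq_nonneg ‖pf p‖)
    have h4 := mul_le_mul_of_nonneg_right (min_le_right (c / 2) (δ / 2)) (sq_nonneg ‖pg p‖)
    have h5 : κ * ‖pt p‖ ^ 2 ≤ 1 * ‖pt p‖ ^ 2 := by
      gcongr
      exact (min_le_right _ _).trans (by linarith)
    nlinarith
  have hsurj : ∀ q, S (q - δ • lift (pg q)) = q := fun q => by
    rw [hSa, map_sub, map_smul, hg, smul_zero, sub_zero, sub_add_cancel]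
  have huniq : ∀ p, (∀ q, B p q = 0) → p = 0 := fun p hp => by
    obtain ⟨C, hC, h⟩ := hcoer
    have h1 : C * ‖p‖ * ‖p‖ ≤ B p (S p) := h p
    rw [hp] at h1
    by_contra hne
    have := norm_pos_iff.2 hne
    have : 0 < C * ‖p‖ * ‖p‖ := by positivity
    linarith
  obtain ⟨r, hr⟩ : ∃ r : G, ∀ q, inner ℝ r q = l (S q) :=
    ⟨(InnerProductSpace.toDual ℝ G).symm (l.comp S), fun q =>
      InnerProductSpace.toDual_symm_apply⟩
  refine ⟨hcoer.continuousLinearEquivOfBilin.symm r, fun q => ?_, fun p hp => ?_⟩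
  · have := hcoer.continuousLinearEquivOfBilin_apply (hcoer.continuousLinearEquivOfBilin.symm r)
      (q - δ • lift (pg q))
    rw [ContinuousLinearEquiv.apply_symm_apply, hr, hsurj] at this
    rw [this]
    change _ = B _ (S _)
    rw [hsurj]
    rfl
  · refine sub_eq_zero.1 (huniq _ fun q => ?_)
    rw [map_sub, _root_.sub_apply, hp, sub_eq_zero]
    have := hcoer.continuousLinearEquivOfBilin_apply (hcoer.continuousLinearEquivOfBilin.symm r)
      (q - δ • lift (pg q))
    rw [ContinuousLinearEquiv.apply_symm_apply, hr, hsurj] at this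
    rw [this]
    change B _ (S _) = _
    rw [hsurj]
    rfl

end Abstract

/-! ### Square integrable curves -/

section Time

variable {H K : Type*} [NormedAddCommGroup H] [InnerProductSpace ℝ H] [CompleteSpace H]
  [NormedAddCommGroup K] [InnerProductSpace ℝ K] [CompleteSpace K]

/-- The measure `dx` on `(0, ∞)`. -/
abbrev halfLine : Measure ℝ := volume.restrict (Ioi (0 : ℝ))

open Classical in
/-- The curve `x ↦ θ(x) z`. -/
def timeTensor (θ : ℝ → ℝ) (z : H) : Lp H 2 halfLine :=
  if h : MemLp (fun x => θ x • z) 2 halfLine then h.toLp else 0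

omit [CompleteSpace H] in
theorem timeTensor_ae {θ : ℝ → ℝ} (hθ : Continuous θ) (hs : HasCompactSupport θ) (z : H) :
    timeTensor θ z =ᵐ[halfLine] fun x => θ x • z := by
  have h : MemLp (fun x => θ x • z) 2 halfLine :=
    (hθ.smul continuous_const).memLp_of_hasCompactSupport hs.smul_right
  rw [timeTensor, dif_pos h]
  exact h.coeFn_toLp

/-- The adjoint moves A onto the test vector, so the weak expression is an inner product with a
fixed element and in particular continuous in w. -/
theorem inner_integral_smul_map (A : H →L[ℝ] K) {θ : ℝ → ℝ} (hθ : Continuous θ)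
    (hs : HasCompactSupport θ) (w : Lp H 2 halfLine) (y : K) :
    inner ℝ (∫ x in Ioi (0 : ℝ), θ x • A (w x)) y =
      inner ℝ w (timeTensor θ (ContinuousLinearMap.adjoint A y)) := by
  have hi := integrableOn_Ioi_smul (integrableOn_Ioc_of_memLp (A.comp_memLp' (Lp.memLp w))) hθ hs
  rw [real_inner_comm, L2.inner_def]
  simp only [Function.comp_apply] at hi
  rw [← integral_inner hi]
  refine integral_congr_ae ?_
  filter_upwards [timeTensor_ae hθ hs (ContinuousLinearMap.adjoint A y)] with x hx
  rw [hx, real_inner_smul_right, real_inner_smul_right, ContinuousLinearMap.adjoint_inner_right,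
    real_inner_comm]

end Time

/-! ### The closed space of triples. -/

section Trans

variable {d m : ℕ} {V : Set (Vel d)} [NeZero d] {u ω₀ : ℝ}

/-- The defect in Green's formula, for the test function `θ(x) y`. -/
def greenDefect (u : ℝ) (θ : ℝ → ℝ) (y : L2k m V) (w : L2xw m V ω₀) (g : L2xw m V (-ω₀))
    (t : L2flux m V u) : ℝ :=
  inner ℝ w (timeTensor (deriv θ) (ContinuousLinearMap.adjoint (transK m V u ω₀) y))
    + inner ℝ g (timeTensor θ (ContinuousLinearMap.adjoint (inclK m V ω₀) y))
    + θ 0 * inner ℝ (traceK m V u t) y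

/-- Green's formula becomes the vanishing of a family of continuous linear functionals of (w, g, t).
Linearity of the set of triples and its closedness, hence completeness, both follow from this form.
-/
theorem trans_iff {w : L2xw m V ω₀} {g : L2xw m V (-ω₀)} {t : L2flux m V u} :
    Trans u w g t ↔ ∀ θ : ℝ → ℝ, ContDiff ℝ (⊤ : ℕ∞) θ → HasCompactSupport θ → ∀ y,
      greenDefect u θ y w g t = 0 := by
  have e : ∀ θ : ℝ → ℝ, ContDiff ℝ (⊤ : ℕ∞) θ → HasCompactSupport θ → ∀ y,
      greenDefect u θ y w g t = inner ℝ ((∫ x in Ioi (0 : ℝ), deriv θ x • transK m V u ω₀ (w x)) +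
        (∫ x in Ioi (0 : ℝ), θ x • inclK m V ω₀ (g x)) + θ 0 • traceK m V u t) y :=
    fun θ hθ hs y => by
      rw [greenDefect, inner_add_left, inner_add_left,
        inner_integral_smul_map _ (hθ.continuous_deriv (by simp)) hs.deriv,
        inner_integral_smul_map _ hθ.continuous hs, real_inner_smul_left]
  constructor
  · intro h θ hθ hs y
    rw [e θ hθ hs, h θ hθ hs, neg_add_cancel, inner_zero_left]
  · intro h θ hθ hs
    refine eq_neg_of_add_eq_zero_left ((inner_self_eq_zero (𝕜 := ℝ)).1 ?_)
    rw [← e θ hθ hs]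
    exact h θ hθ hs _

theorem Trans.zero : Trans (m := m) (V := V) (ω₀ := ω₀) u 0 0 0 :=
  trans_iff.2 fun θ _ _ y => by simp [greenDefect]

theorem Trans.add {w w' : L2xw m V ω₀} {g g' : L2xw m V (-ω₀)} {t t' : L2flux m V u}
    (h : Trans u w g t) (h' : Trans u w' g' t') : Trans u (w + w') (g + g') (t + t') :=
  trans_iff.2 fun θ hθ hs y => by
    have e := trans_iff.1 h θ hθ hs y
    have e' := trans_iff.1 h' θ hθ hs y
    simp only [greenDefect, inner_add_left, map_add] at e e' ⊢
    linarith

theorem Trans.smul {w : L2xw m V ω₀} {g : L2xw m V (-ω₀)} {t : L2flux m V u}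
    (h : Trans u w g t) (c : ℝ) : Trans u (c • w) (c • g) (c • t) :=
  trans_iff.2 fun θ hθ hs y => by
    have e := trans_iff.1 h θ hθ hs y
    simp only [greenDefect, real_inner_smul_left, map_smul] at e ⊢
    linear_combination c * e

/-- The even part of a curve. -/
def evenX (m : ℕ) (V : Set (Vel d)) (u q : ℝ) : L2xw m V q →L[ℝ] L2xw m V q :=
  (evenL m (velMeasure V q) u).compLpL 2 halfLine

/-- The odd part of a curve. -/
def oddX (m : ℕ) (V : Set (Vel d)) (u q : ℝ) : L2xw m V q →L[ℝ] L2xw m V q :=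
  (oddL m (velMeasure V q) u).compLpL 2 halfLine

/-- The isometry `g ↦ g / a` for curves. -/
def rieszX (m : ℕ) (V : Set (Vel d)) (ω₀ : ℝ) : L2xw m V (-ω₀) →L[ℝ] L2xw m V ω₀ :=
  (riesz m V ω₀).compLpL 2 halfLine

theorem evenX_ae (q : ℝ) (f : L2xw m V q) :
    evenX m V u q f =ᵐ[halfLine] fun x => evenL m (velMeasure V q) u (f x) :=
  ContinuousLinearMap.coeFn_compLpL _ f

theorem oddX_ae (q : ℝ) (f : L2xw m V q) :
    oddX m V u q f =ᵐ[halfLine] fun x => oddL m (velMeasure V q) u (f x) :=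
  ContinuousLinearMap.coeFn_compLpL _ f

omit [NeZero d] in
theorem rieszX_ae (g : L2xw m V (-ω₀)) :
    rieszX m V ω₀ g =ᵐ[halfLine] fun x => riesz m V ω₀ (g x) :=
  ContinuousLinearMap.coeFn_compLpL _ g

omit [NeZero d] in
theorem norm_rieszX (g : L2xw m V (-ω₀)) : ‖rieszX m V ω₀ g‖ = ‖g‖ := by
  rw [Lp.norm_def, Lp.norm_def]
  congr 1
  refine eLpNorm_congr_norm_ae ?_
  filter_upwards [rieszX_ae g] with x hx
  rw [hx, norm_riesz]

omit [NeZero d] in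
theorem inner_rieszX (g : L2xw m V (-ω₀)) (f : L2xw m V ω₀) :
    inner ℝ (rieszX m V ω₀ g) f = ∫ x in Ioi (0 : ℝ), ∫ v in V, inner ℝ (g x v) (f x v) := by
  rw [L2.inner_def]
  refine integral_congr_ae ?_
  filter_upwards [rieszX_ae g] with x hx
  rw [hx, inner_riesz]

/-- The Hilbert space of triples of a function, a transport derivative and a trace. -/
abbrev Triple (m : ℕ) (V : Set (Vel d)) (u ω₀ : ℝ) :=
  WithLp 2 (L2xw m V ω₀ × WithLp 2 (L2xw m V (-ω₀) × L2flux m V u))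

/-- The space `Γ`, as the space of triples `(f, (v₁ + u) ∂ₓ f⁺, f⁺|_{x=0})`. -/
def gamTriple (m : ℕ) (V : Set (Vel d)) (u ω₀ : ℝ) : Submodule ℝ (Triple m V u ω₀) where
  carrier := {p | Trans u (evenX m V u ω₀ p.fst) p.snd.fst p.snd.snd}
  zero_mem' := by
    have := Trans.zero (m := m) (V := V) (u := u) (ω₀ := ω₀)
    simpa using this
  add_mem' := fun {p q} hp hq => by
    have := Trans.add hp hq
    rw [← map_add] at this
    exact this
  smul_mem' := fun c p hp => by
    have := Trans.smul hp c
    rw [← map_smul] at this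
    exact this

theorem mem_gamTriple {p : Triple m V u ω₀} :
    p ∈ gamTriple m V u ω₀ ↔ Trans u (evenX m V u ω₀ p.fst) p.snd.fst p.snd.snd := Iff.rfl

theorem isClosed_gamTriple : IsClosed (gamTriple m V u ω₀ : Set (Triple m V u ω₀)) := by
  have : (gamTriple m V u ω₀ : Set (Triple m V u ω₀)) = ⋂ (θ : ℝ → ℝ) (_ : ContDiff ℝ (⊤ : ℕ∞) θ)
      (_ : HasCompactSupport θ) (y : L2k m V),
      {p | greenDefect u θ y (evenX m V u ω₀ p.fst) p.snd.fst p.snd.snd = 0} := by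
    ext p
    simp only [mem_iInter, mem_ofPred_eq, SetLike.mem_coe, mem_gamTriple, trans_iff]
  rw [this]
  refine isClosed_iInter fun θ => isClosed_iInter fun _ => isClosed_iInter fun _ =>
    isClosed_iInter fun y => isClosed_eq ?_ continuous_const
  have c1 : Continuous fun p : Triple m V u ω₀ => p.fst := WithLp.prod_continuous_ofLp _ _ _ |>.fst
  have c2 : Continuous fun p : Triple m V u ω₀ => p.snd := WithLp.prod_continuous_ofLp _ _ _ |>.snd
  have c3 : Continuous fun p : Triple m V u ω₀ => p.snd.fst :=
    ((WithLp.prod_continuous_ofLp _ _ _).comp c2).fst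
  have c4 : Continuous fun p : Triple m V u ω₀ => p.snd.snd :=
    ((WithLp.prod_continuous_ofLp _ _ _).comp c2).snd
  unfold greenDefect
  exact (((evenX m V u ω₀).continuous.comp c1).inner continuous_const).add
    (c3.inner continuous_const) |>.add
      (continuous_const.mul (((traceK m V u).continuous.comp c4).inner continuous_const))

instance : CompleteSpace (gamTriple m V u ω₀) := isClosed_gamTriple.completeSpace_coe

end Trans

/-! ### Reflection and the transport derivative -/

section Map

variable {K K' : Type*} [NormedAddCommGroup K] [InnerProductSpace ℝ K] [CompleteSpace K]
  [NormedAddCommGroup K'] [InnerProductSpace ℝ K'] [CompleteSpace K'] {W G : ℝ → K} {c : K}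

theorem IsGreen.map (h : IsGreen W G c) (hW : ∀ X, IntegrableOn W (Ioc 0 X))
    (hG : ∀ X, IntegrableOn G (Ioc 0 X)) (T : K →L[ℝ] K') :
    IsGreen (fun x => T (W x)) (fun x => T (G x)) (T c) := fun θ hθ hs => by
  have i₁ := integrableOn_Ioi_smul hW (hθ.continuous_deriv (by simp)) hs.deriv
  have i₂ := integrableOn_Ioi_smul hG hθ.continuous hs
  have := congrArg T (h θ hθ hs)
  rw [map_add, ← T.integral_comp_comm i₁, ← T.integral_comp_comm i₂, map_neg, map_smul] at this
  simpa only [map_smul] using this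

end Map

theorem inner_map_smul_sub {E F : Type*} [NormedAddCommGroup E] [NormedSpace ℝ E]
    [NormedAddCommGroup F] [InnerProductSpace ℝ F] (T : E →L[ℝ] F) (c : ℝ) (a b : E) (f : F) :
    inner ℝ (T (c • (a - b))) f = c * (inner ℝ (T a) f - inner ℝ (T b) f) := by
  rw [map_smul, map_sub, real_inner_smul_left, inner_sub_left]

section Reflection

variable {d m : ℕ} {V : Set (Vel d)} [NeZero d] {u ω₀ q : ℝ}

theorem measurableEmbedding_reflect (u : ℝ) : MeasurableEmbedding (reflect (d := d) u) :=
  (MeasurableEquiv.ofInvolutive (reflect u) (reflect_reflect u)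
    (measurePreserving_reflect u).measurable).measurableEmbedding

theorem IsReflDens.integral_inner_reflect {M : Measure (Vel d)} {ρ : Vel d → ℝ}
    (h : IsReflDens V u M ρ) (f g : Vel d → Val m) :
    ∫ v in V, inner ℝ (g v) (f (reflect u v)) = ∫ v in V, inner ℝ (g (reflect u v)) (f v) := by
  rw [← h.mp.integral_comp (measurableEmbedding_reflect u)]
  simp_rw [reflect_reflect]

/-- The reflection of a curve. -/
def reflX (m : ℕ) (V : Set (Vel d)) (u q : ℝ) : L2xw m V q →L[ℝ] L2xw m V q :=
  (reflL m (velMeasure V q) u).compLpL 2 halfLine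

theorem reflX_ae (f : L2xw m V q) :
    reflX m V u q f =ᵐ[halfLine] fun x => reflL m (velMeasure V q) u (f x) :=
  ContinuousLinearMap.coeFn_compLpL _ f

theorem evenX_apply (f : L2xw m V q) : evenX m V u q f = (1 / 2 : ℝ) • (f + reflX m V u q f) := by
  refine Lp.ext ?_
  filter_upwards [evenX_ae (u := u) q f, reflX_ae (u := u) f, Lp.coeFn_smul (1 / 2 : ℝ)
    (f + reflX m V u q f), Lp.coeFn_add f (reflX m V u q f)] with x h₁ h₂ h₃ h₄
  rw [h₁, h₃, Pi.smul_apply, h₄, Pi.add_apply, h₂, evenL_apply]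

theorem oddX_apply (f : L2xw m V q) : oddX m V u q f = (1 / 2 : ℝ) • (f - reflX m V u q f) := by
  refine Lp.ext ?_
  filter_upwards [oddX_ae (u := u) q f, reflX_ae (u := u) f, Lp.coeFn_smul (1 / 2 : ℝ)
    (f - reflX m V u q f), Lp.coeFn_sub f (reflX m V u q f)] with x h₁ h₂ h₃ h₄
  rw [h₁, h₃, Pi.smul_apply, h₄, Pi.sub_apply, h₂, oddL_apply]

variable (hV : MeasurableSet V) (hVu : ∀ v, reflect u v ∈ V ↔ v ∈ V)
include hV hVu

theorem reflX_reflX (f : L2xw m V q) : reflX m V u q (reflX m V u q f) = f := by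
  refine Lp.ext ?_
  filter_upwards [reflX_ae (u := u) f, reflX_ae (u := u) (reflX m V u q f)] with x h₁ h₂
  rw [h₂, h₁, reflL_reflL (isReflDens_velMeasure hV hVu q)]

theorem evenX_evenX (f : L2xw m V q) : evenX m V u q (evenX m V u q f) = evenX m V u q f := by
  simp only [evenX_apply, map_smul, map_add, reflX_reflX hV hVu]
  module

theorem evenX_oddX (f : L2xw m V q) : evenX m V u q (oddX m V u q f) = 0 := by
  simp only [evenX_apply, oddX_apply, map_smul, map_sub, reflX_reflX hV hVu]
  module

theorem oddX_oddX (f : L2xw m V q) : oddX m V u q (oddX m V u q f) = oddX m V u q f := by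
  simp only [oddX_apply, map_smul, map_sub, reflX_reflX hV hVu]
  module

theorem inner_rieszX_reflX (g : L2xw m V (-ω₀)) (f : L2xw m V ω₀) :
    inner ℝ (rieszX m V ω₀ g) (reflX m V u ω₀ f) =
      inner ℝ (rieszX m V ω₀ (reflX m V u (-ω₀) g)) f := by
  rw [inner_rieszX, inner_rieszX]
  refine integral_congr_ae ?_
  filter_upwards [reflX_ae (u := u) f, reflX_ae (u := u) g] with x h₁ h₂
  have e₁ := reflL_ae (isReflDens_velMeasure hV hVu ω₀) (f x)
  have e₂ := reflL_ae (isReflDens_velMeasure hV hVu (-ω₀)) (g x)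
  rw [h₁, h₂]
  trans ∫ v in V, inner ℝ (g x v) (f x (reflect u v))
  · refine integral_congr_ae ?_
    filter_upwards [e₁] with v hv
    rw [hv]
  rw [(isReflDens_velMeasure hV hVu ω₀).integral_inner_reflect]
  refine integral_congr_ae ?_
  filter_upwards [e₂] with v hv
  rw [hv]

theorem inner_rieszX_oddX (g : L2xw m V (-ω₀)) (f : L2xw m V ω₀) :
    inner ℝ (rieszX m V ω₀ g) (oddX m V u ω₀ f) =
      inner ℝ (rieszX m V ω₀ (oddX m V u (-ω₀) g)) f := by
  rw [oddX_apply, oddX_apply, real_inner_smul_right, inner_sub_right, inner_rieszX_reflX hV hVu]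
  exact (inner_map_smul_sub (rieszX m V ω₀) _ _ _ _).symm

/-- The factor v₁ + u changes sign under the reflection. This is the origin of all parity changes
between functions and transport derivatives. -/
theorem transK_reflL (hω₀ : 0 ≤ ω₀) (f : L2w m V ω₀) :
    transK m V u ω₀ (reflL m _ u f) = -reflL m _ u (transK m V u ω₀ f) := by
  have hK := isReflDens_velMeasure hV hVu (-2)
  refine hK.ext ?_
  filter_upwards [transK_ae (u := u) hω₀ (reflL m _ u f), hK.neg_ae (reflL m _ u (transK m V u ω₀ f)),
    reflL_ae hK (transK m V u ω₀ f), reflL_ae (isReflDens_velMeasure hV hVu ω₀) f,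
    hK.mp.quasiMeasurePreserving.ae (transK_ae (u := u) hω₀ f)] with v h₁ h₂ h₃ h₄ h₅
  rw [h₁, h₂, h₃, h₄, h₅, reflect_coord, neg_smul, neg_neg]

theorem traceK_reflL (t : L2flux m V u) :
    traceK m V u (reflL m _ u t) = -reflL m _ u (traceK m V u t) := by
  have hK := isReflDens_velMeasure hV hVu (-2)
  refine hK.ext ?_
  filter_upwards [traceK_ae (reflL m _ u t), hK.neg_ae (reflL m _ u (traceK m V u t)),
    reflL_ae hK (traceK m V u t), reflL_ae (isReflDens_fluxMeasure hV hVu) t,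
    hK.mp.quasiMeasurePreserving.ae (traceK_ae t)] with v h₁ h₂ h₃ h₄ h₅
  rw [h₁, h₂, h₃, h₄, h₅, reflect_coord, neg_smul, neg_neg]

theorem inclK_reflL (hω₁ : ω₀ ≤ 1) (g : L2w m V (-ω₀)) :
    inclK m V ω₀ (reflL m _ u g) = reflL m _ u (inclK m V ω₀ g) := by
  have hK := isReflDens_velMeasure hV hVu (-2)
  refine hK.ext ?_
  filter_upwards [inclK_ae hω₁ (reflL m _ u g), reflL_ae hK (inclK m V ω₀ g),
    reflL_ae (isReflDens_velMeasure hV hVu (-ω₀)) g,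
    hK.mp.quasiMeasurePreserving.ae (inclK_ae hω₁ g)] with v h₁ h₂ h₃ h₄
  rw [h₁, h₂, h₃, h₄]

/-- Minus the reflection is applied to the whole identity in the comparison space. It anticommutes
with multiplication by v₁ + u, so the sign disappears from the function and the trace and stays on
the derivative. -/
theorem Trans.refl (hω₀ : 0 ≤ ω₀) (hω₁ : ω₀ ≤ 1) {w : L2xw m V ω₀} {g : L2xw m V (-ω₀)}
    {t : L2flux m V u} (h : Trans u w g t) :
    Trans u (reflX m V u ω₀ w) (-reflX m V u (-ω₀) g) (reflL m _ u t) := by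
  have h' := IsGreen.map h (integrableOn_Ioc_of_memLp (memLp_transK w))
    (integrableOn_Ioc_of_memLp (memLp_inclK g)) (-reflL m (velMeasure V (-2)) u)
  intro θ hθ hs
  refine Eq.trans ?_ ((h' θ hθ hs).trans ?_)
  · congr 1
    · refine integral_congr_ae ?_
      filter_upwards [reflX_ae (u := u) w] with x hx
      rw [hx, transK_reflL hV hVu hω₀]
      rfl
    · refine integral_congr_ae ?_
      filter_upwards [reflX_ae (u := u) g, Lp.coeFn_neg (reflX m V u (-ω₀) g)] with x h₁ h₂
      rw [h₂, Pi.neg_apply, map_neg, h₁, inclK_reflL hV hVu hω₁]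
      rfl
  · rw [traceK_reflL hV hVu]
    rfl

theorem Trans.even (hω₀ : 0 ≤ ω₀) (hω₁ : ω₀ ≤ 1) {w : L2xw m V ω₀} {g : L2xw m V (-ω₀)}
    {t : L2flux m V u} (h : Trans u w g t) :
    Trans u (evenX m V u ω₀ w) (oddX m V u (-ω₀) g) (evenL m _ u t) := by
  have := (h.add (h.refl hV hVu hω₀ hω₁)).smul (1 / 2)
  rwa [← evenX_apply, ← sub_eq_add_neg, ← oddX_apply] at this

/-- An even function equals its even part, so its derivative equals its own odd part by uniqueness.
This is what makes g/a usable as a correction of the test function in the inf-sup argument. -/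
theorem oddX_eq_of_trans (hω₀ : 0 ≤ ω₀) (hω₁ : ω₀ ≤ 1) {f : L2xw m V ω₀} {g : L2xw m V (-ω₀)}
    {t : L2flux m V u} (h : Trans u (evenX m V u ω₀ f) g t) : oddX m V u (-ω₀) g = g := by
  have := h.even hV hVu hω₀ hω₁
  rw [evenX_evenX hV hVu] at this
  exact this.unique_deriv hω₁ h

end Reflection

/-! ### The variational problem for triples -/

section Variational

variable {d m : ℕ} {V : Set (Vel d)} [NeZero d] {u ω₀ : ℝ}

/-- The action of an operator on curves, composed with the identification of the dual space. -/
def opX (D : L2w m V ω₀ →L[ℝ] L2w m V (-ω₀)) : L2xw m V ω₀ →L[ℝ] L2xw m V ω₀ :=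
  ((riesz m V ω₀).comp D).compLpL 2 halfLine

omit [NeZero d] in
theorem inner_opX (D : L2w m V ω₀ →L[ℝ] L2w m V (-ω₀)) (f g : L2xw m V ω₀) :
    inner ℝ (opX D f) g = ∫ x in Ioi (0 : ℝ), ∫ v in V, inner ℝ (D (f x) v) (g x v) := by
  rw [L2.inner_def]
  refine integral_congr_ae ?_
  filter_upwards [ContinuousLinearMap.coeFn_compLpL ((riesz m V ω₀).comp D) f] with x hx
  rw [opX, hx, ContinuousLinearMap.comp_apply, inner_riesz]

omit [NeZero d] in
theorem inner_opX_self_ge {D : L2w m V ω₀ →L[ℝ] L2w m V (-ω₀)} {c : ℝ}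
    (hD : ∀ f, c * ‖f‖ ^ 2 ≤ ∫ v in V, inner ℝ (D f v) (f v)) (f : L2xw m V ω₀) :
    c * ‖f‖ ^ 2 ≤ inner ℝ (opX D f) f := by
  rw [← real_inner_self_eq_norm_sq, L2.inner_def, L2.inner_def, ← integral_const_mul]
  refine integral_mono_ae ((L2.integrable_inner f f).const_mul c) (L2.integrable_inner _ _) ?_
  filter_upwards [ContinuousLinearMap.coeFn_compLpL ((riesz m V ω₀).comp D) f] with x hx
  rw [opX, hx, ContinuousLinearMap.comp_apply, inner_riesz, real_inner_self_eq_norm_sq]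
  exact hD (f x)

end Variational

/-! ### Solvability on a closed subspace of triples. -/

section Components

variable {E₁ E₂ E₃ : Type*} [NormedAddCommGroup E₁] [InnerProductSpace ℝ E₁]
  [NormedAddCommGroup E₂] [InnerProductSpace ℝ E₂] [NormedAddCommGroup E₃] [InnerProductSpace ℝ E₃]

theorem exists_components : ∃ (π₁ : WithLp 2 (E₁ × WithLp 2 (E₂ × E₃)) →L[ℝ] E₁)
    (π₂ : WithLp 2 (E₁ × WithLp 2 (E₂ × E₃)) →L[ℝ] E₂)
    (π₃ : WithLp 2 (E₁ × WithLp 2 (E₂ × E₃)) →L[ℝ] E₃)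
    (ι : E₁ →L[ℝ] WithLp 2 (E₁ × WithLp 2 (E₂ × E₃))),
    (∀ p, π₁ p = p.fst) ∧ (∀ p, π₂ p = p.snd.fst) ∧ (∀ p, π₃ p = p.snd.snd) ∧
      (∀ y, ι y = WithLp.toLp 2 (y, WithLp.toLp 2 ((0 : E₂), (0 : E₃)))) ∧
      ∀ p, ‖p‖ ^ 2 = ‖π₁ p‖ ^ 2 + ‖π₂ p‖ ^ 2 + ‖π₃ p‖ ^ 2 :=
  ⟨WithLp.fstL 2 ℝ E₁ (WithLp 2 (E₂ × E₃)),
    (WithLp.fstL 2 ℝ E₂ E₃).comp (WithLp.sndL 2 ℝ E₁ (WithLp 2 (E₂ × E₃))),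
    (WithLp.sndL 2 ℝ E₂ E₃).comp (WithLp.sndL 2 ℝ E₁ (WithLp 2 (E₂ × E₃))),
    ((WithLp.prodContinuousLinearEquiv 2 ℝ E₁ (WithLp 2 (E₂ × E₃))).symm :
      E₁ × WithLp 2 (E₂ × E₃) →L[ℝ] _).comp (ContinuousLinearMap.inl ℝ _ _),
    fun _ => rfl, fun _ => rfl, fun _ => rfl, fun _ => rfl, fun p => by
      rw [WithLp.prod_norm_sq_eq_of_L2, WithLp.prod_norm_sq_eq_of_L2, ← add_assoc]
      rfl⟩

/-- The restriction of the three component maps to S meets the requirements of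
`existsUnique_mixedForm`: J is isometric, so the norm is the sum of the components, and y ↦ ι(O y)
is the lift, with values in S. -/
theorem existsUnique_components {H : Type*} [NormedAddCommGroup H] [InnerProductSpace ℝ H]
    (S : Submodule ℝ H) [CompleteSpace S] (π₁ : H →L[ℝ] E₁) (π₂ : H →L[ℝ] E₂) (π₃ : H →L[ℝ] E₃)
    (ι : E₁ →L[ℝ] H) (hn : ∀ p, ‖p‖ ^ 2 = ‖π₁ p‖ ^ 2 + ‖π₂ p‖ ^ 2 + ‖π₃ p‖ ^ 2)
    (h₁ : ∀ y, π₁ (ι y) = y) (h₂ : ∀ y, π₂ (ι y) = 0) (h₃ : ∀ y, π₃ (ι y) = 0)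
    (J : E₂ →L[ℝ] E₁) (hJ : ∀ g, ‖J g‖ = ‖g‖)
    (O D : E₁ →L[ℝ] E₁) (hO : ∀ y, O (O y) = O y) (hlift : ∀ y, ι (O y) ∈ S)
    (hgO : ∀ p ∈ S, inner ℝ (J (π₂ p)) (O (J (π₂ p))) = ‖J (π₂ p)‖ ^ 2) {c : ℝ}
    (hc : 0 < c) (hD : ∀ y, c * ‖y‖ ^ 2 ≤ inner ℝ (D y) y) (φ : E₃) :
    ∃ p ∈ S, (∀ q ∈ S, -inner ℝ (O (π₁ p)) (J (π₂ q)) + inner ℝ (J (π₂ p)) (O (π₁ q))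
      + inner ℝ (D (π₁ p)) (π₁ q) + inner ℝ (π₃ p) (π₃ q) = 2 * inner ℝ φ (π₃ q)) ∧
      ∀ p' ∈ S, (∀ q ∈ S, -inner ℝ (O (π₁ p')) (J (π₂ q)) + inner ℝ (J (π₂ p')) (O (π₁ q))
        + inner ℝ (D (π₁ p')) (π₁ q) + inner ℝ (π₃ p') (π₃ q) = 2 * inner ℝ φ (π₃ q)) →
        p' = p := by
  have hn' : ∀ p : S, ‖p‖ ^ 2 ≤ ‖π₁.comp S.subtypeL p‖ ^ 2 + ‖(J.comp π₂).comp S.subtypeL p‖ ^ 2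
      + ‖π₃.comp S.subtypeL p‖ ^ 2 := fun p => by
    change ‖(p : H)‖ ^ 2 ≤ ‖π₁ p‖ ^ 2 + ‖J (π₂ p)‖ ^ 2 + ‖π₃ p‖ ^ 2
    rw [hn, hJ]
  have hg : ∀ y, (J.comp π₂).comp S.subtypeL ((ι.comp O).codRestrict S hlift y) = 0 := fun y => by
    change J (π₂ (ι (O y))) = 0
    rw [h₂, map_zero]
  obtain ⟨p, hp, hu⟩ := existsUnique_mixedForm (π₁.comp S.subtypeL) ((J.comp π₂).comp S.subtypeL)
    (π₃.comp S.subtypeL) O D hn' ((ι.comp O).codRestrict S hlift) (fun y => h₁ (O y)) hg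
    (fun y => h₃ (O y)) hO (fun p => hgO p p.2) hc hD
    ((2 : ℝ) • (innerSL ℝ φ).comp (π₃.comp S.subtypeL))
  refine ⟨p, p.2, fun q hq => hp ⟨q, hq⟩, fun p' hp' h => ?_⟩
  exact congrArg Subtype.val (hu ⟨p', hp'⟩ fun q => h q q.2)

theorem existsUnique_triple (S : Submodule ℝ (WithLp 2 (E₁ × WithLp 2 (E₂ × E₃)))) [CompleteSpace S]
    (J : E₂ →L[ℝ] E₁) (hJ : ∀ g, ‖J g‖ = ‖g‖) (O D : E₁ →L[ℝ] E₁) (hO : ∀ y, O (O y) = O y)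
    (hlift : ∀ y, WithLp.toLp 2 (O y, WithLp.toLp 2 ((0 : E₂), (0 : E₃))) ∈ S)
    (hgO : ∀ p ∈ S, inner ℝ (J p.snd.fst) (O (J p.snd.fst)) = ‖J p.snd.fst‖ ^ 2) {c : ℝ}
    (hc : 0 < c) (hD : ∀ y, c * ‖y‖ ^ 2 ≤ inner ℝ (D y) y) (φ : E₃) :
    ∃ p ∈ S, (∀ q ∈ S, -inner ℝ (O p.fst) (J q.snd.fst) + inner ℝ (J p.snd.fst) (O q.fst)
      + inner ℝ (D p.fst) q.fst + inner ℝ p.snd.snd q.snd.snd = 2 * inner ℝ φ q.snd.snd) ∧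
      ∀ p' ∈ S, (∀ q ∈ S, -inner ℝ (O p'.fst) (J q.snd.fst) + inner ℝ (J p'.snd.fst) (O q.fst)
        + inner ℝ (D p'.fst) q.fst + inner ℝ p'.snd.snd q.snd.snd = 2 * inner ℝ φ q.snd.snd) →
        p' = p := by
  obtain ⟨π₁, π₂, π₃, ι, h₁, h₂, h₃, hι, hn⟩ := exists_components (E₁ := E₁) (E₂ := E₂) (E₃ := E₃)
  simp_rw [← h₁, ← h₂, ← h₃, ← hι] at hlift hgO ⊢
  refine existsUnique_components S π₁ π₂ π₃ ι hn (fun y => ?_) (fun y => ?_) (fun y => ?_) J hJ O D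
    hO hlift hgO hc hD φ
  · rw [h₁, hι]; rfl
  · rw [h₂, hι]; rfl
  · rw [h₃, hι]; rfl

end Components

/-! ### Solvability of the weak formulation. -/

section Variational

variable {d m : ℕ} {V : Set (Vel d)} [NeZero d] {u ω₀ : ℝ}

/-- The weak formulation in terms of triples. -/
def IsWeakSol (D : L2w m V ω₀ →L[ℝ] L2w m V (-ω₀)) (φ : L2flux m V u) (f : L2xw m V ω₀)
    (g : L2xw m V (-ω₀)) (t : L2flux m V u) : Prop :=
  ∀ ψ gψ tψ, Trans u (evenX m V u ω₀ ψ) gψ tψ →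
    -inner ℝ (oddX m V u ω₀ f) (rieszX m V ω₀ gψ) + inner ℝ (rieszX m V ω₀ g) (oddX m V u ω₀ ψ)
      + inner ℝ (opX D f) ψ + inner ℝ t tψ = 2 * inner ℝ φ tψ

/-- The two structural inputs are parity facts: an odd function has even part zero, so (odd part, 0,
0) is an admissible triple, and transport derivatives of even parts are odd. -/
theorem existsUnique_isWeakSol (hV : MeasurableSet V) (hVu : ∀ v, reflect u v ∈ V ↔ v ∈ V)
    (hω₀ : 0 ≤ ω₀) (hω₁ : ω₀ ≤ 1) {D : L2w m V ω₀ →L[ℝ] L2w m V (-ω₀)} {c : ℝ} (hc : 0 < c)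
    (hD : ∀ f, c * ‖f‖ ^ 2 ≤ ∫ v in V, inner ℝ (D f v) (f v)) (φ : L2flux m V u) :
    ∃ f g t, Trans u (evenX m V u ω₀ f) g t ∧ IsWeakSol D φ f g t ∧
      ∀ f' g' t', Trans u (evenX m V u ω₀ f') g' t' → IsWeakSol D φ f' g' t' → f' = f := by
  have hlift : ∀ y, (WithLp.toLp 2 (oddX m V u ω₀ y, WithLp.toLp 2 (0, 0)) : Triple m V u ω₀) ∈
      gamTriple m V u ω₀ := fun y => by
    have : Trans u (evenX m V u ω₀ (oddX m V u ω₀ y)) 0 0 := by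
      rw [evenX_oddX hV hVu]
      exact Trans.zero
    exact this
  have hgO : ∀ p ∈ gamTriple m V u ω₀, inner ℝ (rieszX m V ω₀ p.snd.fst)
      (oddX m V u ω₀ (rieszX m V ω₀ p.snd.fst)) = ‖rieszX m V ω₀ p.snd.fst‖ ^ 2 := fun p hp => by
    rw [inner_rieszX_oddX hV hVu, oddX_eq_of_trans hV hVu hω₀ hω₁ (mem_gamTriple.1 hp),
      real_inner_self_eq_norm_sq]
  obtain ⟨p, hp, hs, hu⟩ := existsUnique_triple (gamTriple m V u ω₀) (rieszX m V ω₀) norm_rieszX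
    (oddX m V u ω₀) (opX D) (oddX_oddX hV hVu) hlift hgO hc (inner_opX_self_ge hD) φ
  refine ⟨p.fst, p.snd.fst, p.snd.snd, hp, fun ψ gψ tψ h => ?_, fun f' g' t' h' hw => ?_⟩
  · exact hs (WithLp.toLp 2 (ψ, WithLp.toLp 2 (gψ, tψ))) h
  · have := hu (WithLp.toLp 2 (f', WithLp.toLp 2 (g', t'))) h' fun q hq => hw _ _ _ hq
    exact congrArg (fun p : Triple m V u ω₀ => p.fst) this

end Variational

/-! ### From the weak formulation to the equation and the boundary condition -/

section Pairing

variable {d m : ℕ} {V : Set (Vel d)} [NeZero d] {u ω₀ : ℝ}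

/-- The identification of `L²((1 + |v|)² dv)` with the dual of the comparison space. -/
def dualK (m : ℕ) (V : Set (Vel d)) : L2w m V 2 →L[ℝ] L2k m V := mulL m _ _ (wt 2)

/-- The inclusion of `L²((1 + |v|)² dv)` in `L²(a dv)`. -/
def testH (m : ℕ) (V : Set (Vel d)) (ω₀ : ℝ) : L2w m V 2 →L[ℝ] L2w m V ω₀ := mulL m _ _ fun _ => 1

/-- The map `z ↦ (v₁ + u) z` from `L²((1 + |v|)² dv)` to `L²(1/a dv)`. -/
def testS (m : ℕ) (V : Set (Vel d)) (u ω₀ : ℝ) : L2w m V 2 →L[ℝ] L2w m V (-ω₀) :=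
  mulL m _ _ fun v => v 0 + u

/-- The inclusion of `L²((1 + |v|)² dv)` in the trace space. -/
def testT (m : ℕ) (V : Set (Vel d)) (u : ℝ) : L2w m V 2 →L[ℝ] L2flux m V u := mulL m _ _ fun _ => 1

omit [NeZero d] in
theorem dualK_ae (z : L2w m V 2) : dualK m V z =ᵐ[volume.restrict V] fun v => wt 2 v • z v :=
  mulL_two_ae z

omit [NeZero d] in
theorem testH_ae (hω₁ : ω₀ ≤ 1) (z : L2w m V 2) : testH m V ω₀ z =ᵐ[volume.restrict V] z := by
  have := mulL_ae (isDens_velMeasure V 2) (isDens_velMeasure V ω₀) (m := m)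
    (b := fun _ => 1) (by fun_prop) (C := 1)
    (fun v => by simpa using wt_le_wt (by linarith) v) z
  simp only [one_smul] at this
  exact this

theorem testS_ae (hω₀ : 0 ≤ ω₀) (z : L2w m V 2) :
    testS m V u ω₀ z =ᵐ[volume.restrict V] fun v => (v 0 + u) • z v :=
  mulL_ae (isDens_velMeasure V _) (isDens_velMeasure V _) (by fun_prop) (C := (1 + |u|) ^ 2)
    (fun v => by
      have h : wt (-ω₀) v ≤ 1 := by
        rw [← wt_zero v]; exact wt_le_wt (by linarith) v
      exact (mul_le_of_le_one_right (sq_nonneg _) h).trans (coord_sq_le u v)) z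

theorem testT_ae (z : L2w m V 2) : testT m V u z =ᵐ[volume.restrict V] z := by
  have := mulL_ae (isDens_velMeasure V 2) (isDens_fluxMeasure V u) (m := m)
    (b := fun _ => 1) (by fun_prop) (C := 1 + |u|)
    (fun v => by
      rw [one_pow, one_mul, wt_two]
      refine (abs_coord_le u v).trans ?_
      gcongr
      nlinarith [norm_nonneg v]) z
  simp only [one_smul] at this
  exact this

omit [NeZero d] in
theorem inner_dualK (k : L2k m V) (z : L2w m V 2) :
    inner ℝ k (dualK m V z) = ∫ v in V, inner ℝ (k v) (z v) := by
  rw [(isDens_velMeasure V _).inner_eq]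
  refine integral_congr_ae ?_
  filter_upwards [dualK_ae z] with v hv
  rw [hv, real_inner_smul_right, ← mul_assoc, mul_comm (wt (-2) v), wt_two_mul, one_mul]

omit [NeZero d] in
theorem eq_zero_of_inner_dualK {k : L2k m V} (h : ∀ z, inner ℝ k (dualK m V z) = 0) : k = 0 := by
  refine eq_zero_of_inner_test fun ζ hζ hs => ?_
  have hζ2 : MemLp ζ 2 (velMeasure V 2) := hζ.continuous.memLp_of_hasCompactSupport hs
  rw [← h hζ2.toLp, inner_dualK]
  have := hζ2.coeFn_toLp
  rw [(isDens_velMeasure V 2).ae_eq] at this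
  refine integral_congr_ae ?_
  filter_upwards [this] with v hv
  rw [hv]

theorem inner_riesz_testS (hω₀ : 0 ≤ ω₀) (z : L2w m V 2) (h : L2w m V ω₀) :
    inner ℝ (riesz m V ω₀ (testS m V u ω₀ z)) h = inner ℝ (transK m V u ω₀ h) (dualK m V z) := by
  rw [inner_riesz, inner_dualK]
  refine integral_congr_ae ?_
  filter_upwards [testS_ae (u := u) hω₀ z, transK_ae (u := u) hω₀ h] with v h₁ h₂
  rw [h₁, h₂, real_inner_smul_left, real_inner_smul_left, real_inner_comm]

omit [NeZero d] in
theorem inner_riesz_testH (hω₁ : ω₀ ≤ 1) (z : L2w m V 2) (g : L2w m V (-ω₀)) :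
    inner ℝ (riesz m V ω₀ g) (testH m V ω₀ z) = inner ℝ (inclK m V ω₀ g) (dualK m V z) := by
  rw [inner_riesz, inner_dualK]
  refine integral_congr_ae ?_
  filter_upwards [testH_ae hω₁ z, inclK_ae hω₁ g] with v h₁ h₂
  rw [h₁, h₂]

theorem inner_testT (t : L2flux m V u) (z : L2w m V 2) :
    inner ℝ t (testT m V u z) = ∫ v in V, |v 0 + u| * inner ℝ (t v) (z v) := by
  rw [(isDens_fluxMeasure V u).inner_eq]
  refine integral_congr_ae ?_
  filter_upwards [testT_ae z] with v hv
  rw [hv]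

theorem integral_mul_inner {K : Type*} [NormedAddCommGroup K] [InnerProductSpace ℝ K]
    [CompleteSpace K] {W : ℝ → K} (hW : ∀ X, IntegrableOn W (Ioc 0 X)) {θ : ℝ → ℝ}
    (hθ : Continuous θ) (hs : HasCompactSupport θ) (k : K) :
    ∫ x in Ioi (0 : ℝ), θ x * inner ℝ (W x) k = inner ℝ (∫ x in Ioi (0 : ℝ), θ x • W x) k := by
  rw [real_inner_comm, ← integral_inner (integrableOn_Ioi_smul hW hθ hs)]
  simp_rw [real_inner_smul_right, real_inner_comm k]

variable (hV : MeasurableSet V) (hVu : ∀ v, reflect u v ∈ V ↔ v ∈ V)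

section
include hV hVu

theorem inner_reflL_dualK (k : L2k m V) (z : L2w m V 2) :
    inner ℝ (reflL m _ u k) (dualK m V z) = inner ℝ k (dualK m V (reflL m _ u z)) := by
  have h2 := isReflDens_velMeasure hV hVu 2
  rw [inner_dualK, inner_dualK]
  trans ∫ v in V, inner ℝ (k (reflect u v)) (z v)
  · refine integral_congr_ae ?_
    filter_upwards [reflL_ae (isReflDens_velMeasure hV hVu (-2)) k] with v hv
    rw [hv]
  rw [← h2.integral_inner_reflect]
  refine integral_congr_ae ?_
  filter_upwards [reflL_ae h2 z] with v hv
  rw [hv]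

/-- The reflection is symmetric for this pairing, so even and odd components are orthogonal and the
mixed terms drop out. -/
theorem inner_even_add_inner_odd (k : L2k m V) (z : L2w m V 2) :
    inner ℝ (evenL m _ u k) (dualK m V (evenL m _ u z)) +
      inner ℝ (oddL m _ u k) (dualK m V (oddL m _ u z)) = inner ℝ k (dualK m V z) := by
  have e₁ := inner_reflL_dualK hV hVu k z
  have e₂ := inner_reflL_dualK hV hVu k (reflL m _ u z)
  rw [reflL_reflL (isReflDens_velMeasure hV hVu 2)] at e₂
  simp only [evenL_apply, oddL_apply, (dualK m V).map_smul, (dualK m V).map_add,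
    (dualK m V).map_sub, real_inner_smul_left, real_inner_smul_right, inner_add_left,
    inner_add_right, inner_sub_left, inner_sub_right, e₁, e₂]
  ring

theorem transK_oddL (hω₀ : 0 ≤ ω₀) (f : L2w m V ω₀) :
    transK m V u ω₀ (oddL m _ u f) = evenL m _ u (transK m V u ω₀ f) := by
  rw [oddL_apply, evenL_apply, (transK m V u ω₀).map_smul, (transK m V u ω₀).map_sub,
    transK_reflL hV hVu hω₀, sub_neg_eq_add]

theorem transK_evenL (hω₀ : 0 ≤ ω₀) (f : L2w m V ω₀) :
    transK m V u ω₀ (evenL m _ u f) = oddL m _ u (transK m V u ω₀ f) := by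
  rw [oddL_apply, evenL_apply, (transK m V u ω₀).map_smul, (transK m V u ω₀).map_add,
    transK_reflL hV hVu hω₀, sub_eq_add_neg]

theorem testH_reflL (hω₁ : ω₀ ≤ 1) (z : L2w m V 2) :
    testH m V ω₀ (reflL m _ u z) = reflL m _ u (testH m V ω₀ z) := by
  have hK := isReflDens_velMeasure hV hVu ω₀
  refine hK.ext ?_
  filter_upwards [testH_ae hω₁ (reflL m _ u z), reflL_ae hK (testH m V ω₀ z),
    reflL_ae (isReflDens_velMeasure hV hVu 2) z,
    hK.mp.quasiMeasurePreserving.ae (testH_ae hω₁ z)] with v h₁ h₂ h₃ h₄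
  rw [h₁, h₂, h₃, h₄]

theorem testH_evenL (hω₁ : ω₀ ≤ 1) (z : L2w m V 2) :
    testH m V ω₀ (evenL m _ u z) = evenL m _ u (testH m V ω₀ z) := by
  rw [evenL_apply, evenL_apply, (testH m V ω₀).map_smul, (testH m V ω₀).map_add,
    testH_reflL hV hVu hω₁]

theorem testH_oddL (hω₁ : ω₀ ≤ 1) (z : L2w m V 2) :
    testH m V ω₀ (oddL m _ u z) = oddL m _ u (testH m V ω₀ z) := by
  rw [oddL_apply, oddL_apply, (testH m V ω₀).map_smul, (testH m V ω₀).map_sub,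
    testH_reflL hV hVu hω₁]

end

variable {θ : ℝ → ℝ}

theorem evenX_timeTensor (hθ : Continuous θ) (hs : HasCompactSupport θ) (z : L2w m V ω₀) :
    evenX m V u ω₀ (timeTensor θ z) = timeTensor θ (evenL m _ u z) := by
  refine Lp.ext ?_
  filter_upwards [evenX_ae (u := u) ω₀ (timeTensor θ z), timeTensor_ae hθ hs z,
    timeTensor_ae hθ hs (evenL m _ u z)] with x h₁ h₂ h₃
  rw [h₁, h₂, h₃]
  exact (evenL m (velMeasure V ω₀) u).map_smul _ _

theorem oddX_timeTensor (hθ : Continuous θ) (hs : HasCompactSupport θ) (z : L2w m V ω₀) :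
    oddX m V u ω₀ (timeTensor θ z) = timeTensor θ (oddL m _ u z) := by
  refine Lp.ext ?_
  filter_upwards [oddX_ae (u := u) ω₀ (timeTensor θ z), timeTensor_ae hθ hs z,
    timeTensor_ae hθ hs (oddL m _ u z)] with x h₁ h₂ h₃
  rw [h₁, h₂, h₃]
  exact (oddL m (velMeasure V ω₀) u).map_smul _ _

/-- The hypotheses say that y and (v₁+u)τ are both (v₁+u)z, read in the respective spaces. What
remains is the scalar identity ∫ (ϑθ)' = -ϑ(0)θ(0) on the half-line. -/
theorem trans_timeTensor (hθ : ContDiff ℝ (⊤ : ℕ∞) θ) (hs : HasCompactSupport θ) {z : L2w m V ω₀}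
    {y : L2w m V (-ω₀)} {τ : L2flux m V u} (h₁ : inclK m V ω₀ y = transK m V u ω₀ z)
    (h₂ : traceK m V u τ = transK m V u ω₀ z) :
    Trans u (timeTensor θ z) (timeTensor (deriv θ) y) (θ 0 • τ) := by
  intro ϑ hϑ hϑs
  have c₁ := hθ.continuous_deriv (by simp)
  have c₂ := hϑ.continuous_deriv (by simp)
  set k := transK m V u ω₀ z with hk
  have e₁ : ∫ x in Ioi (0 : ℝ), deriv ϑ x • transK m V u ω₀ (timeTensor θ z x) =
      (∫ x in Ioi (0 : ℝ), deriv ϑ x * θ x) • k := by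
    rw [← integral_smul_const]
    refine integral_congr_ae ?_
    filter_upwards [timeTensor_ae hθ.continuous hs z] with x hx
    rw [hx, (transK m V u ω₀).map_smul, smul_smul]
  have e₂ : ∫ x in Ioi (0 : ℝ), ϑ x • inclK m V ω₀ (timeTensor (deriv θ) y x) =
      (∫ x in Ioi (0 : ℝ), ϑ x * deriv θ x) • k := by
    rw [← integral_smul_const]
    refine integral_congr_ae ?_
    filter_upwards [timeTensor_ae c₁ hs.deriv y] with x hx
    rw [hx, (inclK m V ω₀).map_smul, smul_smul, h₁]
  rw [e₁, e₂, ← add_smul, (traceK m V u).map_smul, h₂, smul_smul, ← neg_smul]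
  congr 1
  have i₁ : Integrable (fun x => deriv ϑ x * θ x) :=
    (c₂.mul hθ.continuous).integrable_of_hasCompactSupport hs.mul_left
  have i₂ : Integrable (fun x => ϑ x * deriv θ x) :=
    (hϑ.continuous.mul c₁).integrable_of_hasCompactSupport hs.deriv.mul_left
  rw [← integral_add i₁.integrableOn i₂.integrableOn]
  have := HasCompactSupport.integral_Ioi_deriv_eq (f := fun x => ϑ x * θ x)
    ((hϑ.mul hθ).of_le (by exact_mod_cast le_top)) hs.mul_left 0
  rw [← this]
  refine integral_congr_ae (Eventually.of_forall fun x => ?_)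
  exact (deriv_fun_mul (hϑ.differentiable (by simp) x) (hθ.differentiable (by simp) x)).symm

end Pairing

/-! ### The equation and the incoming boundary values. -/

section WeakSolution

variable {d m : ℕ} {V : Set (Vel d)} [NeZero d] {u ω₀ : ℝ}

omit [NeZero d] in
theorem inner_rieszX_timeTensor_left {θ : ℝ → ℝ} (hθ : Continuous θ) (hs : HasCompactSupport θ)
    (y : L2w m V (-ω₀)) (f : L2xw m V ω₀) : inner ℝ (rieszX m V ω₀ (timeTensor θ y)) f =
      ∫ x in Ioi (0 : ℝ), θ x * inner ℝ (riesz m V ω₀ y) (f x) := by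
  rw [L2.inner_def]
  refine integral_congr_ae ?_
  filter_upwards [rieszX_ae (timeTensor θ y), timeTensor_ae hθ hs y] with x h₁ h₂
  rw [h₁, h₂, (riesz m V ω₀).map_smul, real_inner_smul_left]

omit [NeZero d] in
theorem inner_timeTensor_right {H : Type*} [NormedAddCommGroup H] [InnerProductSpace ℝ H]
    [CompleteSpace H] {θ : ℝ → ℝ} (hθ : Continuous θ) (hs : HasCompactSupport θ)
    (F : Lp H 2 halfLine) (z : H) : inner ℝ F (timeTensor θ z) =
      ∫ x in Ioi (0 : ℝ), θ x * inner ℝ (F x) z := by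
  rw [L2.inner_def]
  refine integral_congr_ae ?_
  filter_upwards [timeTensor_ae hθ hs z] with x hx
  rw [hx, real_inner_smul_right]

variable (hV : MeasurableSet V) (hVu : ∀ v, reflect u v ∈ V ↔ v ∈ V)
include hV hVu

-- The test element is ψ = θ(x)z(v). Its even part has derivative θ'(v₁+u)z⁺, so the first term of
-- the form sees the even part of (v₁+u)f. In the second term, Green's formula for f⁺ moves the
-- derivative onto θ, which yields the odd part of (v₁+u)f and a boundary term. The two parities add
-- up to the full transport term.
set_option maxHeartbeats 1600000 in
theorem IsWeakSol.tensor (hω₀ : 0 ≤ ω₀) (hω₁ : ω₀ ≤ 1) {D : L2w m V ω₀ →L[ℝ] L2w m V (-ω₀)}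
    {φ : L2flux m V u} {f : L2xw m V ω₀} {g : L2xw m V (-ω₀)} {t : L2flux m V u}
    (hf : Trans u (evenX m V u ω₀ f) g t) (h : IsWeakSol D φ f g t) {θ : ℝ → ℝ}
    (hθ : ContDiff ℝ (⊤ : ℕ∞) θ) (hs : HasCompactSupport θ) (z : L2w m V 2) :
    inner ℝ (-(∫ x in Ioi (0 : ℝ), deriv θ x • transK m V u ω₀ (f x)) +
        ∫ x in Ioi (0 : ℝ), θ x • inclK m V ω₀ (D (f x))) (dualK m V z) =
      θ 0 * (inner ℝ (traceK m V u t) (dualK m V (oddL m _ u z))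
        - inner ℝ t (testT m V u (evenL m _ u z)) + 2 * inner ℝ φ (testT m V u (evenL m _ u z))) := by
  have c₁ := hθ.continuous_deriv (by simp)
  have cθ := hθ.continuous
  set zE := evenL m (velMeasure V 2) u z with hzE
  set zO := oddL m (velMeasure V 2) u z with hzO
  set A := fun x => transK m V u ω₀ (f x) with hA
  have hAi : ∀ X, IntegrableOn A (Ioc 0 X) := integrableOn_Ioc_of_memLp (memLp_transK f)
  have hgi := integrableOn_Ioc_of_memLp (memLp_inclK g)
  have hDf : MemLp (fun x => inclK m V ω₀ (D (f x))) 2 halfLine :=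
    ((inclK m V ω₀).comp D).comp_memLp' (Lp.memLp f)
  have hDi := integrableOn_Ioc_of_memLp hDf
  -- the test triple
  have htest : Trans u (evenX m V u ω₀ (timeTensor θ (testH m V ω₀ z)))
      (timeTensor (deriv θ) (testS m V u ω₀ zE)) (θ 0 • testT m V u zE) := by
    rw [evenX_timeTensor cθ hs, ← testH_evenL hV hVu hω₁]
    refine trans_timeTensor hθ hs ((isDens_velMeasure V (-2)).ext ?_)
      ((isDens_velMeasure V (-2)).ext ?_)
    · filter_upwards [inclK_ae hω₁ (testS m V u ω₀ zE), testS_ae (u := u) hω₀ zE,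
        transK_ae (u := u) hω₀ (testH m V ω₀ zE), testH_ae hω₁ zE] with v h₁ h₂ h₃ h₄
      rw [h₁, h₂, h₃, h₄]
    · filter_upwards [traceK_ae (testT m V u zE), testT_ae (u := u) zE,
        transK_ae (u := u) hω₀ (testH m V ω₀ zE), testH_ae hω₁ zE] with v h₁ h₂ h₃ h₄
      rw [h₁, h₂, h₃, h₄]
  have key := h _ _ _ htest
  -- the four terms
  have T1 : inner ℝ (oddX m V u ω₀ f) (rieszX m V ω₀ (timeTensor (deriv θ) (testS m V u ω₀ zE))) =
      ∫ x in Ioi (0 : ℝ), deriv θ x * inner ℝ (evenL m _ u (A x)) (dualK m V zE) := by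
    rw [real_inner_comm, inner_rieszX_timeTensor_left c₁ hs.deriv]
    refine integral_congr_ae ?_
    filter_upwards [oddX_ae (u := u) ω₀ f] with x hx
    rw [hx, inner_riesz_testS hω₀, transK_oddL hV hVu hω₀]
  have T2 : inner ℝ (rieszX m V ω₀ g) (oddX m V u ω₀ (timeTensor θ (testH m V ω₀ z))) =
      inner ℝ (∫ x in Ioi (0 : ℝ), θ x • inclK m V ω₀ (g x)) (dualK m V zO) := by
    rw [oddX_timeTensor cθ hs, ← testH_oddL hV hVu hω₁, inner_timeTensor_right cθ hs,
      ← integral_mul_inner hgi cθ hs]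
    refine integral_congr_ae ?_
    filter_upwards [rieszX_ae g] with x hx
    rw [hx, inner_riesz_testH hω₁]
  have T3 : inner ℝ (opX D f) (timeTensor θ (testH m V ω₀ z)) =
      inner ℝ (∫ x in Ioi (0 : ℝ), θ x • inclK m V ω₀ (D (f x))) (dualK m V z) := by
    rw [inner_timeTensor_right cθ hs, ← integral_mul_inner hDi cθ hs]
    refine integral_congr_ae ?_
    filter_upwards [ContinuousLinearMap.coeFn_compLpL ((riesz m V ω₀).comp D) f] with x hx
    rw [opX, hx, ContinuousLinearMap.comp_apply, inner_riesz_testH hω₁]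
  have hG := congrArg (fun k => inner ℝ k (dualK m V zO)) (hf θ hθ hs)
  simp only [inner_add_left, inner_neg_left, real_inner_smul_left] at hG
  have hO : inner ℝ (∫ x in Ioi (0 : ℝ), deriv θ x • transK m V u ω₀ (evenX m V u ω₀ f x))
      (dualK m V zO) = ∫ x in Ioi (0 : ℝ), deriv θ x * inner ℝ (oddL m _ u (A x)) (dualK m V zO) := by
    rw [← integral_mul_inner (integrableOn_Ioc_of_memLp (memLp_transK _)) c₁ hs.deriv]
    refine integral_congr_ae ?_
    filter_upwards [evenX_ae (u := u) ω₀ f] with x hx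
    rw [hx, transK_evenL hV hVu hω₀]
  have hsum : (∫ x in Ioi (0 : ℝ), deriv θ x * inner ℝ (evenL m _ u (A x)) (dualK m V zE)) +
      (∫ x in Ioi (0 : ℝ), deriv θ x * inner ℝ (oddL m _ u (A x)) (dualK m V zO)) =
      inner ℝ (∫ x in Ioi (0 : ℝ), deriv θ x • A x) (dualK m V z) := by
    have iE : ∀ X, IntegrableOn (fun x => evenL m (velMeasure V (-2)) u (A x)) (Ioc 0 X) := fun X =>
      ContinuousLinearMap.integrable_comp _ (hAi X)
    have iO : ∀ X, IntegrableOn (fun x => oddL m (velMeasure V (-2)) u (A x)) (Ioc 0 X) := fun X =>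
      ContinuousLinearMap.integrable_comp _ (hAi X)
    have j₁ := (integrableOn_Ioi_smul iE c₁ hs.deriv).inner_const (𝕜 := ℝ) (dualK m V zE)
    have j₂ := (integrableOn_Ioi_smul iO c₁ hs.deriv).inner_const (𝕜 := ℝ) (dualK m V zO)
    simp_rw [real_inner_smul_left] at j₁ j₂
    rw [← integral_add j₁ j₂, ← integral_mul_inner hAi c₁ hs.deriv]
    congr 1; ext1 x
    rw [← mul_add, inner_even_add_inner_odd hV hVu]
  rw [T1, T2, T3, real_inner_smul_right, real_inner_smul_right] at key
  rw [hO] at hG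
  rw [inner_add_left, inner_neg_left]
  linarith

/-- Cutoffs that vanish near 0 give the equation for all of f, not only for f⁺, and with it a trace
t' of f. By uniqueness g and t are the odd part of the derivative and the even part of t'. A cutoff
with θ(0) = 1 then equates the boundary terms. -/
theorem IsWeakSol.trans_and_trace (hω₀ : 0 ≤ ω₀) (hω₁ : ω₀ ≤ 1)
    {D : L2w m V ω₀ →L[ℝ] L2w m V (-ω₀)}
    {φ : L2flux m V u} {f : L2xw m V ω₀} {g : L2xw m V (-ω₀)} {t : L2flux m V u}
    (hf : Trans u (evenX m V u ω₀ f) g t) (h : IsWeakSol D φ f g t) :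
    ∃ t', Trans u f (-D.compLpL 2 halfLine f) t' ∧ t = evenL m _ u t' ∧ ∀ z,
      inner ℝ (traceK m V u t') (dualK m V z) =
        inner ℝ (traceK m V u t) (dualK m V (oddL m _ u z))
        - inner ℝ t (testT m V u (evenL m _ u z)) +
          2 * inner ℝ φ (testT m V u (evenL m _ u z)) := by
  have hDae : ∀ᵐ x ∂halfLine, inclK m V ω₀ ((-D.compLpL 2 halfLine f : L2xw m V (-ω₀)) x) =
      -inclK m V ω₀ (D (f x)) := by
    filter_upwards [Lp.coeFn_neg (D.compLpL 2 halfLine f),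
      ContinuousLinearMap.coeFn_compLpL (p := 2) (μ := halfLine) D f] with x h₁ h₂
    rw [h₁, Pi.neg_apply, h₂, (inclK m V ω₀).map_neg]
  have hint : ∀ θ : ℝ → ℝ, ∫ x in Ioi (0 : ℝ),
      θ x • inclK m V ω₀ ((-D.compLpL 2 halfLine f : L2xw m V (-ω₀)) x) =
      -∫ x in Ioi (0 : ℝ), θ x • inclK m V ω₀ (D (f x)) := fun θ => by
    rw [← integral_neg]
    refine integral_congr_ae ?_
    filter_upwards [hDae] with x hx
    rw [hx, smul_neg]
  have hW := integrableOn_Ioc_of_memLp (memLp_transK (u := u) f)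
  have hG := integrableOn_Ioc_of_memLp (memLp_inclK (-D.compLpL 2 halfLine f : L2xw m V (-ω₀)))
  have hweak : IsWeakDeriv (fun x => transK m V u ω₀ (f x))
      fun x => inclK m V ω₀ ((-D.compLpL 2 halfLine f : L2xw m V (-ω₀)) x) := by
    intro θ hθ hs ht
    rw [hint, ← sub_eq_add_neg, ← neg_eq_zero, neg_sub, sub_eq_neg_add]
    refine eq_zero_of_inner_dualK fun z => ?_
    rw [h.tensor hV hVu hω₀ hω₁ hf hθ hs,
      image_eq_zero_of_notMem_tsupport fun h0 => lt_irrefl (0 : ℝ) (ht h0), zero_mul]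
  obtain ⟨c, hc⟩ := hweak.exists_primitive hG hW
  obtain ⟨t', rfl⟩ := exists_traceK_eq hω₀ hω₁ hc
  have ht' : Trans u f (-D.compLpL 2 halfLine f) t' := IsGreen.of_primitive hc hG hW
  have he := ht'.even hV hVu hω₀ hω₁
  obtain rfl := hf.unique_deriv hω₁ he
  refine ⟨t', ht', hf.unique_trace he, fun z => ?_⟩
  obtain ⟨θ, hθ, hs, h0⟩ := exists_smooth_cutoff
  have e := h.tensor hV hVu hω₀ hω₁ hf hθ hs z
  have e' := ht' θ hθ hs
  rw [hint] at e'
  rw [h0, one_mul] at e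
  rw [← e]
  congr 1
  rw [h0, one_smul] at e'
  rw [← neg_inj, ← e', neg_add, neg_neg]

/-- The boundary condition at incoming velocities. -/
theorem trace_eq_of_inner {φ t t' : L2flux m V u} (ht : t = evenL m _ u t')
    (hφ : ∀ᵐ v ∂volume.restrict V, v ∉ incoming d u → φ v = 0)
    (h : ∀ z, inner ℝ (traceK m V u t') (dualK m V z) =
        inner ℝ (traceK m V u t) (dualK m V (oddL m _ u z))
        - inner ℝ t (testT m V u (evenL m _ u z)) +
          2 * inner ℝ φ (testT m V u (evenL m _ u z))) :
    ∀ᵐ v ∂volume.restrict V, v ∈ incoming d u → t' v = φ v := by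
  have h2 := isReflDens_velMeasure hV hVu 2
  have hF := isReflDens_fluxMeasure hV hVu (V := V)
  have hmeas : MeasurableSet (incoming d u) :=
    measurableSet_lt measurable_const (by fun_prop : Measurable fun v : Vel d => v 0 + u)
  set χ : Vel d → ℝ := (incoming d u).indicator 1 with hχ
  have hχm : Measurable χ := measurable_one.indicator hmeas
  have hχ1 : ∀ v, χ v ^ 2 ≤ 1 := fun v => by
    rw [hχ]; by_cases hv : v ∈ incoming d u <;> simp [hv]
  set k := mulL m (velMeasure V (-2)) (velMeasure V (-2)) χ (traceK m V u (t' - φ)) with hk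
  have hkae : k =ᵐ[volume.restrict V] fun v => (χ v * (v 0 + u)) • (t' v - φ v) := by
    filter_upwards [mulL_ae (m := m) (isDens_velMeasure V (-2)) (isDens_velMeasure V (-2)) hχm (C := 1)
      (fun v => mul_le_mul_of_nonneg_right (hχ1 v) (wt_pos _ v).le) (traceK m V u (t' - φ)),
      traceK_ae (t' - φ), hF.sub_ae t' φ] with v h₁ h₂ h₃
    rw [hk, h₁, h₂, h₃, smul_smul]
  have hk0 : k = 0 := by
    refine eq_zero_of_inner_dualK fun ζ => ?_
    set y := mulL m (velMeasure V 2) (velMeasure V 2) χ ζ with hy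
    have hyae : y =ᵐ[volume.restrict V] fun v => χ v • ζ v :=
      mulL_ae (m := m) (isDens_velMeasure V 2) (isDens_velMeasure V 2) hχm (C := 1)
      (fun v => mul_le_mul_of_nonneg_right (hχ1 v) (wt_pos _ v).le) ζ
    -- An even test function that agrees with ζ at incoming velocities. Evenness removes the term
    -- with the odd part of z.
    set z := y + reflL m _ u y with hz
    have hRz : reflL m _ u z = z := by
      rw [hz, map_add, reflL_reflL h2, add_comm]
    have hEz : evenL m _ u z = z := by
      rw [evenL_apply, hRz]; module
    have hOz : oddL m _ u z = 0 := by
      rw [oddL_apply, hRz, sub_self, smul_zero]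
    have e := h z
    rw [hEz, hOz, map_zero, inner_zero_right, zero_sub, inner_dualK, inner_testT, inner_testT] at e
    have hzae : ∀ᵐ v ∂volume.restrict V, z v = χ v • ζ v + χ (reflect u v) • ζ (reflect u v) := by
      filter_upwards [h2.add_ae y (reflL m _ u y), reflL_ae h2 y, hyae,
        h2.mp.quasiMeasurePreserving.ae hyae] with v h₁ h₂ h₃ h₄
      rw [h₁, h₂, h₃, h₄]
    have hzR : ∀ᵐ v ∂volume.restrict V, z (reflect u v) = z v := by
      have := reflL_ae h2 z
      rw [hRz] at this
      filter_upwards [this] with v hv using hv.symm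
    have hint : ∀ s : L2flux m V u, Integrable (fun v => |v 0 + u| * inner ℝ (s v) (z v))
        (volume.restrict V) := fun s => by
      refine (hF.integrable_inner s (testT m V u z)).congr ?_
      filter_upwards [testT_ae (u := u) z] with v hv
      rw [hv]
    -- Both z and |v₁+u| are even, so the even part t may be replaced by the full trace t'.
    have hmid : ∫ v in V, |v 0 + u| * inner ℝ (t v) (z v) =
        ∫ v in V, |v 0 + u| * inner ℝ (t' v) (z v) := by
      have e1 : ∫ v in V, |v 0 + u| * inner ℝ (reflL m _ u t' v) (z v) =
          ∫ v in V, |v 0 + u| * inner ℝ (t' v) (z v) := by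
        rw [← hF.mp.integral_comp (measurableEmbedding_reflect u)
          (fun v => |v 0 + u| * inner ℝ (t' v) (z v))]
        refine integral_congr_ae ?_
        filter_upwards [reflL_ae hF t', hzR] with v h₁ h₂
        rw [h₁, h₂, reflect_coord, abs_neg]
      have e2 : ∫ v in V, |v 0 + u| * inner ℝ (t v) (z v) =
          ∫ v in V, (1 / 2 : ℝ) * (|v 0 + u| * inner ℝ (t' v) (z v) +
            |v 0 + u| * inner ℝ (reflL m _ u t' v) (z v)) := by
        refine integral_congr_ae ?_
        rw [ht, evenL_apply]
        filter_upwards [hF.smul_ae (1 / 2) (t' + reflL m _ u t'), hF.add_ae t' (reflL m _ u t')]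
          with v h₁ h₂
        rw [h₁, h₂, real_inner_smul_left, inner_add_left]
        ring
      rw [e2, integral_const_mul, integral_add (hint _) (hint _), e1]
      ring
    rw [hmid] at e
    have i₁ : Integrable (fun v => inner ℝ (traceK m V u t' v) (z v)) (volume.restrict V) := by
      refine ((isDens_velMeasure V (-2)).integrable_inner (traceK m V u t') (dualK m V z)).congr ?_
      filter_upwards [dualK_ae z] with v hv
      rw [hv, real_inner_smul_right, ← mul_assoc, mul_comm (wt (-2) v), wt_two_mul, one_mul]
    have i₂ : Integrable (fun v => inner ℝ (traceK m V u t' v) (z v) +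
        |v 0 + u| * inner ℝ (t' v) (z v)) (volume.restrict V) := i₁.add (hint t')
    -- The sum (v₁+u) + |v₁+u| is twice v₁+u at incoming velocities and zero elsewhere, where φ
    -- vanishes too. Only the incoming mismatch between t' and φ is left.
    have e3 : ∫ v in V, inner ℝ (k v) (ζ v) = (1 / 2) * ∫ v in V,
        (inner ℝ (traceK m V u t' v) (z v) + |v 0 + u| * inner ℝ (t' v) (z v)
          - 2 * (|v 0 + u| * inner ℝ (φ v) (z v))) := by
      rw [← integral_const_mul]
      refine integral_congr_ae ?_
      filter_upwards [hkae, hzae, traceK_ae t', hφ] with v h₁ h₂ h₃ h₄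
      rw [h₁, h₂, h₃]
      by_cases hv : v ∈ incoming d u
      · have hv' : reflect u v ∉ incoming d u := fun h => by
          have h1 : 0 < reflect u v 0 + u := h
          have h2 : 0 < v 0 + u := hv
          rw [reflect_coord] at h1
          linarith
        have hp : 0 < v 0 + u := hv
        simp only [hχ, indicator_of_mem hv, indicator_of_notMem hv', Pi.one_apply, one_smul,
          zero_smul, add_zero, one_mul, abs_of_pos hp, real_inner_smul_left, inner_sub_left]
        ring
      · have hp : v 0 + u ≤ 0 := not_lt.1 hv
        rw [h₄ hv]
        simp only [hχ, indicator_of_notMem hv, zero_smul, zero_add, zero_mul, inner_zero_left,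
          abs_of_nonpos hp, real_inner_smul_left]
        ring
    rw [inner_dualK, e3, integral_sub i₂ ((hint φ).const_mul 2),
      integral_add i₁ (hint t'), integral_const_mul, e]
    ring
  rw [hk0] at hkae
  filter_upwards [hkae, (isDens_velMeasure V (-2)).zero_ae] with v h₁ h₂ hv
  rw [h₂] at h₁
  have hp : 0 < v 0 + u := hv
  have : (v 0 + u) • (t' v - φ v) = 0 := by
    simpa [hχ, indicator_of_mem hv] using h₁.symm
  exact sub_eq_zero.1 ((smul_eq_zero.1 this).resolve_left hp.ne')

end WeakSolution

/-! ### Exponential weights -/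

section ExpWeight

variable {E F : Type*} [NormedAddCommGroup E] [InnerProductSpace ℝ E]
  [NormedAddCommGroup F] [InnerProductSpace ℝ F] {β : ℝ}

open Classical in
/-- The curve `x ↦ e^{-βx} f(x)`. -/
def expX (β : ℝ) (f : Lp E 2 halfLine) : Lp E 2 halfLine :=
  if h : MemLp (fun x => Real.exp (-β * x) • f x) 2 halfLine then h.toLp else 0

theorem expX_ae (hβ : 0 ≤ β) (f : Lp E 2 halfLine) :
    expX β f =ᵐ[halfLine] fun x => Real.exp (-β * x) • f x := by
  have h : MemLp (fun x => Real.exp (-β * x) • f x) 2 halfLine := by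
    refine (Lp.memLp f).of_le ((by fun_prop : Continuous fun x : ℝ =>
      Real.exp (-β * x)).aestronglyMeasurable.smul (Lp.aestronglyMeasurable f)) ?_
    refine (ae_restrict_iff' measurableSet_Ioi).2 (Eventually.of_forall fun x hx => ?_)
    rw [norm_smul, Real.norm_of_nonneg (Real.exp_pos _).le]
    refine mul_le_of_le_one_left (norm_nonneg _) (Real.exp_le_one_iff.2 ?_)
    have := mul_nonneg hβ (le_of_lt hx)
    linarith
  rw [expX, dif_pos h]
  exact h.coeFn_toLp

theorem compLpL_expX (hβ : 0 ≤ β) (T : E →L[ℝ] F) (f : Lp E 2 halfLine) :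
    T.compLpL 2 halfLine (expX β f) = expX β (T.compLpL 2 halfLine f) := by
  refine Lp.ext ?_
  filter_upwards [ContinuousLinearMap.coeFn_compLpL (p := 2) (μ := halfLine) T (expX β f),
    ContinuousLinearMap.coeFn_compLpL (p := 2) (μ := halfLine) T f, expX_ae hβ f,
    expX_ae hβ (T.compLpL 2 halfLine f)] with x h₁ h₂ h₃ h₄
  rw [h₁, h₃, h₄, h₂, map_smul]

theorem inner_expX_left (hβ : 0 ≤ β) (f g : Lp E 2 halfLine) :
    inner ℝ (expX β f) g = inner ℝ f (expX β g) := by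
  rw [L2.inner_def, L2.inner_def]
  refine integral_congr_ae ?_
  filter_upwards [expX_ae hβ f, expX_ae hβ g] with x h₁ h₂
  rw [h₁, h₂, real_inner_smul_left, real_inner_smul_right]

theorem memLp_expX (hβ : 0 ≤ β) (f : Lp E 2 halfLine) :
    MemLp (expX β f) 2 (halfLine.withDensity fun x => ENNReal.ofReal (Real.exp (2 * β * x))) := by
  have hm : Measurable fun x : ℝ => ENNReal.ofReal (Real.exp (2 * β * x)) := by fun_prop
  refine ⟨(Lp.stronglyMeasurable _).aestronglyMeasurable, ?_⟩
  refine lt_of_eq_of_lt ?_ (Lp.memLp f).2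
  rw [eLpNorm_eq_lintegral_rpow_enorm_toReal (by norm_num) (by norm_num),
    eLpNorm_eq_lintegral_rpow_enorm_toReal (by norm_num) (by norm_num),
    lintegral_withDensity_eq_lintegral_mul₀ hm.aemeasurable
      ((Lp.stronglyMeasurable _).enorm.pow_const _).aemeasurable]
  congr 1
  refine lintegral_congr_ae ?_
  filter_upwards [expX_ae hβ f] with x hx
  rw [Pi.mul_apply, hx, enorm_smul, ENNReal.mul_rpow_of_nonneg _ _ (by norm_num), ← mul_assoc,
    Real.enorm_of_nonneg (Real.exp_pos _).le, ENNReal.ofReal_rpow_of_pos (Real.exp_pos _),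
    ← ENNReal.ofReal_mul (Real.exp_pos _).le, ← Real.exp_mul, ← Real.exp_add]
  simp only [ENNReal.toReal_ofNat]
  rw [show 2 * β * x + -β * x * 2 = 0 by ring, Real.exp_zero, ENNReal.ofReal_one, one_mul]

/-- As the form of σ changes sign when R is moved across it, it pairs even elements only with odd
ones; the two terms on the left are all that survives. In the application σ is multiplication by
v₁+u followed by division by a. -/
theorem inner_even_odd (σ R P O : E →L[ℝ] E) (hP : ∀ a, P a = (1 / 2 : ℝ) • (a + R a))
    (hO : ∀ a, O a = (1 / 2 : ℝ) • (a - R a)) (hσ : ∀ a b, inner ℝ (σ a) b = inner ℝ a (σ b))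
    (hR : ∀ a, R (R a) = a) (hσR : ∀ a b, inner ℝ (σ a) (R b) = -inner ℝ (σ (R a)) b) (a b : E) :
    inner ℝ (O a) (σ (P b)) + inner ℝ (σ (P a)) (O b) = inner ℝ (σ a) b := by
  rw [← hσ]
  simp only [hO, hP, map_smul, map_add, map_sub, real_inner_smul_left, real_inner_smul_right,
    inner_add_left, inner_add_right, inner_sub_left, inner_sub_right, hσR, hR]
  ring

theorem inner_map_sub_smul {E F : Type*} [NormedAddCommGroup E] [NormedSpace ℝ E]
    [NormedAddCommGroup F] [InnerProductSpace ℝ F] (T : E →L[ℝ] F) (c : ℝ) (a b : E) (f : F) :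
    inner ℝ (T (a - c • b)) f = inner ℝ (T a) f - c * inner ℝ (T b) f := by
  rw [map_sub, map_smul, inner_sub_left, real_inner_smul_left]

/-- The factor e is symmetric and is moved from f to ψ. The derivatives of the exponential, once in
f and once in ψ, leave two terms that combine by `hm` to -β times the form of σ; this is the shift
of D. -/
theorem mixedForm_exp {P O σ D : E →L[ℝ] E} {J : F →L[ℝ] E} {S : E →L[ℝ] F} {e : E → E} {e' : F → F}
    (hP : ∀ a, P (e a) = e (P a)) (hO : ∀ a, O (e a) = e (O a)) (hσ : ∀ a, σ (e a) = e (σ a))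
    (hD : ∀ a, D (e a) = e (D a)) (hJ : ∀ b, J (e' b) = e (J b))
    (he : ∀ a b, inner ℝ (e a) b = inner ℝ a (e b)) (hS : ∀ a, J (S a) = σ a)
    (hm : ∀ a b, inner ℝ (O a) (σ (P b)) + inner ℝ (σ (P a)) (O b) = inner ℝ (σ a) b)
    (β : ℝ) (f ψ : E) (g gψ : F) :
    -inner ℝ (O (e f)) (J gψ) + inner ℝ (J (e' g - β • S (P (e f)))) (O ψ) + inner ℝ (D (e f)) ψ =
    -inner ℝ (O f) (J (e' gψ - β • S (P (e ψ)))) + inner ℝ (J g) (O (e ψ))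
      + (inner ℝ (D f) (e ψ) - β * inner ℝ (σ f) (e ψ)) := by
  have h := hm f (e ψ)
  rw [real_inner_comm (J (e' gψ - β • S (P (e ψ)))), inner_map_sub_smul, inner_map_sub_smul, hS, hS,
    hJ, hJ, hO, hO, hP, hσ, hD, he, he (J gψ), he, he, he, ← h, hP, hO,
    show inner ℝ (J gψ) (e (O f)) = inner ℝ (O f) (e (J gψ)) by rw [real_inner_comm, he],
    real_inner_comm (O f) (σ (e (P ψ)))]
  ring

end ExpWeight

/-! ### Exponential decay of the solution. -/

section Damped

variable {d m : ℕ} {V : Set (Vel d)} [NeZero d] {u ω₀ β : ℝ}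

/-- The product rule for e^{-βx}w, obtained by testing the given identity with e^{-βx}θ. The trace
is unchanged because the exponential is 1 at 0. -/
theorem Trans.exp (hβ : 0 ≤ β) {S : L2w m V ω₀ →L[ℝ] L2w m V (-ω₀)}
    (hS : ∀ w, inclK m V ω₀ (S w) = transK m V u ω₀ w) {w : L2xw m V ω₀} {g : L2xw m V (-ω₀)}
    {t : L2flux m V u} (h : Trans u w g t) :
    Trans u (expX β w) (expX β g - β • S.compLpL 2 halfLine (expX β w)) t := by
  intro θ hθ hs
  set e : ℝ → ℝ := fun x => Real.exp (-β * x) with he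
  have hec : ContDiff ℝ (⊤ : ℕ∞) e := by fun_prop
  have hed : ∀ x, HasDerivAt e (-β * e x) x := fun x => by
    have := ((hasDerivAt_id x).const_mul (-β)).exp
    simpa [he, mul_comm] using this
  have hde : ∀ x, deriv (fun x => e x * θ x) x = e x * deriv θ x - β * (e x * θ x) := fun x => by
    rw [((hed x).fun_mul (hθ.differentiable (by simp) x).hasDerivAt).deriv]
    ring
  have key := h (fun x => e x * θ x) (hec.mul hθ) hs.mul_left
  have i₁ := integrableOn_Ioi_smul (integrableOn_Ioc_of_memLp (memLp_transK (u := u) (expX β w)))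
    (hθ.continuous_deriv (by simp)) hs.deriv
  have i₂ := integrableOn_Ioi_smul (integrableOn_Ioc_of_memLp (memLp_inclK
    (expX β g - β • S.compLpL 2 halfLine (expX β w)))) hθ.continuous hs
  have j₁ := integrableOn_Ioi_smul (integrableOn_Ioc_of_memLp (memLp_transK (u := u) w))
    (((hec.mul hθ).continuous_deriv (by simp))) (HasCompactSupport.deriv hs.mul_left)
  have j₂ := integrableOn_Ioi_smul (integrableOn_Ioc_of_memLp (memLp_inclK g))
    (hec.mul hθ).continuous hs.mul_left
  have e0 : e 0 = 1 := by simp [he]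
  rw [e0, one_mul, ← integral_add j₁ j₂] at key
  rw [← key, ← integral_add i₁ i₂]
  refine integral_congr_ae ?_
  filter_upwards [expX_ae hβ w, expX_ae hβ g, Lp.coeFn_sub (expX β g)
    (β • S.compLpL 2 halfLine (expX β w)), Lp.coeFn_smul β (S.compLpL 2 halfLine (expX β w)),
    ContinuousLinearMap.coeFn_compLpL (p := 2) (μ := halfLine) S (expX β w)] with x h₁ h₂ h₃ h₄ h₅
  rw [h₃, Pi.sub_apply, h₄, Pi.smul_apply, h₅, h₁, h₂, (inclK m V ω₀).map_sub,
    (inclK m V ω₀).map_smul, (inclK m V ω₀).map_smul, hS, (transK m V u ω₀).map_smul, hde]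
  module

variable (hV : MeasurableSet V) (hVu : ∀ v, reflect u v ∈ V ↔ v ∈ V)

omit [NeZero d] in
theorem rieszX_compLpL (S : L2w m V ω₀ →L[ℝ] L2w m V (-ω₀)) (f : L2xw m V ω₀) :
    rieszX m V ω₀ (S.compLpL 2 halfLine f) = opX S f := by
  refine Lp.ext ?_
  filter_upwards [rieszX_ae (S.compLpL 2 halfLine f),
    ContinuousLinearMap.coeFn_compLpL (p := 2) (μ := halfLine) S f,
    ContinuousLinearMap.coeFn_compLpL (p := 2) (μ := halfLine) ((riesz m V ω₀).comp S) f]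
    with x h₁ h₂ h₃
  exact h₁.trans ((congrArg _ h₂).trans h₃.symm)

theorem inner_opX_comm {S : L2w m V ω₀ →L[ℝ] L2w m V (-ω₀)}
    (hS : ∀ w, S w =ᵐ[volume.restrict V] fun v => (v 0 + u) • w v) (a b : L2xw m V ω₀) :
    inner ℝ (opX S a) b = inner ℝ a (opX S b) := by
  rw [real_inner_comm (opX S b) a, inner_opX, inner_opX]
  congr 1; ext1 x
  refine integral_congr_ae ?_
  filter_upwards [hS (a x), hS (b x)] with v h₁ h₂
  rw [h₁, h₂, real_inner_smul_left, real_inner_smul_left, real_inner_comm]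

include hV hVu in
theorem inner_opX_reflX {S : L2w m V ω₀ →L[ℝ] L2w m V (-ω₀)}
    (hS : ∀ w, S w =ᵐ[volume.restrict V] fun v => (v 0 + u) • w v) (a b : L2xw m V ω₀) :
    inner ℝ (opX S a) (reflX m V u ω₀ b) = -inner ℝ (opX S (reflX m V u ω₀ a)) b := by
  have hR := isReflDens_velMeasure hV hVu ω₀
  rw [inner_opX, inner_opX, ← integral_neg]
  refine integral_congr_ae ?_
  filter_upwards [reflX_ae (u := u) a, reflX_ae (u := u) b] with x h₁ h₂
  rw [h₁, h₂, ← integral_neg]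
  trans ∫ v in V, inner ℝ ((v 0 + u) • a x v) (b x (reflect u v))
  · refine integral_congr_ae ?_
    filter_upwards [hS (a x), reflL_ae hR (b x)] with v h₁ h₂
    rw [h₁, h₂]
  rw [hR.integral_inner_reflect (b x) fun v => (v 0 + u) • a x v]
  refine integral_congr_ae ?_
  filter_upwards [hS (reflL m _ u (a x)), reflL_ae hR (a x)] with v h₁ h₂
  rw [h₁, h₂, reflect_coord, neg_smul, inner_neg_left]

include hV hVu in
theorem inner_opX_even_odd {S : L2w m V ω₀ →L[ℝ] L2w m V (-ω₀)}
    (hS : ∀ w, S w =ᵐ[volume.restrict V] fun v => (v 0 + u) • w v) (a b : L2xw m V ω₀) :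
    inner ℝ (oddX m V u ω₀ a) (opX S (evenX m V u ω₀ b)) +
      inner ℝ (opX S (evenX m V u ω₀ a)) (oddX m V u ω₀ b) = inner ℝ (opX S a) b := by
  exact inner_even_odd (opX S) (reflX m V u ω₀) (evenX m V u ω₀) (oddX m V u ω₀) evenX_apply
    oddX_apply (inner_opX_comm hS) (reflX_reflX hV hVu) (inner_opX_reflX hV hVu hS) a b

omit [NeZero d] in
theorem opX_sub_smul (D S : L2w m V ω₀ →L[ℝ] L2w m V (-ω₀)) (β : ℝ) (f g : L2xw m V ω₀) :
    inner ℝ (opX (D - β • S) f) g = inner ℝ (opX D f) g - β * inner ℝ (opX S f) g := by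
  rw [L2.inner_def, L2.inner_def, L2.inner_def, ← integral_const_mul, ← integral_sub
    (L2.integrable_inner _ _) ((L2.integrable_inner _ _).const_mul β)]
  refine integral_congr_ae ?_
  filter_upwards [ContinuousLinearMap.coeFn_compLpL ((riesz m V ω₀).comp D) f,
    ContinuousLinearMap.coeFn_compLpL ((riesz m V ω₀).comp S) f,
    ContinuousLinearMap.coeFn_compLpL ((riesz m V ω₀).comp (D - β • S)) f] with x h₁ h₂ h₃
  refine (congrArg (fun k => inner ℝ k (g x)) h₃).trans
    ((inner_map_sub_smul (riesz m V ω₀) β (D (f x)) (S (f x)) (g x)).trans ?_)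
  exact (congrArg₂ (fun k l => inner ℝ k (g x) - β * inner ℝ l (g x)) h₁ h₂).symm

-- Testing the shifted problem for f with e^{-βx}ψ is the same as testing the original problem for
-- e^{-βx}f with ψ, and e^{-βx}ψ is again admissible with the same trace.
include hV hVu in
theorem IsWeakSol.exp (hβ : 0 ≤ β) {D S : L2w m V ω₀ →L[ℝ] L2w m V (-ω₀)}
    (hω₀ : 0 ≤ ω₀) (hω₁ : ω₀ ≤ 1)
    (hS : ∀ w, S w =ᵐ[volume.restrict V] fun v => (v 0 + u) • w v)
    {φ t : L2flux m V u} {f : L2xw m V ω₀} {g : L2xw m V (-ω₀)}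
    (hf : Trans u (evenX m V u ω₀ f) g t) (h : IsWeakSol (D - β • S) φ f g t) :
    ∃ g', Trans u (evenX m V u ω₀ (expX β f)) g' t ∧ IsWeakSol D φ (expX β f) g' t := by
  have hSK : ∀ w, inclK m V ω₀ (S w) = transK m V u ω₀ w := fun w => by
    refine (isDens_velMeasure V (-2)).ext ?_
    filter_upwards [inclK_ae hω₁ (S w), hS w, transK_ae (u := u) hω₀ w] with v h₁ h₂ h₃
    rw [h₁, h₂, h₃]
  have hev : ∀ f : L2xw m V ω₀, evenX m V u ω₀ (expX β f) = expX β (evenX m V u ω₀ f) :=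
    compLpL_expX hβ _
  have hod : ∀ f : L2xw m V ω₀, oddX m V u ω₀ (expX β f) = expX β (oddX m V u ω₀ f) :=
    compLpL_expX hβ _
  have hop : ∀ T : L2w m V ω₀ →L[ℝ] L2w m V (-ω₀), ∀ f : L2xw m V ω₀,
      opX T (expX β f) = expX β (opX T f) := fun T => compLpL_expX hβ _
  have hri : ∀ g : L2xw m V (-ω₀), rieszX m V ω₀ (expX β g) = expX β (rieszX m V ω₀ g) :=
    compLpL_expX hβ _
  have ht := hf.exp hβ hSK
  rw [← hev] at ht
  refine ⟨_, ht, fun ψ gψ tψ hψ => ?_⟩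
  have hψ' := hψ.exp hβ hSK
  rw [← hev] at hψ'
  have key := h _ _ _ hψ'
  rw [opX_sub_smul] at key
  rw [← key]
  exact congrArg (· + inner ℝ t tψ) (mixedForm_exp hev hod (hop S) (hop D) hri (inner_expX_left hβ)
    (rieszX_compLpL S) (inner_opX_even_odd hV hVu hS) β f ψ g gψ)

/-- Multiplication by `v₁ + u` from `L²((1 + |v|) dv)` to `L²((1 + |v|)⁻¹ dv)`. -/
theorem exists_shiftL (m : ℕ) (V : Set (Vel d)) (u : ℝ) : ∃ S : L2w m V 1 →L[ℝ] L2w m V (-1),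
    (∀ w, S w =ᵐ[volume.restrict V] fun v => (v 0 + u) • w v) ∧
      ∀ w, ∫ v in V, inner ℝ (S w v) (w v) ≤ (1 + |u|) * ‖w‖ ^ 2 := by
  have hS := mulL_ae (m := m) (isDens_velMeasure V 1) (isDens_velMeasure V (-1))
    (b := fun v => v 0 + u) (by fun_prop) (C := (1 + |u|) ^ 2) fun v => by
      have h1 := coord_sq_le u v
      have h2 : wt 2 v * wt (-1) v = wt 1 v := by rw [← wt_add]; norm_num
      have := mul_le_mul_of_nonneg_right h1 (wt_pos (-1) v).le
      rwa [mul_assoc, h2] at this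
  refine ⟨_, hS, fun w => ?_⟩
  rw [(isDens_velMeasure V 1).norm_sq_eq, ← integral_const_mul]
  have hi := (isDens_velMeasure V 1).integrable_inner w w
  simp_rw [real_inner_self_eq_norm_sq] at hi
  refine integral_mono_ae (integrable_inner_dual _ _) (hi.const_mul _) ?_
  filter_upwards [hS w] with v hv
  rw [hv, real_inner_smul_left, real_inner_self_eq_norm_sq, ← mul_assoc, wt_one]
  exact mul_le_mul_of_nonneg_right ((le_abs_self _).trans (abs_coord_le u v)) (sq_nonneg _)

-- For a = 1+|v| the operator D - β(v₁+u) is bounded and coercive between the same spaces, so it can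
-- be solved for; multiplying that solution by e^{-βx} produces a solution of the original problem
-- with a finite exponential moment.
include hV hVu in
theorem exists_exp_isWeakSol {D : L2w m V 1 →L[ℝ] L2w m V (-1)} {c : ℝ} (hc : 0 < c)
    (hD : ∀ f, c * ‖f‖ ^ 2 ≤ ∫ v in V, inner ℝ (D f v) (f v)) (φ : L2flux m V u) :
    ∃ β, 0 < β ∧ ∃ f g t, Trans u (evenX m V u 1 f) g t ∧ IsWeakSol D φ f g t ∧
      MemLp f 2 (halfLine.withDensity fun x => ENNReal.ofReal (Real.exp (2 * β * x))) := by
  obtain ⟨S, hS, hS'⟩ := exists_shiftL m V u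
  have hu : 0 < 1 + |u| := by positivity
  -- Since |v₁+u| ≤ (1+|u|)(1+|v|), this rate costs exactly half of the coercivity constant.
  set β : ℝ := c / (2 * (1 + |u|)) with hβ
  have hβ0 : 0 < β := by positivity
  have hβu : β * (1 + |u|) = c / 2 := by rw [hβ]; field_simp
  have hD' : ∀ f, c / 2 * ‖f‖ ^ 2 ≤ ∫ v in V, inner ℝ ((D - β • S) f v) (f v) := fun f => by
    have e : ∫ v in V, inner ℝ ((D - β • S) f v) (f v) =
        (∫ v in V, inner ℝ (D f v) (f v)) - β * ∫ v in V, inner ℝ (S f v) (f v) := by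
      rw [← integral_const_mul, ← integral_sub (integrable_inner_dual _ _)
        ((integrable_inner_dual _ _).const_mul β)]
      refine integral_congr_ae ?_
      have hE := isDens_velMeasure V (-1)
      filter_upwards [hE.sub_ae (D f) (β • S f), hE.smul_ae β (S f)] with v h₁ h₂
      rw [show (D - β • S) f = D f - β • S f from rfl, h₁, h₂, inner_sub_left, real_inner_smul_left]
    have h1 := mul_le_mul_of_nonneg_left (hS' f) hβ0.le
    rw [← mul_assoc, hβu] at h1
    rw [e]
    linarith [hD f]
  obtain ⟨f, g, t, hf, hw, -⟩ := existsUnique_isWeakSol hV hVu zero_le_one le_rfl (half_pos hc) hD' φ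
  obtain ⟨g', h₁, h₂⟩ := hw.exp hV hVu hβ0.le zero_le_one le_rfl hS hf
  exact ⟨β, hβ0, expX β f, g', t, h₁, h₂, memLp_expX hβ0.le f⟩

end Damped

/-! ### The space `Γ`, its derivative and its trace -/

section Gamma

variable {d m : ℕ} {V : Set (Vel d)} [NeZero d] {u ω₀ : ℝ}
  (hV : MeasurableSet V) (hVu : ∀ v, reflect u v ∈ V ↔ v ∈ V)
include hV hVu

theorem evenPart_ae {q : ℝ} (f : L2xw m V q) :
    ∀ᵐ x ∂halfLine, evenPart u (f x) =ᵐ[volume.restrict V] evenX m V u q f x := by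
  filter_upwards [evenX_ae (u := u) q f] with x hx
  rw [hx]
  exact (evenL_ae (isReflDens_velMeasure hV hVu q) (f x)).symm

theorem oddPart_ae {q : ℝ} (f : L2xw m V q) :
    ∀ᵐ x ∂halfLine, oddPart u (f x) =ᵐ[volume.restrict V] oddX m V u q f x := by
  filter_upwards [oddX_ae (u := u) q f] with x hx
  rw [hx]
  exact (oddL_ae (isReflDens_velMeasure hV hVu q) (f x)).symm

theorem HasTransportDeriv.exists_trans_even (hω₀ : 0 ≤ ω₀) (hω₁ : ω₀ ≤ 1) {f : L2xw m V ω₀}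
    {g : L2xw m V (-ω₀)} (h : HasTransportDeriv V u (fun x => evenPart u (f x)) fun x => g x) :
    ∃ t, Trans u (evenX m V u ω₀ f) g t :=
  h.exists_trans hω₀ hω₁ (evenPart_ae hV hVu f) (Eventually.of_forall fun _ => ae_eq_refl _)

theorem Trans.isTrace_even (hω₀ : 0 ≤ ω₀) (hω₁ : ω₀ ≤ 1) {f : L2xw m V ω₀} {g : L2xw m V (-ω₀)}
    {t : L2flux m V u} (h : Trans u (evenX m V u ω₀ f) g t) :
    IsTrace V u (fun x => evenPart u (f x)) (fun x => g x) t :=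
  isTrace_of_trans hω₀ hω₁ h (evenPart_ae hV hVu f) (Eventually.of_forall fun _ => ae_eq_refl _)

theorem Trans.mem_gam (hω₀ : 0 ≤ ω₀) (hω₁ : ω₀ ≤ 1) {f : L2xw m V ω₀} {g : L2xw m V (-ω₀)}
    {t : L2flux m V u} (h : Trans u (evenX m V u ω₀ f) g t) : f ∈ Gam (V := V) (m := m) u :=
  ⟨g, (h.isTrace_even hV hVu hω₀ hω₁).hasTransportDeriv⟩

theorem exists_trans_dEven (hω₀ : 0 ≤ ω₀) (hω₁ : ω₀ ≤ 1) {f : L2xw m V ω₀} (hf : f ∈ Gam u) :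
    ∃ t, Trans u (evenX m V u ω₀ f) (dEven u f) t := by
  have hf' : ∃ g : L2xw m V (-ω₀),
    HasTransportDeriv V u (fun x => evenPart u (f x)) fun x => g x := hf
  rw [dEven, dif_pos hf']
  exact hf'.choose_spec.exists_trans_even hV hVu hω₀ hω₁

theorem existsUnique_isEvenTrace (hω₀ : 0 ≤ ω₀) (hω₁ : ω₀ ≤ 1) {f : L2xw m V ω₀} (hf : f ∈ Gam u) :
    ∃! t : L2flux m V u, IsEvenTrace u f t := by
  obtain ⟨t, ht⟩ := exists_trans_dEven hV hVu hω₀ hω₁ hf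
  exact ⟨t, ht.isTrace_even hV hVu hω₀ hω₁, fun t' h' => ht.unique_of_isTrace hω₀ hω₁
    (evenPart_ae hV hVu f) (Eventually.of_forall fun _ => ae_eq_refl _) h'⟩

theorem existsUnique_transportDeriv (hω₀ : 0 ≤ ω₀) (hω₁ : ω₀ ≤ 1) {f : L2xw m V ω₀}
    (hf : f ∈ Gam u) : ∃! g : L2xw m V (-ω₀),
      HasTransportDeriv V u (fun x => evenPart u (f x)) fun x => g x := by
  obtain ⟨g, hg⟩ := hf
  obtain ⟨t, ht⟩ := hg.exists_trans_even hV hVu hω₀ hω₁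
  refine ⟨g, hg, fun g' hg' => ?_⟩
  obtain ⟨t', ht'⟩ := HasTransportDeriv.exists_trans_even hV hVu hω₀ hω₁ hg'
  exact ht'.unique_deriv hω₁ ht

/-- The derivative and trace in the statement are arbitrary choices; uniqueness of the trace
identifies them with the components of a triple. -/
theorem trans_dEven_traceEven (hω₀ : 0 ≤ ω₀) (hω₁ : ω₀ ≤ 1) {f : L2xw m V ω₀} (hf : f ∈ Gam u) :
    Trans u (evenX m V u ω₀ f) (dEven u f) (traceEven u f) := by
  obtain ⟨t, ht⟩ := exists_trans_dEven hV hVu hω₀ hω₁ hf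
  have hex := (existsUnique_isEvenTrace hV hVu hω₀ hω₁ hf).exists
  have : traceEven u f = t := by
    rw [traceEven, dif_pos hex]
    exact ht.unique_of_isTrace hω₀ hω₁ (evenPart_ae hV hVu f)
      (Eventually.of_forall fun _ => ae_eq_refl _) hex.choose_spec
  rwa [this]

theorem Trans.dEven_eq (hω₀ : 0 ≤ ω₀) (hω₁ : ω₀ ≤ 1) {f : L2xw m V ω₀} {g : L2xw m V (-ω₀)}
    {t : L2flux m V u} (h : Trans u (evenX m V u ω₀ f) g t) : dEven u f = g :=
  (trans_dEven_traceEven hV hVu hω₀ hω₁ (h.mem_gam hV hVu hω₀ hω₁)).unique_deriv hω₁ h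

theorem Trans.traceEven_eq (hω₀ : 0 ≤ ω₀) (hω₁ : ω₀ ≤ 1) {f : L2xw m V ω₀} {g : L2xw m V (-ω₀)}
    {t : L2flux m V u} (h : Trans u (evenX m V u ω₀ f) g t) : traceEven u f = t := by
  have h' := trans_dEven_traceEven hV hVu hω₀ hω₁ (h.mem_gam hV hVu hω₀ hω₁)
  rw [h.dEven_eq hV hVu hω₀ hω₁] at h'
  exact h'.unique_trace h

end Gamma

/-! ### Equivalence with the variational problem, and well-posedness. -/

section Solve

variable {d m : ℕ} {V : Set (Vel d)} [NeZero d] {u ω₀ : ℝ}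
  {L : L2v m V →ₗ.[ℝ] L2v m V} {La : L2w m V ω₀ →L[ℝ] L2w m V (-ω₀)} {ν : ℕ} {X : Fin ν → L2v m V}
  {γ : Fin ν → ℝ} {α : ℝ}

/-- The class of the incoming data, extended by zero. -/
theorem exists_incoming_data {φ : Vel d → Val m}
    (hφ : MemLp φ 2 ((fluxMeasure V u).restrict (incoming d u))) :
    ∃ φ' : L2flux m V u, φ' =ᵐ[volume.restrict V] (incoming d u).indicator φ := by
  have hmeas : MeasurableSet (incoming d u) :=
    measurableSet_lt measurable_const (by fun_prop : Measurable fun v : Vel d => v 0 + u)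
  have h := (memLp_indicator_iff_restrict hmeas).2 hφ
  refine ⟨h.toLp, ?_⟩
  rw [← (isDens_fluxMeasure V u).ae_eq]
  exact h.coeFn_toLp

theorem load_eq {φ : Vel d → Val m} {φ' : L2flux m V u}
    (h : φ' =ᵐ[volume.restrict V] (incoming d u).indicator φ) (ψ : L2xw m V ω₀) :
    load u φ ψ = 2 * inner ℝ φ' (traceEven u ψ) := by
  have hmeas : MeasurableSet (incoming d u) :=
    measurableSet_lt measurable_const (by fun_prop : Measurable fun v : Vel d => v 0 + u)
  rw [load, (isDens_fluxMeasure V u).inner_eq, ← Measure.restrict_restrict hmeas,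
    ← integral_indicator hmeas]
  congr 1
  refine integral_congr_ae ?_
  filter_upwards [h] with v hv
  rw [hv]
  by_cases hi : v ∈ incoming d u
  · have hp : 0 < v 0 + u := hi
    rw [indicator_of_mem hi, indicator_of_mem hi, abs_of_pos hp]
  · rw [indicator_of_notMem hi, indicator_of_notMem hi, inner_zero_left, mul_zero]

variable (hV : MeasurableSet V) (hVu : ∀ v, reflect u v ∈ V ↔ v ∈ V)
include hV hVu

theorem bilin_eq {D : L2w m V ω₀ →L[ℝ] L2w m V (-ω₀)}
    (hD : ∀ f, damped u L La X γ α f =ᵐ[volume.restrict V] D f) (f ψ : L2xw m V ω₀) :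
    bilin u L La X γ α f ψ = -inner ℝ (oddX m V u ω₀ f) (rieszX m V ω₀ (dEven u ψ))
      + inner ℝ (rieszX m V ω₀ (dEven u f)) (oddX m V u ω₀ ψ) + inner ℝ (opX D f) ψ
      + inner ℝ (traceEven u f) (traceEven u ψ) := by
  have e₁ : ∫ x in Ioi (0 : ℝ), ∫ v in V, inner ℝ (oddPart u (f x) v) (dEven u ψ x v) =
      inner ℝ (oddX m V u ω₀ f) (rieszX m V ω₀ (dEven u ψ)) := by
    rw [real_inner_comm, inner_rieszX]
    refine integral_congr_ae ?_
    filter_upwards [oddPart_ae hV hVu f] with x hx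
    refine integral_congr_ae ?_
    filter_upwards [hx] with v hv
    rw [hv, real_inner_comm]
  have e₂ : ∫ x in Ioi (0 : ℝ), ∫ v in V, inner ℝ (dEven u f x v) (oddPart u (ψ x) v) =
      inner ℝ (rieszX m V ω₀ (dEven u f)) (oddX m V u ω₀ ψ) := by
    rw [inner_rieszX]
    refine integral_congr_ae ?_
    filter_upwards [oddPart_ae hV hVu ψ] with x hx
    refine integral_congr_ae ?_
    filter_upwards [hx] with v hv
    rw [hv]
  have e₃ : ∫ x in Ioi (0 : ℝ), ∫ v in V, inner ℝ (ψ x v) (damped u L La X γ α (f x) v) =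
      inner ℝ (opX D f) ψ := by
    rw [inner_opX]
    congr 1; ext1 x
    refine integral_congr_ae ?_
    filter_upwards [hD (f x)] with v hv
    rw [hv, real_inner_comm]
  have e₄ : ∫ v in V, |v 0 + u| * inner ℝ (traceEven u f v) (traceEven u ψ v) =
      inner ℝ (traceEven u f) (traceEven u ψ) := ((isDens_fluxMeasure V u).inner_eq _ _).symm
  exact congrArg₂ (· + ·) (congrArg₂ (· + ·) (congrArg₂ (· + ·) (congrArg Neg.neg e₁) e₂) e₃) e₄

theorem isVarSolution_iff {D : L2w m V ω₀ →L[ℝ] L2w m V (-ω₀)} (hω₀ : 0 ≤ ω₀) (hω₁ : ω₀ ≤ 1)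
    (hD : ∀ f, damped u L La X γ α f =ᵐ[volume.restrict V] D f) {φ : Vel d → Val m}
    {φ' : L2flux m V u} (hφ : φ' =ᵐ[volume.restrict V] (incoming d u).indicator φ)
    (f : L2xw m V ω₀) : IsVarSolution u L La X γ α φ f ↔
      ∃ g t, Trans u (evenX m V u ω₀ f) g t ∧ IsWeakSol D φ' f g t := by
  constructor
  · rintro ⟨hf, h⟩
    refine ⟨_, _, trans_dEven_traceEven hV hVu hω₀ hω₁ hf, fun ψ gψ tψ hψ => ?_⟩
    have := h ψ (hψ.mem_gam hV hVu hω₀ hω₁)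
    obtain rfl := hψ.dEven_eq hV hVu hω₀ hω₁
    obtain rfl := hψ.traceEven_eq hV hVu hω₀ hω₁
    exact (bilin_eq hV hVu hD f ψ).symm.trans (this.trans (load_eq hφ ψ))
  · rintro ⟨g, t, hf, h⟩
    refine ⟨hf.mem_gam hV hVu hω₀ hω₁, fun ψ hψ => ?_⟩
    obtain rfl := hf.dEven_eq hV hVu hω₀ hω₁
    obtain rfl := hf.traceEven_eq hV hVu hω₀ hω₁
    exact (bilin_eq hV hVu hD f ψ).trans ((h _ _ _
      (trans_dEven_traceEven hV hVu hω₀ hω₁ hψ)).trans (load_eq hφ ψ).symm)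

theorem wellPosed_of_coercive {D : L2w m V ω₀ →L[ℝ] L2w m V (-ω₀)} (hω₀ : 0 ≤ ω₀) (hω₁ : ω₀ ≤ 1)
    (hD : ∀ f, damped u L La X γ α f =ᵐ[volume.restrict V] D f) {c : ℝ} (hc : 0 < c)
    (hDc : ∀ f, c * ‖f‖ ^ 2 ≤ ∫ v in V, inner ℝ (D f v) (f v)) {φ : Vel d → Val m}
    (hφ : MemLp φ 2 ((fluxMeasure V u).restrict (incoming d u))) :
    ∃ f : L2xw m V ω₀, IsVarSolution u L La X γ α φ f ∧
        (∀ f' : L2xw m V ω₀, IsVarSolution u L La X γ α φ f' → f' = f) ∧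
        (∃ g : L2xw m V (-ω₀),
          HasTransportDeriv V u (fun x => f x) (fun x => g x) ∧
          ∃ t : L2flux m V u,
            IsTrace V u (fun x => f x) (fun x => g x) t ∧
            ∀ᵐ v ∂(volume.restrict V), v ∈ incoming d u → t v = φ v) ∧
        SolvesDamped u L La X γ α f ∧
        (ω₀ = 1 → ∃ β : ℝ, 0 < β ∧
          MemLp f 2 ((volume.restrict (Ioi (0 : ℝ))).withDensity
            fun x => ENNReal.ofReal (Real.exp (2 * β * x)))) := by
  obtain ⟨φ', hφ'⟩ := exists_incoming_data hφ
  have hiff := isVarSolution_iff hV hVu hω₀ hω₁ hD hφ' (L := L)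
  obtain ⟨f, g, t, hf, hw, hu⟩ := existsUnique_isWeakSol hV hVu hω₀ hω₁ hc hDc φ'
  obtain ⟨t', h₁, h₂, h₃⟩ := hw.trans_and_trace hV hVu hω₀ hω₁ hf
  have htr := isTrace_of_trans hω₀ hω₁ h₁ (w' := fun x => f x)
    (g' := fun x => (-D.compLpL 2 halfLine f : L2xw m V (-ω₀)) x)
    (Eventually.of_forall fun _ => ae_eq_refl _) (Eventually.of_forall fun _ => ae_eq_refl _)
  refine ⟨f, (hiff f).2 ⟨g, t, hf, hw⟩, fun f' hf' => ?_,
    ⟨-D.compLpL 2 halfLine f, htr.hasTransportDeriv, t', htr, ?_⟩, fun η hη hs ht => ?_, ?_⟩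
  · obtain ⟨g', s, h, h'⟩ := (hiff f').1 hf'
    exact hu f' g' s h h'
  · have hφ0 : ∀ᵐ v ∂volume.restrict V, v ∉ incoming d u → φ' v = 0 := by
      filter_upwards [hφ'] with v hv hn
      rw [hv, indicator_of_notMem hn]
    filter_upwards [trace_eq_of_inner hV hVu h₂ hφ0 h₃, hφ'] with v hv hv' hi
    rw [hv hi, hv', indicator_of_mem hi]
  · rw [htr.hasTransportDeriv η hη hs ht, neg_neg, ← sub_neg_eq_add, sub_eq_zero, ← integral_neg]
    refine integral_congr_ae ?_
    filter_upwards [Lp.coeFn_neg (D.compLpL 2 halfLine f),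
      ContinuousLinearMap.coeFn_compLpL (p := 2) (μ := halfLine) D f] with x e₁ e₂
    rw [← integral_neg]
    refine integral_congr_ae ?_
    have e₃ : (-D.compLpL 2 halfLine f : L2xw m V (-ω₀)) x = -D (f x) := by
      rw [e₁, Pi.neg_apply, e₂]
    rw [e₃]
    filter_upwards [hD (f x), (isDens_velMeasure V (-ω₀)).neg_ae (D (f x))] with v e₄ e₅
    rw [e₄, e₅, inner_neg_left]
  · rintro rfl
    -- The decaying function solves the same weak problem, so it is f by uniqueness.
    obtain ⟨β, hβ, f', g', s, h, h', hm⟩ := exists_exp_isWeakSol hV hVu hc hDc φ'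
    rw [hu f' g' s h h'] at hm
    exact ⟨β, hβ, hm⟩

end Solve

/-! ### Self-adjoint operators with a spectral gap -/

section Gap

variable {E : Type*} [NormedAddCommGroup E] [InnerProductSpace ℝ E] [CompleteSpace E]
  {A : E →ₗ.[ℝ] E}

theorem IsSelfAdjoint.inner_map_left (hA : IsSelfAdjoint A) (x y : A.domain) :
    inner ℝ (A x) (y : E) = inner ℝ (x : E) (A y) := by
  have h : A.adjoint.IsFormalAdjoint A := LinearPMap.adjoint_isFormalAdjoint hA.dense_domain
  rw [LinearPMap.isSelfAdjoint_def.1 hA] at h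
  exact h x y

/-- A vector orthogonal to the range lies in the domain of the adjoint, with adjoint value 0, and
the adjoint is A itself. -/
theorem IsSelfAdjoint.exists_map_eq_zero (hA : IsSelfAdjoint A) {z : E}
    (hz : ∀ x : A.domain, inner ℝ z (A x) = 0) : ∃ y : A.domain, (y : E) = z ∧ A y = 0 := by
  have hd := hA.dense_domain
  have hz' : ∀ x : A.domain, inner ℝ (0 : E) (x : E) = inner ℝ z (A x) := fun x => by
    rw [hz, inner_zero_left]
  have hm : z ∈ A.adjoint.domain := LinearPMap.mem_adjoint_domain_of_exists (T := A) z ⟨0, hz'⟩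
  have he := LinearPMap.adjoint_apply_eq hd (T := A) ⟨z, hm⟩ hz'
  have hs := LinearPMap.isSelfAdjoint_def.1 hA
  have : ∀ B : E →ₗ.[ℝ] E, B = A → ∀ w : B.domain, B w = 0 → ∃ y : A.domain, (y : E) = w ∧ A y = 0 := by
    rintro B rfl w hw
    exact ⟨w, rfl, hw⟩
  exact this _ hs ⟨z, hm⟩ he

/-- A self-adjoint operator with a spectral gap is onto the orthogonal complement of its null
space. -/
theorem IsSelfAdjoint.exists_map_eq (hA : IsSelfAdjoint A) (N : Submodule ℝ E)
    [N.HasOrthogonalProjection] (hN : ∀ x : E, x ∈ N ↔ ∃ y : A.domain, (y : E) = x ∧ A y = 0) {s : ℝ}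
    (hs : 0 < s) (hgap : ∀ y : A.domain, (y : E) ∈ Nᗮ → s * ‖(y : E)‖ ^ 2 ≤ inner ℝ (y : E) (A y))
    {g : E} (hg : g ∈ Nᗮ) : ∃ y : A.domain, (y : E) ∈ Nᗮ ∧ A y = g := by
  -- The graph over Nᗮ is closed, and by the gap its second projection is bounded below. So the
  -- image R of Nᗮ under A is closed.
  set G : Submodule ℝ (E × E) := A.graph ⊓ Nᗮ.comap (LinearMap.fst ℝ E E) with hG
  have hGmem : ∀ p : E × E, p ∈ G ↔ ∃ y : A.domain, (y : E) = p.1 ∧ A y = p.2 ∧ (y : E) ∈ Nᗮ := by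
    intro p
    rw [hG, Submodule.mem_inf, LinearPMap.mem_graph_iff, Submodule.mem_comap]
    constructor
    · rintro ⟨⟨y, h₁, h₂⟩, h₃⟩
      exact ⟨y, h₁, h₂, by rw [h₁]; exact h₃⟩
    · rintro ⟨y, h₁, h₂, h₃⟩
      exact ⟨⟨y, h₁, h₂⟩, by rw [h₁] at h₃; exact h₃⟩
  have hGc : IsClosed (G : Set (E × E)) := by
    have h1 : IsClosed (A.graph : Set (E × E)) := hA.isClosed
    exact h1.inter ((Submodule.isClosed_orthogonal N).preimage continuous_fst)
  have : CompleteSpace G := hGc.completeSpace_coe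
  have hle : ∀ p ∈ G, s * ‖p.1‖ ≤ ‖p.2‖ := fun p hp => by
    obtain ⟨y, h₁, h₂, h₃⟩ := (hGmem p).1 hp
    rw [← h₁, ← h₂]
    have h4 := (hgap y h₃).trans (real_inner_le_norm _ _)
    rcases (norm_nonneg (y : E)).eq_or_lt with h0 | h0
    · rw [← h0, mul_zero]; exact norm_nonneg _
    · nlinarith
  set R : Submodule ℝ E := G.map (LinearMap.snd ℝ E E) with hR
  have hRmem : ∀ z, z ∈ R ↔ ∃ y : A.domain, (y : E) ∈ Nᗮ ∧ A y = z := fun z => by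
    rw [hR, Submodule.mem_map]
    constructor
    · rintro ⟨p, hp, rfl⟩
      obtain ⟨y, _, h₂, h₃⟩ := (hGmem p).1 hp
      exact ⟨y, h₃, h₂⟩
    · rintro ⟨y, h₁, h₂⟩
      exact ⟨((y : E), A y), (hGmem _).2 ⟨y, rfl, rfl, h₁⟩, h₂⟩
  have hRc : IsClosed (R : Set E) := by
    have hf : AntilipschitzWith (max (Real.toNNReal s⁻¹) 1) fun p : G => (p : E × E).2 := by
      refine AntilipschitzWith.of_le_mul_dist fun p q => ?_
      have h1 := hle _ (p - q).2
      rw [Submodule.coe_sub, Prod.fst_sub, Prod.snd_sub] at h1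
      rw [Subtype.dist_eq, Prod.dist_eq, dist_eq_norm, dist_eq_norm, NNReal.coe_max,
        Real.coe_toNNReal _ (inv_nonneg.2 hs.le), NNReal.coe_one]
      refine max_le ?_ (le_mul_of_one_le_left (norm_nonneg _) (le_max_right _ _))
      refine le_trans ?_ (mul_le_mul_of_nonneg_right (le_max_left _ _) (norm_nonneg _))
      rw [← div_eq_inv_mul, le_div_iff₀ hs]
      linarith
    have := hf.isClosed_range (uniformContinuous_snd.comp uniformContinuous_subtype_val)
    convert! this using 1
    ext z
    rw [hR]
    simp
  have : CompleteSpace R := hRc.completeSpace_coe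
  have hRN : R ≤ Nᗮ := fun z hz => by
    obtain ⟨y, _, rfl⟩ := (hRmem z).1 hz
    refine (Submodule.mem_orthogonal' _ _).2 fun n hn => ?_
    obtain ⟨x, rfl, hx⟩ := (hN n).1 hn
    rw [hA.inner_map_left, hx, inner_zero_right]
  -- The component of g orthogonal to R is orthogonal to the whole range of A, because subtracting
  -- the null part of x does not change A x. So z lies in N, and also in Nᗮ, hence it is zero.
  set z := g - R.starProjection g with hz
  have hzR : z ∈ Rᗮ := R.sub_starProjection_mem_orthogonal g
  have hzN : z ∈ Nᗮ := Nᗮ.sub_mem hg (hRN (R.starProjection_apply_mem g))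
  have hz0 : z = 0 := by
    have : z ∈ N := (hN z).2 <| hA.exists_map_eq_zero fun x => by
      obtain ⟨n, hn, hn0⟩ := (hN _).1 (N.starProjection_apply_mem (x : E))
      have h1 : ((x - n : A.domain) : E) ∈ Nᗮ := by
        rw [Submodule.coe_sub, hn]
        exact N.sub_starProjection_mem_orthogonal _
      have h2 : A x = A (x - n) := by rw [A.map_sub, hn0, sub_zero]
      rw [h2]
      exact (Submodule.mem_orthogonal' _ _).1 hzR _ ((hRmem _).2 ⟨_, h1, rfl⟩)
    exact (Submodule.disjoint_def.1 N.orthogonal_disjoint) z this hzN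
  rw [sub_eq_zero] at hz0
  exact (hRmem g).1 (hz0 ▸ R.starProjection_apply_mem g)

end Gap

/-! ### The damped operator -/

section DampedOperator

variable {d m : ℕ} {V : Set (Vel d)} {ω₀ : ℝ}

theorem memLp_velMeasure_of_nonpos {q : ℝ} (hq : q ≤ 0) {g : Vel d → Val m}
    (hg : MemLp g 2 (volume.restrict V)) : MemLp g 2 (velMeasure V q) := by
  refine hg.mono_measure ?_
  conv_rhs => rw [← withDensity_one (μ := volume.restrict V)]
  refine withDensity_mono (Eventually.of_forall fun v => ?_)
  rw [Pi.one_apply, ← ENNReal.ofReal_one, ← wt_zero v]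
  exact ENNReal.ofReal_le_ofReal (wt_le_wt hq v)

/-- The rank one operator `f ↦ w ⟨w, f⟩`. -/
theorem exists_rankOneL {w : Vel d → Val m} (hw : MemLp w 2 (velMeasure V (-ω₀))) :
    ∃ T : L2w m V ω₀ →L[ℝ] L2w m V (-ω₀), (∀ f, T f =ᵐ[volume.restrict V] rankOne V w f) ∧
      ∀ f, ∫ v in V, inner ℝ (T f v) (f v) = (∫ v in V, inner ℝ (w v) (f v)) ^ 2 := by
  have hD := isDens_velMeasure V (-ω₀)
  have hwae : hw.toLp =ᵐ[volume.restrict V] w := by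
    rw [← hD.ae_eq]; exact hw.coeFn_toLp
  have hin : ∀ f : L2w m V ω₀, inner ℝ (riesz m V ω₀ hw.toLp) f = ∫ v in V, inner ℝ (w v) (f v) :=
    fun f => by
      rw [inner_riesz]
      refine integral_congr_ae ?_
      filter_upwards [hwae] with v hv
      rw [hv]
  refine ⟨(innerSL ℝ (riesz m V ω₀ hw.toLp)).smulRight hw.toLp, fun f => ?_, fun f => ?_⟩
  · change ((inner ℝ (riesz m V ω₀ hw.toLp) f • hw.toLp : L2w m V (-ω₀)) : Vel d → Val m) =ᵐ[_] _
    rw [hin]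
    filter_upwards [hD.smul_ae (∫ v in V, inner ℝ (w v) (f v)) hw.toLp, hwae] with v h₁ h₂
    rw [h₁, h₂, rankOne]
  · change ∫ v in V, inner ℝ ((inner ℝ (riesz m V ω₀ hw.toLp) f • hw.toLp : L2w m V (-ω₀)) v) (f v) = _
    rw [hin, sq, ← integral_const_mul]
    refine integral_congr_ae ?_
    filter_upwards [hD.smul_ae (∫ v in V, inner ℝ (w v) (f v)) hw.toLp, hwae] with v h₁ h₂
    rw [h₁, h₂, real_inner_smul_left]

/-- Operators that are given almost everywhere by the same formula as `F`, with the quadratic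
form `Q`. -/
def IsRealized (F : L2w m V ω₀ → Vel d → Val m) (Q : L2w m V ω₀ → ℝ)
    (T : L2w m V ω₀ →L[ℝ] L2w m V (-ω₀)) : Prop :=
  (∀ f, T f =ᵐ[volume.restrict V] F f) ∧ ∀ f, ∫ v in V, inner ℝ (T f v) (f v) = Q f

theorem IsRealized.add_smul {F F' : L2w m V ω₀ → Vel d → Val m} {Q Q' : L2w m V ω₀ → ℝ}
    {T T' : L2w m V ω₀ →L[ℝ] L2w m V (-ω₀)} (h : IsRealized F Q T) (h' : IsRealized F' Q' T')
    (α : ℝ) : IsRealized (fun f v => F f v + α • F' f v) (fun f => Q f + α * Q' f) (T + α • T') := by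
  have hD := isDens_velMeasure V (-ω₀)
  refine ⟨fun f => ?_, fun f => ?_⟩
  · filter_upwards [hD.add_ae (T f) (α • T' f), hD.smul_ae α (T' f), h.1 f, h'.1 f] with v h₁ h₂ h₃ h₄
    rw [show (T + α • T') f = T f + α • T' f from rfl, h₁, h₂, h₃, h₄]
  · beta_reduce
    rw [← h.2, ← h'.2, ← integral_const_mul, ← integral_add (integrable_inner_dual _ _)
      ((integrable_inner_dual _ _).const_mul α)]
    refine integral_congr_ae ?_
    filter_upwards [hD.add_ae (T f) (α • T' f), hD.smul_ae α (T' f)] with v h₁ h₂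
    rw [show (T + α • T') f = T f + α • T' f from rfl, h₁, h₂, inner_add_left, real_inner_smul_left]

theorem exists_isRealized_sum {ι : Type*} (s : Finset ι) {w : ι → Vel d → Val m}
    (hw : ∀ k ∈ s, MemLp (w k) 2 (velMeasure V (-ω₀))) : ∃ T : L2w m V ω₀ →L[ℝ] L2w m V (-ω₀),
      IsRealized (fun f v => ∑ k ∈ s, rankOne V (w k) f v)
        (fun f => ∑ k ∈ s, (∫ v in V, inner ℝ (w k v) (f v)) ^ 2) T := by
  classical
  induction s using Finset.induction_on with
  | empty =>
    refine ⟨0, fun f => ?_, fun f => ?_⟩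
    · filter_upwards [(isDens_velMeasure V (-ω₀)).zero_ae (m := m)] with v hv
      rw [show (0 : L2w m V ω₀ →L[ℝ] L2w m V (-ω₀)) f = 0 from rfl, hv, Finset.sum_empty, Pi.zero_apply]
    · beta_reduce
      rw [Finset.sum_empty]
      refine (integral_congr_ae ?_).trans (integral_zero' _ _)
      filter_upwards [(isDens_velMeasure V (-ω₀)).zero_ae (m := m)] with v hv
      rw [show (0 : L2w m V ω₀ →L[ℝ] L2w m V (-ω₀)) f = 0 from rfl, hv, Pi.zero_apply,
        inner_zero_left, Pi.zero_apply]
  | insert k s hk ih =>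
    obtain ⟨T, hT⟩ := ih fun j hj => hw j (Finset.mem_insert_of_mem hj)
    obtain ⟨T', hT'⟩ := exists_rankOneL (hw k (Finset.mem_insert_self k s))
    refine ⟨T + (1 : ℝ) • T', ?_⟩
    have := hT.add_smul hT' 1
    simp only [one_smul, one_mul] at this
    simp only [Finset.sum_insert hk, add_comm (rankOne _ _ _ _), add_comm ((∫ v in V, _) ^ 2), one_smul]
    exact this

variable [NeZero d] {u : ℝ} {L : L2v m V →ₗ.[ℝ] L2v m V}
  {La : L2w m V ω₀ →L[ℝ] L2w m V (-ω₀)} {ν : ℕ} {X : Fin ν → L2v m V} {γ : Fin ν → ℝ}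

/-- The quadratic form of the damping. -/
def dampQ (u : ℝ) (L : L2v m V →ₗ.[ℝ] L2v m V) (X : Fin ν → L2v m V) (γ : Fin ν → ℝ)
    (f : L2w m V ω₀) : ℝ :=
  ∑ k, (∫ v in V, inner ℝ (shiftMul u (X k) v) (f v)) ^ 2 +
    ∑ k with γ k = 0, (∫ v in V, inner ℝ (shiftMul u (pinvShift u L (X k)) v) (f v)) ^ 2

/-- Each rank one term is bounded from L²(a dv) to L²(1/a dv) because its vector lies in L²(1/a dv),
and it contributes a square to the quadratic form. The three sums over the sign of the eigenvalue
merge into one in `dampQ`. -/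
theorem exists_dampedL (hω₀ : 0 ≤ ω₀) (hP : ∀ k, MemLp (shiftMul u (X k)) 2 (volume.restrict V))
    (hX0 : ∀ k, γ k = 0 → MemLp (shiftMul u (pinvShift u L (X k))) 2 (velMeasure V (-ω₀))) (α : ℝ) :
    ∃ D : L2w m V ω₀ →L[ℝ] L2w m V (-ω₀), (∀ f, damped u L La X γ α f =ᵐ[volume.restrict V] D f) ∧
      ∀ f, ∫ v in V, inner ℝ (D f v) (f v) =
        (∫ v in V, inner ℝ (f v) (La f v)) + α * dampQ u L X γ f := by
  have hP' : ∀ k, MemLp (shiftMul u (X k)) 2 (velMeasure V (-ω₀)) := fun k =>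
    memLp_velMeasure_of_nonpos (by linarith) (hP k)
  have h0 : IsRealized (fun f => La f) (fun f => ∫ v in V, inner ℝ (f v) (La f v)) La :=
    ⟨fun f => ae_eq_refl _, fun f => by simp_rw [real_inner_comm]⟩
  obtain ⟨T₁, h₁⟩ := exists_isRealized_sum (m := m) (V := V) (ω₀ := ω₀)
    (Finset.univ.filter fun k => 0 < γ k) (w := fun k => shiftMul u (X k)) fun k _ => hP' k
  obtain ⟨T₂, h₂⟩ := exists_isRealized_sum (m := m) (V := V) (ω₀ := ω₀)
    (Finset.univ.filter fun k => γ k < 0) (w := fun k => shiftMul u (X k)) fun k _ => hP' k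
  obtain ⟨T₃, h₃⟩ := exists_isRealized_sum (m := m) (V := V) (ω₀ := ω₀)
    (Finset.univ.filter fun k => γ k = 0) (w := fun k => shiftMul u (X k)) fun k _ => hP' k
  obtain ⟨T₄, h₄⟩ := exists_isRealized_sum (m := m) (V := V) (ω₀ := ω₀)
    (Finset.univ.filter fun k => γ k = 0) (w := fun k => shiftMul u (pinvShift u L (X k)))
    fun k hk => hX0 k (Finset.mem_filter.1 hk).2
  have h := (((h0.add_smul h₁ α).add_smul h₂ α).add_smul h₃ α).add_smul h₄ α
  refine ⟨_, fun f => (h.1 f).symm, fun f => ?_⟩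
  rw [h.2, dampQ]
  have hsplit : ∀ a : Fin ν → ℝ, ∑ k, a k = ∑ k with 0 < γ k, a k + ∑ k with γ k < 0, a k +
      ∑ k with γ k = 0, a k := fun a => by
    simp only [Finset.sum_filter, ← Finset.sum_add_distrib]
    refine Finset.sum_congr rfl fun k _ => ?_
    rcases lt_trichotomy (γ k) 0 with hk | hk | hk
    · simp [hk, hk.ne, hk.le]
    · simp [hk]
    · simp [hk, hk.ne', hk.le]
  rw [hsplit]
  ring

end DampedOperator

/-! ### The domain of the collision operator -/

section Domain

variable {d m : ℕ} {V : Set (Vel d)} {ω₀ : ℝ} {L : L2v m V →ₗ.[ℝ] L2v m V}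

theorem exists_inclH (hω₀ : 0 ≤ ω₀) : ∃ i : L2w m V ω₀ →L[ℝ] L2v m V,
    ∀ f, i f =ᵐ[volume.restrict V] f := by
  obtain ⟨T, hT⟩ := exists_mulOp (m := m) (isDens_velMeasure V ω₀) (isDens_volume V)
    (b := fun _ => 1) measurable_const (C := 1) fun v => by
      simpa using (wt_zero v).ge.trans (wt_le_wt hω₀ v)
  exact ⟨T, fun f => by simpa using hT f⟩

/-- Elements of the domain lie in `L²(a dv)`. -/
theorem AssumptionA1.exists_eq (hω₀ : 0 ≤ ω₀) (hA1 : AssumptionA1 ω₀ L) {f : L2v m V}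
    (hf : f ∈ L.domain) : ∃ g : L2w m V ω₀, g =ᵐ[volume.restrict V] f := by
  have hw := (hA1.2.2 f).1 hf
  obtain ⟨T, hT⟩ := exists_mulOp (m := m) (isDens_volume V) (isDens_velMeasure V ω₀)
    (b := wt (-ω₀)) (continuous_wt _).measurable (C := 1) fun v => by
      rw [sq, mul_assoc, wt_neg_mul, mul_one, one_mul, ← wt_zero v]
      exact wt_le_wt (by linarith) v
  refine ⟨T hw.toLp, ?_⟩
  filter_upwards [hT hw.toLp, hw.coeFn_toLp] with v h₁ h₂
  rw [h₁, h₂, smul_smul, wt_neg_mul, one_smul]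

/-- The domain is dense in `L²(a dv)`. -/
theorem AssumptionA1.dense (hA1 : AssumptionA1 ω₀ L) : Dense {f : L2w m V ω₀ |
    ∃ f' : L.domain, (f : Vel d → Val m) =ᵐ[volume.restrict V] ((f' : L2v m V) : Vel d → Val m)} := by
  refine (Lp.dense_hasCompactSupport_contDiff (F := Val m) (μ := velMeasure V ω₀) (p := 2)
      (by norm_num)).mono ?_
  rintro f ⟨ζ, hf, hs, hζ⟩
  rw [(isDens_velMeasure V ω₀).ae_eq] at hf
  have h₁ : MemLp ζ 2 (volume.restrict V) := hζ.continuous.memLp_of_hasCompactSupport hs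
  have h₂ : MemLp (fun v => wt ω₀ v • ζ v) 2 (volume.restrict V) :=
    ((continuous_wt ω₀).smul hζ.continuous).memLp_of_hasCompactSupport hs.smul_left
  have hd : h₁.toLp ∈ L.domain := (hA1.2.2 _).2 <| h₂.ae_eq <| by
    filter_upwards [h₁.coeFn_toLp] with v hv
    rw [hv]
  exact ⟨⟨_, hd⟩, hf.trans h₁.coeFn_toLp.symm⟩

variable [NeZero d] {u : ℝ} {La : L2w m V ω₀ →L[ℝ] L2w m V (-ω₀)} {ν : ℕ} {X : Fin ν → L2v m V}
  {γ : Fin ν → ℝ} {α : ℝ}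

/-- Both sides of the inequality are continuous on L²(a dv), where the domain of L is dense. -/
theorem Coercive.exists_forall (hA1 : AssumptionA1 ω₀ L) (h : Coercive u L La X γ α)
    {D : L2w m V ω₀ →L[ℝ] L2w m V (-ω₀)}
    (hD : ∀ f, damped u L La X γ α f =ᵐ[volume.restrict V] D f) :
    ∃ c, 0 < c ∧ ∀ f, c * ‖f‖ ^ 2 ≤ ∫ v in V, inner ℝ (D f v) (f v) := by
  obtain ⟨c, hc, h⟩ := h
  refine ⟨c, hc, fun f => ?_⟩
  have hcl : IsClosed {f : L2w m V ω₀ | c * ‖f‖ ^ 2 ≤ inner ℝ (riesz m V ω₀ (D f)) f} :=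
    isClosed_le (by fun_prop) ((((riesz m V ω₀).comp D).continuous).inner continuous_id)
  have hall : f ∈ {f : L2w m V ω₀ | c * ‖f‖ ^ 2 ≤ inner ℝ (riesz m V ω₀ (D f)) f} := by
    refine closure_minimal ?_ hcl (hA1.dense f)
    intro g hg
    refine (h g hg).trans_eq ?_
    rw [inner_riesz]
    refine integral_congr_ae ?_
    filter_upwards [hD g] with v hv
    rw [hv, real_inner_comm]
  rw [← inner_riesz]
  exact hall

end Domain

/-! ### Coercivity for small damping parameters -/

section FiniteRank

variable {H : Type*} [NormedAddCommGroup H] [InnerProductSpace ℝ H] {κ ι : Type*} [Fintype κ]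
  [Fintype ι]

/-- An injective linear map between finite dimensional spaces is bounded below. -/
theorem exists_sum_sq_ge (ℓ : κ → H →L[ℝ] ℝ) (j : EuclideanSpace ℝ ι →L[ℝ] H)
    (hj : ∀ c, (∀ i, ℓ i (j c) = 0) → c = 0) :
    ∃ q : ℝ, 0 < q ∧ ∀ c, q * ‖j c‖ ^ 2 ≤ ∑ i, ℓ i (j c) ^ 2 := by
  set W : EuclideanSpace ℝ ι →ₗ[ℝ] EuclideanSpace ℝ κ :=
    (WithLp.linearEquiv 2 ℝ (κ → ℝ)).symm.toLinearMap ∘ₗ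
      LinearMap.pi fun i => ((ℓ i).comp j : EuclideanSpace ℝ ι →ₗ[ℝ] ℝ) with hW
  have hWa : ∀ c i, W c i = ℓ i (j c) := fun c i => rfl
  obtain ⟨K, hK, hA⟩ := W.exists_antilipschitzWith (LinearMap.ker_eq_bot'.2 fun c hc =>
    hj c fun i => by rw [← hWa, hc]; rfl)
  have hWn : ∀ c, ‖W c‖ ^ 2 = ∑ i, ℓ i (j c) ^ 2 := fun c => by
    rw [EuclideanSpace.norm_sq_eq]
    simp_rw [hWa, Real.norm_eq_abs, sq_abs]
  refine ⟨1 / (‖j‖ ^ 2 * K ^ 2 + 1), by positivity, fun c => ?_⟩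
  have h1 : ‖c‖ ≤ K * ‖W c‖ := by
    have := hA.le_mul_dist c 0
    rwa [map_zero, dist_zero_right, dist_zero_right] at this
  have h2 : ‖j c‖ ^ 2 ≤ (‖j‖ ^ 2 * K ^ 2 + 1) * ‖W c‖ ^ 2 := by
    calc ‖j c‖ ^ 2 ≤ (‖j‖ * (K * ‖W c‖)) ^ 2 := by
          refine pow_le_pow_left₀ (norm_nonneg _) ((j.le_opNorm c).trans ?_) 2
          gcongr
      _ = ‖j‖ ^ 2 * K ^ 2 * ‖W c‖ ^ 2 := by ring
      _ ≤ _ := by nlinarith [sq_nonneg ‖W c‖]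
  rw [← hWn, one_div, ← div_eq_inv_mul, div_le_iff₀ (by positivity), mul_comm]
  exact h2

/-- Split f into n = j(p f) and the rest r. The form a controls r, the squares control n, and for
small α the squares evaluated at r are absorbed by a. -/
theorem exists_coercive_add (ℓ : κ → H →L[ℝ] ℝ) (j : EuclideanSpace ℝ ι →L[ℝ] H)
    (hj : ∀ c, (∀ i, ℓ i (j c) = 0) → c = 0) (p : H → EuclideanSpace ℝ ι) (a : H → ℝ) {s : ℝ}
    (hs : 0 < s) (ha : ∀ f, s * ‖f - j (p f)‖ ^ 2 ≤ a f) :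
    ∃ α₀ : ℝ, 0 < α₀ ∧ ∀ α, 0 < α → α ≤ α₀ →
      ∃ c, 0 < c ∧ ∀ f, c * ‖f‖ ^ 2 ≤ a f + α * ∑ i, ℓ i f ^ 2 := by
  obtain ⟨q, hq, hqj⟩ := exists_sum_sq_ge ℓ j hj
  set C : ℝ := ∑ i, ‖ℓ i‖ ^ 2 with hC
  have hC0 : 0 ≤ C := Finset.sum_nonneg fun i _ => sq_nonneg _
  -- The bound on α makes αC ≤ s/2, so half of the gap is left for r, while n keeps αq/2; the last
  -- halving comes from ‖n + r‖² ≤ 2(‖n‖² + ‖r‖²).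
  refine ⟨s / (2 * (C + 1)), by positivity, fun α hα hαs => ⟨min (s / 2) (α * q / 2) / 2,
    by positivity, fun f => ?_⟩⟩
  set n := j (p f) with hn
  set r := f - n with hr
  have hf : f = n + r := by rw [hr, add_sub_cancel]
  have h1 : ∑ i, ℓ i r ^ 2 ≤ C * ‖r‖ ^ 2 := by
    rw [hC, Finset.sum_mul]
    refine Finset.sum_le_sum fun i _ => ?_
    rw [← mul_pow, ← sq_abs, ← Real.norm_eq_abs]
    exact pow_le_pow_left₀ (norm_nonneg _) ((ℓ i).le_opNorm r) 2
  have h2 : (1 / 2) * ∑ i, ℓ i n ^ 2 - ∑ i, ℓ i r ^ 2 ≤ ∑ i, ℓ i f ^ 2 := by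
    rw [Finset.mul_sum, ← Finset.sum_sub_distrib]
    refine Finset.sum_le_sum fun i _ => ?_
    rw [hf, map_add]
    nlinarith [sq_nonneg (ℓ i n + 2 * ℓ i r)]
  have h3 : α * C ≤ s / 2 := by
    have := mul_le_mul_of_nonneg_right hαs (by positivity : 0 ≤ 2 * (C + 1))
    rw [div_mul_cancel₀ _ (by positivity)] at this
    nlinarith
  have h4 : ‖f‖ ^ 2 ≤ 2 * (‖n‖ ^ 2 + ‖r‖ ^ 2) := by
    have h := norm_add_le n r
    rw [← hf] at h
    have := pow_le_pow_left₀ (norm_nonneg _) h 2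
    nlinarith [sq_nonneg (‖n‖ - ‖r‖)]
  set μ := min (s / 2) (α * q / 2) with hμ
  have hμ0 : 0 < μ := lt_min (by positivity) (by positivity)
  have h5 : μ * ‖r‖ ^ 2 ≤ s / 2 * ‖r‖ ^ 2 :=
    mul_le_mul_of_nonneg_right (min_le_left _ _) (sq_nonneg _)
  have h6 : μ * ‖n‖ ^ 2 ≤ α * q / 2 * ‖n‖ ^ 2 :=
    mul_le_mul_of_nonneg_right (min_le_right _ _) (sq_nonneg _)
  have h7 := mul_le_mul_of_nonneg_left h2 hα.le
  have h8 := mul_le_mul_of_nonneg_left h1 hα.le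
  have h9 := mul_le_mul_of_nonneg_left (hqj (p f)) hα.le
  have h10 := mul_le_mul_of_nonneg_right h3 (sq_nonneg ‖r‖)
  have h11 := mul_le_mul_of_nonneg_left h4 hμ0.le
  have h12 := ha f
  rw [← hn] at h9
  linarith

end FiniteRank

/-! ### The spectral gap and the pseudo-inverse of L. -/

section Collision

variable {d m : ℕ} {V : Set (Vel d)} {ω₀ : ℝ} {L : L2v m V →ₗ.[ℝ] L2v m V}
  {La : L2w m V ω₀ →L[ℝ] L2w m V (-ω₀)}

theorem mem_nullSpace {x : L2v m V} : x ∈ nullSpace L ↔ ∃ y : L.domain, (y : L2v m V) = x ∧ L y = 0 := by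
  rw [nullSpace, Submodule.mem_map]
  constructor
  · rintro ⟨y, hy, rfl⟩
    exact ⟨y, rfl, hy⟩
  · rintro ⟨y, rfl, hy⟩
    exact ⟨y, hy, rfl⟩

theorem nullProj_eq [FiniteDimensional ℝ (nullSpace L)] {f n : L2v m V} (hn : n ∈ nullSpace L)
    (h : f - n ∈ (nullSpace L)ᗮ) : nullProj L f = n := by
  have hc : (nullSpace L).topologicalClosure = nullSpace L :=
    (Submodule.closed_of_finiteDimensional (nullSpace L)).submodule_topologicalClosure_eq
  refine Submodule.eq_starProjection_of_mem_orthogonal ?_ ?_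
  · rw [hc]; exact hn
  · rw [hc]; exact h

theorem sub_nullProj_mem [FiniteDimensional ℝ (nullSpace L)] (f : L2v m V) :
    f - nullProj L f ∈ (nullSpace L)ᗮ := by
  rw [nullProj_eq ((nullSpace L).starProjection_apply_mem f)
    ((nullSpace L).sub_starProjection_mem_orthogonal f)]
  exact (nullSpace L).sub_starProjection_mem_orthogonal f

theorem inner_eq_integral (f g : L2v m V) : inner ℝ f g = ∫ v in V, inner ℝ (f v) (g v) := rfl

/-- On the orthogonal complement of the null space the projection in (A4) vanishes, and a ≥ 1 lets
the weighted norm be replaced by the plain one. -/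
theorem exists_gap [FiniteDimensional ℝ (nullSpace L)] (hω₀ : 0 ≤ ω₀) (hA1 : AssumptionA1 ω₀ L)
    (hA2 : AssumptionA2 ω₀ L La) (hA4 : AssumptionA4 ω₀ L La) : ∃ s : ℝ, 0 < s ∧
      ∀ y : L.domain, (y : L2v m V) ∈ (nullSpace L)ᗮ →
        s * ‖(y : L2v m V)‖ ^ 2 ≤ inner ℝ (y : L2v m V) (L y) := by
  obtain ⟨s, hs, h⟩ := hA4
  refine ⟨s, hs, fun y hy => ?_⟩
  obtain ⟨g, hg⟩ := hA1.exists_eq hω₀ y.2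
  have hP : nullProj L (y : L2v m V) = 0 := nullProj_eq (zero_mem _) (by rwa [sub_zero])
  have h1 := h g y hg
  rw [hP] at h1
  have hD := isDens_velMeasure V ω₀
  have e1 : ∫ v in V, inner ℝ (g v) (La g v) = inner ℝ (y : L2v m V) (L y) := by
    rw [inner_eq_integral]
    refine integral_congr_ae ?_
    filter_upwards [hg, hA2 y g hg.symm] with v h₁ h₂
    rw [h₁, h₂]
  rw [e1] at h1
  refine le_trans (mul_le_mul_of_nonneg_left ?_ hs.le) h1
  rw [← real_inner_self_eq_norm_sq, inner_eq_integral]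
  refine integral_mono_ae (L2.integrable_inner _ _) ?_ ?_
  · refine (hD.integrable_inner g g).congr ?_
    filter_upwards [hg, (isDens_volume V).zero_ae (m := m)] with v h₁ h₂
    rw [h₁, h₂, Pi.zero_apply, sub_zero, real_inner_self_eq_norm_sq]
  · filter_upwards [(isDens_volume V).zero_ae (m := m)] with v h₂
    rw [h₂, Pi.zero_apply, sub_zero, real_inner_self_eq_norm_sq]
    refine le_mul_of_one_le_left (sq_nonneg _) ?_
    rw [← wt_zero v]
    exact wt_le_wt hω₀ v

theorem pinv_spec [FiniteDimensional ℝ (nullSpace L)] (hω₀ : 0 ≤ ω₀) (hA1 : AssumptionA1 ω₀ L)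
    (hA2 : AssumptionA2 ω₀ L La) (hA4 : AssumptionA4 ω₀ L La) (g : L2v m V) : ∃ y : L.domain,
      (y : L2v m V) = pinv L g ∧ (y : L2v m V) ∈ (nullSpace L)ᗮ ∧ L y = g - nullProj L g := by
  obtain ⟨s, hs, hgap⟩ := exists_gap hω₀ hA1 hA2 hA4
  have hex := IsSelfAdjoint.exists_map_eq hA1.1 (nullSpace L) (fun _ => mem_nullSpace) hs hgap
    (sub_nullProj_mem g)
  rw [pinv, dif_pos hex]
  exact ⟨hex.choose, rfl, hex.choose_spec⟩

end Collision

/-! ### The damping on the null space and coercivity for small parameters. -/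

section Damping

variable {d m : ℕ} [NeZero d] {V : Set (Vel d)} {u ω₀ : ℝ} {L : L2v m V →ₗ.[ℝ] L2v m V}
  {La : L2w m V ω₀ →L[ℝ] L2w m V (-ω₀)} {ν : ℕ} {X : Fin ν → L2v m V} {γ : Fin ν → ℝ}

omit [NeZero d] in
theorem toL2_ae {g : Vel d → Val m} (h : MemLp g 2 (volume.restrict V)) :
    toL2 V g =ᵐ[volume.restrict V] g := by
  rw [toL2, dif_pos h]
  exact h.coeFn_toLp

/-- Multiplication by `v₁ + u` as a linear map on the null space. -/
def shiftN (u : ℝ) (L : L2v m V →ₗ.[ℝ] L2v m V)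
    (hP1 : ∀ f ∈ nullSpace L, MemLp (shiftMul u f) 2 (volume.restrict V)) :
    nullSpace L →ₗ[ℝ] L2v m V where
  toFun f := toL2 V (shiftMul u (f : L2v m V))
  map_add' f g := by
    have hD := isDens_volume V
    refine hD.ext ?_
    filter_upwards [toL2_ae (hP1 _ (f + g).2), toL2_ae (hP1 _ f.2), toL2_ae (hP1 _ g.2),
      hD.add_ae (f : L2v m V) (g : L2v m V), hD.add_ae (toL2 V (shiftMul u (f : L2v m V)))
      (toL2 V (shiftMul u (g : L2v m V)))] with v h₁ h₂ h₃ h₄ h₅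
    rw [h₁, h₅, h₂, h₃, shiftMul, Submodule.coe_add, h₄, smul_add]
    rfl
  map_smul' c f := by
    have hD := isDens_volume V
    refine hD.ext ?_
    filter_upwards [toL2_ae (hP1 _ (c • f).2), toL2_ae (hP1 _ f.2), hD.smul_ae c (f : L2v m V),
      hD.smul_ae c (toL2 V (shiftMul u (f : L2v m V)))] with v h₁ h₂ h₃ h₄
    rw [h₁, RingHom.id_apply, h₄, h₂, shiftMul, Submodule.coe_smul, h₃, smul_comm]
    rfl

theorem IsEigenbasis.mem (hX : IsEigenbasis u L X γ) (k : Fin ν) : X k ∈ nullSpace L := by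
  rw [← hX.span_eq]
  exact Submodule.subset_span (mem_range_self k)

theorem IsEigenbasis.nullProj_eq_sum [FiniteDimensional ℝ (nullSpace L)] (hX : IsEigenbasis u L X γ)
    (f : L2v m V) : nullProj L f = ∑ k, inner ℝ (X k) f • X k := by
  refine nullProj_eq (Submodule.sum_mem _ fun k _ => Submodule.smul_mem _ _ (hX.mem k)) ?_
  set v := f - ∑ k, inner ℝ (X k) f • X k with hv
  have hle : nullSpace L ≤ (ℝ ∙ v)ᗮ := by
    rw [← hX.span_eq, Submodule.span_le]
    rintro _ ⟨k, rfl⟩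
    refine Submodule.mem_orthogonal_singleton_iff_inner_left.2 ?_
    rw [hv, inner_sub_right, hX.orthonormal.inner_right_fintype, sub_self]
  exact (Submodule.mem_orthogonal _ _).2 fun w hw =>
    Submodule.mem_orthogonal_singleton_iff_inner_left.1 (hle hw)

/-- Against an element of the null space, (v₁+u)X_k may be replaced by its projection, which is the
eigenvector relation for P₁. -/
theorem IsEigenbasis.inner_shift [FiniteDimensional ℝ (nullSpace L)] (hX : IsEigenbasis u L X γ)
    (k : Fin ν) {n : L2v m V} (hn : n ∈ nullSpace L) :
    inner ℝ (toL2 V (shiftMul u (X k))) n = γ k * inner ℝ (X k) n := by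
  have h := (Submodule.mem_orthogonal' _ _).1 (sub_nullProj_mem (L := L) (toL2 V (shiftMul u (X k)))) n hn
  rw [inner_sub_left, sub_eq_zero] at h
  rw [h, ← real_inner_smul_left, ← hX.eigen k]
  rfl

omit [NeZero d] in
theorem inner_toL2 {w : Vel d → Val m} (h : MemLp w 2 (volume.restrict V)) (n : L2v m V) :
    inner ℝ (toL2 V w) n = ∫ v in V, inner ℝ (w v) (n v) := by
  rw [inner_eq_integral]
  refine integral_congr_ae ?_
  filter_upwards [toL2_ae h] with v hv
  rw [hv]

/-- The damping terms control the null space. -/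
theorem IsEigenbasis.eq_zero_of_damping (hX : IsEigenbasis u L X γ) (hω₀ : 0 ≤ ω₀)
    (hA1 : AssumptionA1 ω₀ L) (hA2 : AssumptionA2 ω₀ L La) (hA3 : AssumptionA3 L)
    (hA4 : AssumptionA4 ω₀ L La)
    (hP1 : ∀ f ∈ nullSpace L, MemLp (shiftMul u f) 2 (volume.restrict V)) (c : Fin ν → ℝ)
    (h₁ : ∀ k, ∫ v in V, inner ℝ (shiftMul u (X k) v) ((∑ i, c i • X i : L2v m V) v) = 0)
    (h₂ : ∀ k, γ k = 0 → ∫ v in V, inner ℝ (shiftMul u (pinvShift u L (X k)) v)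
      ((∑ i, c i • X i : L2v m V) v) = 0) : c = 0 := by
  have := hA3.1
  set n : L2v m V := ∑ i, c i • X i with hn
  have hnN : n ∈ nullSpace L := Submodule.sum_mem _ fun k _ => Submodule.smul_mem _ _ (hX.mem k)
  have hcn : ∀ k, inner ℝ (X k) n = c k := fun k => hX.orthonormal.inner_right_fintype c k
  have hγ : ∀ k, γ k * c k = 0 := fun k => by
    rw [← hcn, ← hX.inner_shift k hnN, inner_toL2 (hP1 _ (hX.mem k)), h₁]
  choose Y hY₁ hY₂ hY₃ using fun k => pinv_spec hω₀ hA1 hA2 hA4 (toL2 V (shiftMul u (X k)))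
  -- This is L⁻¹((v₁+u)n). The projections that the pseudo-inverse subtracts add up to ∑ c_k γ_k
  -- X_k, which vanishes by `hγ`, so L y is exactly (v₁+u)n.
  set y : L.domain := ∑ k, c k • Y k with hy
  have hyN : (y : L2v m V) ∈ (nullSpace L)ᗮ := by
    rw [hy, Submodule.coe_sum]
    exact Submodule.sum_mem _ fun k _ => Submodule.smul_mem _ _ (hY₂ k)
  set S := shiftN u L hP1 with hS
  have hLy : L y = S ⟨n, hnN⟩ := by
    have e1 : L y = ∑ k, c k • L (Y k) := by
      change L.toFun y = ∑ k, c k • L.toFun (Y k)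
      rw [hy, map_sum]
      simp_rw [map_smul]
    have e2 : (⟨n, hnN⟩ : nullSpace L) = ∑ k, c k • ⟨X k, hX.mem k⟩ := by
      ext1
      rw [Submodule.coe_sum]
      rfl
    rw [e1, e2, map_sum]
    refine Finset.sum_congr rfl fun k _ => ?_
    rw [map_smul, hY₃, show nullProj L (toL2 V (shiftMul u (X k))) = γ k • X k from hX.eigen k,
      smul_sub, smul_smul, mul_comm, hγ, zero_smul, sub_zero]
    rfl
  have hSae : S ⟨n, hnN⟩ =ᵐ[volume.restrict V] shiftMul u n := toL2_ae (hP1 n hnN)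
  -- The factor v₁+u is moved from n to L⁻¹((v₁+u)X_k). For γ_k = 0 the result is one of the last
  -- damping functionals at n; for γ_k ≠ 0 the coefficient c_k is zero.
  have hzero : inner ℝ (y : L2v m V) (L y) = 0 := by
    rw [hLy, hy, Submodule.coe_sum, sum_inner]
    refine Finset.sum_eq_zero fun k _ => ?_
    rw [Submodule.coe_smul, real_inner_smul_left]
    by_cases hk : γ k = 0
    · rw [hY₁, inner_eq_integral]
      refine mul_eq_zero_of_right _ (Eq.trans ?_ (h₂ k hk))
      refine integral_congr_ae ?_
      filter_upwards [hSae] with v hv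
      rw [hv, shiftMul, shiftMul, real_inner_smul_left, real_inner_smul_right]
      rfl
    · rw [(mul_eq_zero.1 (hγ k)).resolve_left hk, zero_mul]
  obtain ⟨s, hs, hgap⟩ := exists_gap hω₀ hA1 hA2 hA4
  have hy0 : y = 0 := by
    have h := hgap y hyN
    rw [hzero] at h
    have : ‖(y : L2v m V)‖ ^ 2 ≤ 0 := by
      by_contra hne
      have := mul_pos hs (not_le.1 hne)
      linarith
    have := pow_eq_zero_iff two_ne_zero |>.1 (le_antisymm this (sq_nonneg _))
    exact Subtype.ext (norm_eq_zero.1 this)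
  have hn0 : n = 0 := by
    rw [hy0, LinearPMap.map_zero] at hLy
    rw [← hLy] at hSae
    refine (isDens_volume V).ext ?_
    filter_upwards [hSae, (isDens_volume V).zero_ae (m := m), ae_coord_ne V u] with v e₁ e₂ e₃
    rw [e₂] at e₁ ⊢
    exact (smul_eq_zero.1 e₁.symm).resolve_left e₃
  funext k
  rw [← hcn, hn0, inner_zero_right, Pi.zero_apply]

omit [NeZero d] in
theorem exists_functional {w : Vel d → Val m} (hw : MemLp w 2 (velMeasure V (-ω₀))) :
    ∃ ℓ : L2w m V ω₀ →L[ℝ] ℝ, ∀ f, ℓ f = ∫ v in V, inner ℝ (w v) (f v) := by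
  refine ⟨innerSL ℝ (riesz m V ω₀ hw.toLp), fun f => ?_⟩
  have := hw.coeFn_toLp
  rw [(isDens_velMeasure V (-ω₀)).ae_eq] at this
  rw [innerSL_apply_apply, inner_riesz]
  refine integral_congr_ae ?_
  filter_upwards [this] with v hv
  rw [hv]

/-- `exists_coercive_add` is applied in L²(a dv), with j the embedding of coefficient vectors into
the null space and p the coefficients of the projection onto it. (A4) supplies the gap and
`IsEigenbasis.eq_zero_of_damping` the injectivity. -/
theorem exists_coercive (hX : IsEigenbasis u L X γ) (hω₀ : 0 ≤ ω₀)
    (hA1 : AssumptionA1 ω₀ L) (hA2 : AssumptionA2 ω₀ L La) (hA3 : AssumptionA3 L)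
    (hA4 : AssumptionA4 ω₀ L La)
    (hP1 : ∀ f ∈ nullSpace L, MemLp (shiftMul u f) 2 (volume.restrict V))
    (hX0 : ∀ k, γ k = 0 → MemLp (shiftMul u (pinvShift u L (X k))) 2 (velMeasure V (-ω₀))) :
    ∃ α₀ : ℝ, 0 < α₀ ∧ ∀ α : ℝ, 0 < α → α ≤ α₀ → Coercive u L La X γ α := by
  have := hA3.1
  obtain ⟨i, hi⟩ := exists_inclH (m := m) (V := V) hω₀
  obtain ⟨s, hs, hgap⟩ := hA4
  choose X' hX' using fun k => hA1.exists_eq hω₀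
    (show X k ∈ L.domain by obtain ⟨y, hy, -⟩ := mem_nullSpace.1 (hX.mem k); exact hy ▸ y.2)
  have hiX : ∀ k, i (X' k) = X k := fun k => (isDens_volume V).ext ((hi _).trans (hX' k))
  choose ℓ₁ hℓ₁ using fun k => exists_functional (memLp_velMeasure_of_nonpos
    (q := -ω₀) (by linarith) (hP1 _ (hX.mem k)))
  choose ℓ₂ hℓ₂ using fun k : {k // γ k = 0} => exists_functional (hX0 k k.2)
  set ℓ : Fin ν ⊕ {k // γ k = 0} → L2w m V ω₀ →L[ℝ] ℝ := Sum.elim ℓ₁ ℓ₂ with hℓ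
  have hQ : ∀ f, ∑ k, ℓ k f ^ 2 = dampQ u L X γ f := fun f => by
    rw [Fintype.sum_sum_type, dampQ]
    congr 1
    · exact Finset.sum_congr rfl fun k _ => by rw [← hℓ₁]; rfl
    · rw [Finset.sum_subtype (p := fun k => γ k = 0) _ (fun k => by simp)]
      exact Finset.sum_congr rfl fun k _ => by rw [← hℓ₂]; rfl
  set j : EuclideanSpace ℝ (Fin ν) →L[ℝ] L2w m V ω₀ :=
    ∑ k, (EuclideanSpace.proj k : EuclideanSpace ℝ (Fin ν) →L[ℝ] ℝ).smulRight (X' k) with hj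
  have hja : ∀ c, j c = ∑ k, c k • X' k := fun c => by
    rw [hj, _root_.sum_apply]
    rfl
  have hij : ∀ c, i (j c) = ∑ k, c k • X k := fun c => by
    rw [hja, map_sum]
    simp_rw [map_smul, hiX]
  have hjae : ∀ c, j c =ᵐ[volume.restrict V] (∑ k, c k • X k : L2v m V) := fun c => by
    rw [← hij]
    exact (hi _).symm
  have hinj : ∀ c, (∀ k, ℓ k (j c) = 0) → c = 0 := fun c hc => by
    have e := hX.eq_zero_of_damping hω₀ hA1 hA2 hA3 ⟨s, hs, hgap⟩ hP1 c (fun k => ?_) fun k hk => ?_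
    · ext k
      exact congrFun e k
    · rw [← hc (Sum.inl k)]
      refine Eq.trans ?_ (hℓ₁ k (j c)).symm
      refine integral_congr_ae ?_
      filter_upwards [hjae c] with v hv
      rw [hv]
    · rw [← hc (Sum.inr ⟨k, hk⟩)]
      refine Eq.trans ?_ (hℓ₂ ⟨k, hk⟩ (j c)).symm
      refine integral_congr_ae ?_
      filter_upwards [hjae c] with v hv
      rw [hv]
  have ha : ∀ f : L2w m V ω₀, s * ‖f - j (WithLp.toLp 2 fun k => inner ℝ (X k) (i f))‖ ^ 2 ≤
      ∫ v in V, inner ℝ (f v) (La f v) := fun f => by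
    refine le_trans (le_of_eq ?_) (hgap f (i f) (hi f).symm)
    have hD := isDens_velMeasure V ω₀
    rw [hD.norm_sq_eq]
    congr 1
    refine integral_congr_ae ?_
    filter_upwards [hD.sub_ae f (j (WithLp.toLp 2 fun k => inner ℝ (X k) (i f))),
      hjae (WithLp.toLp 2 fun k => inner ℝ (X k) (i f)), hi f] with v e₁ e₂ e₃
    rw [e₁, e₂, e₃, hX.nullProj_eq_sum]
  obtain ⟨α₀, hα₀, h⟩ := exists_coercive_add ℓ j hinj _ _ hs ha
  refine ⟨α₀, hα₀, fun α h₁ h₂ => ?_⟩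
  obtain ⟨c, hc, h⟩ := h α h₁ h₂
  refine ⟨c, hc, fun f _ => (h f).trans (le_of_eq ?_)⟩
  obtain ⟨D, hD, hDQ⟩ := exists_dampedL (La := La) hω₀ (fun k => hP1 _ (hX.mem k)) hX0 α
  rw [hQ, ← hDQ]
  refine integral_congr_ae ?_
  filter_upwards [hD f] with v hv
  rw [hv, real_inner_comm]

end Damping

end HalfSpace

end

theorem proposition3p3 {d m : ℕ} [NeZero d] (u : ℝ)
    -- the velocity set, for example the whole space, or [-1, 1] with d = 1 and u = 0
    (V : Set (Vel d)) (hV : MeasurableSet V)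
    (hVu : ∀ v, reflect u v ∈ V ↔ v ∈ V)
    -- the weight a(v) = (1 + |v|)^ω₀
    (ω₀ : ℝ) (hω₀ : 0 ≤ ω₀) (hω₁ : ω₀ ≤ 1)
    -- the collision operator, and its bounded extension La to L²(a dv)
    (L : L2v m V →ₗ.[ℝ] L2v m V)
    (La : L2w m V ω₀ →L[ℝ] L2w m V (-ω₀))
    (hA1 : AssumptionA1 ω₀ L) (hA2 : AssumptionA2 ω₀ L La)
    (hA3 : AssumptionA3 L) (hA4 : AssumptionA4 ω₀ L La)
    -- P₁ is defined on the null space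
    (hP1 : ∀ f ∈ nullSpace L, MemLp (shiftMul u f) 2 (volume.restrict V))
    {ν : ℕ} (X : Fin ν → L2v m V) (γ : Fin ν → ℝ)
    (hX : IsEigenbasis u L X γ)
    -- the last damping term is defined on L²(a dv)
    (hX0 : ∀ k, γ k = 0 → MemLp (shiftMul u (pinvShift u L (X k))) 2
      (velMeasure V (-ω₀))) :
    -- every element of Γ has a well-defined transport derivative and trace
    (∀ g ∈ Gam (V := V) (m := m) (ω₀ := ω₀) u,
      (∃! g' : L2xw m V (-ω₀), HasTransportDeriv V u
        (fun x => evenPart u (g x)) fun x => g' x) ∧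
      ∃! t : L2flux m V u, IsEvenTrace u g t) ∧
    -- L_d is coercive for small α
    (∃ α₀ : ℝ, 0 < α₀ ∧ ∀ α : ℝ, 0 < α → α ≤ α₀ → Coercive u L La X γ α) ∧
    ∀ α : ℝ, 0 < α → Coercive u L La X γ α →
    ∀ φ : Vel d → Val m,
      MemLp φ 2 ((velMeasure V ω₀).restrict (incoming d u)) →
      MemLp φ 2 ((fluxMeasure V u).restrict (incoming d u)) →
      -- (a)
      ∃ f : L2xw m V ω₀, IsVarSolution u L La X γ α φ f ∧
        (∀ f' : L2xw m V ω₀, IsVarSolution u L La X γ α φ f' → f' = f) ∧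
        -- (b)
        (∃ g : L2xw m V (-ω₀),
          HasTransportDeriv V u (fun x => f x) (fun x => g x) ∧
          ∃ t : L2flux m V u,
            IsTrace V u (fun x => f x) (fun x => g x) t ∧
            ∀ᵐ v ∂(volume.restrict V), v ∈ incoming d u → t v = φ v) ∧
        SolvesDamped u L La X γ α f ∧
        -- (c)
        (ω₀ = 1 → ∃ β : ℝ, 0 < β ∧
          MemLp f 2 ((volume.restrict (Ioi (0 : ℝ))).withDensity
            fun x => ENNReal.ofReal (Real.exp (2 * β * x)))) := by
  have hDL := fun α : ℝ => exists_dampedL (La := La) hω₀ (fun k => hP1 _ (hX.mem k)) hX0 α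
  refine ⟨fun g hg => ⟨existsUnique_transportDeriv hV hVu hω₀ hω₁ hg,
    existsUnique_isEvenTrace hV hVu hω₀ hω₁ hg⟩,
    exists_coercive hX hω₀ hA1 hA2 hA3 hA4 hP1 hX0, fun α _ hα φ _ hφ => ?_⟩
  obtain ⟨D, hD, -⟩ := hDL α
  obtain ⟨c, hc, hDc⟩ := hα.exists_forall hA1 hD
  exact wellPosed_of_coercive hV hVu hω₀ hω₁ hD hc hDc hφ
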